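/- Let $d\ge 3$ be odd. The distance-$d$ hexagonal 2D color code is the CSS stabilizer code on the triangular patch of the hexagonal (6.6.6) lattice with $n=(3d^2+1)/4$ qubits on the vertices, generated for every plaquette $P$ by $G_P=\prod_{v\in P}X_v$ and $H_P=\prod_{v\in P}Z_v$; for an edge $e$ of the lattice let $H_e=\prod_{v\in e}Z_v$. Let $E$ be a set of edges such that the operators $H_e$ ($e\in E$), along with the $H_P$, generate the operators $H_e$ of all edges. Take $d-1$ layers $l=1,\dots,d-1$, each carrying a copy of this code (operators marked by $(l)$, logical operators $X_L^{(l)}=X^{\otimes n}$, $Z_L^{(l)}=Z^{\otimes n}$), and a single ancilla qubit as layer $d$, with $X_L^{(d)}=X$, $Z_L^{(d)}=Z$. The $(d-1)+1$ stacked code is the code on these $(d-1)n+1$ qubits whose stabilizer group is generated, up to signs, by $$H_e^{(2k-1)}H_e^{(2k)},\quad H_P^{(2k-1)},\quad G_P^{(2k-1)}G_P^{(2k)},\quad H_P^{(2k-1)}H_P^{(2k)},\quad X_L^{(2k)}X_L^{(2k+1)},\quad Z_L^{(2k)}Z_L^{(2k+1)},$$ for all $1\le k\le (d-1)/2$, $e\in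 E$ and all plaquettes $P$. A stabilizer group defines a 3D color code if, for some 4-colorable simplicial triangulation of a closed connected 3-manifold and some tetrahedron $\sigma$ of it, the qubits can be identified with the tetrahedra other than $\sigma$ so that the group is generated by the operators $\prod_{t\ni v}X_t$ for the vertices $v\notin\sigma$ and $\prod_{t\supset \varepsilon}Z_t$ for the edges $\varepsilon\not\subset\sigma$. The distance of a stabilizer code is the least weight of a Pauli operator that commutes with all stabilizers and is not itself a stabilizer up to a phase. Then the hexagonal 2D color code is a stabilizer code (its generators commute) of distance exactly $d$, and the $(d-1)+1$ stacked code is a stabilizer code (its generators commute), is a 3D color code, and has distance exactly $d$. -/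

import Mathlib

/-! ### Pauli operators and stabilizer codes -/

/-- Pauli operators on the qubits `Q`, up to a phase, in symplectic form: the pair `(a, b)` stands
for the operator `∏ q, X_q ^ a q * Z_q ^ b q`. Addition is multiplication of operators up to a
phase. -/
abbrev Pauli (Q : Type) : Type := (Q → ZMod 2) × (Q → ZMod 2)

/-- The tensor product of Pauli `X` over the qubits in `s`. -/
noncomputable def xOp {Q : Type} (s : Set Q) : Pauli Q := (s.indicator 1, 0)

/-- The tensor product of Pauli `Z` over the qubits in `s`. -/
noncomputable def zOp {Q : Type} (s : Set Q) : Pauli Q := (0, s.indicator 1)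

/-- Two Pauli operators commute: their symplectic product vanishes. -/
def PauliCommute {Q : Type} [Fintype Q] (g h : Pauli Q) : Prop :=
  ∑ q, (g.1 q * h.2 q + g.2 q * h.1 q) = 0

/-- The number of qubits on which a Pauli operator acts nontrivially. -/
def pauliWeight {Q : Type} [Fintype Q] (g : Pauli Q) : ℕ :=
  (Finset.univ.filter fun q => g.1 q ≠ 0 ∨ g.2 q ≠ 0).card

/-- A group of Pauli operators (up to phases) is the stabilizer group of a code: its elements
commute pairwise. -/
def IsStabilizerGroup {Q : Type} [Fintype Q] (S : Submodule (ZMod 2) (Pauli Q)) : Prop :=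
  ∀ g ∈ S, ∀ h ∈ S, PauliCommute g h

/-- A nontrivial logical operator: it commutes with every stabilizer and is not a stabilizer. -/
def IsNontrivialLogical {Q : Type} [Fintype Q] (S : Submodule (ZMod 2) (Pauli Q))
    (g : Pauli Q) : Prop :=
  (∀ h ∈ S, PauliCommute g h) ∧ g ∉ S

/-- The code with stabilizer group `S` has distance exactly `d`: `d` is the least weight of a
nontrivial logical operator (and such an operator exists). -/
def HasCodeDistance {Q : Type} [Fintype Q] (S : Submodule (ZMod 2) (Pauli Q)) (d : ℕ) : Prop :=
  IsLeast {w : ℕ | ∃ g : Pauli Q, IsNontrivialLogical S g ∧ pauliWeight g = w} d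

/-! ### Three-dimensional color codes -/

/-- The faces of `K` that have exactly `n` vertices and contain `s`. -/
def facesOver {V : Type} (K : AbstractSimplicialComplex V) (n : ℕ) (s : Finset V) :
    Set (Finset V) :=
  {t | t ∈ K.faces ∧ t.card = n ∧ s ⊆ t}

/-- `K` is a finite triangulation, by tetrahedra, of a connected closed 3-manifold, and its
vertices are 4-colorable (every tetrahedron has vertices of all four colors). -/
structure IsFourColorableManifold {V : Type} (K : AbstractSimplicialComplex V) : Prop where
  finite : Finite V
  /-- Every face lies in a tetrahedron, and there is no face of higher dimension. -/
  pure : ∀ s ∈ K.faces, (facesOver K 4 s).Nonempty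
  colorable : ∃ color : V → Fin 4, ∀ s ∈ K.faces, Set.InjOn color s
  /-- Every triangle lies in exactly two tetrahedra. -/
  closed : ∀ s ∈ K.faces, s.card = 3 → (facesOver K 4 s).ncard = 2
  /-- `K` is connected, and so is the link of every face of dimension at most one: any two
  tetrahedra containing `s` (possibly empty) are joined by a chain of tetrahedra containing `s`,
  consecutive ones sharing a triangle which contains `s`. -/
  connected : ∀ s : Finset V, ∀ t ∈ facesOver K 4 s, ∀ t' ∈ facesOver K 4 s,
    Relation.ReflTransGen
      (fun a b => b ∈ facesOver K 4 s ∧ ∃ f ∈ facesOver K 3 s, f ⊆ a ∧ f ⊆ b) t t'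
  /-- The link of every vertex, a connected closed surface by the previous conditions, has Euler
  characteristic 2, so it is a 2-sphere. -/
  link_sphere : ∀ v : V, (facesOver K 2 {v}).ncard + (facesOver K 4 {v}).ncard
    = (facesOver K 3 {v}).ncard + 2

/-- `S` is the stabilizer group of a 3D color code, described on the dual lattice. The lattice `K`
is a 4-colorable triangulation of a closed 3-manifold with one tetrahedron `σ` removed; the four
vertices of `σ` represent the four colored boundaries. Qubits are the remaining tetrahedra. The
stabilizer group is generated by an `X` operator for every vertex not in `σ` (a cell of the primal
lattice), acting on the tetrahedra around this vertex, and a `Z` operator for every edge not in `σ`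
(a face of the primal lattice), acting on the tetrahedra around this edge. -/
def Is3DColorCode {Q : Type} (S : Submodule (ZMod 2) (Pauli Q)) : Prop :=
  ∃ (V : Type) (K : AbstractSimplicialComplex V) (σ : Finset V)
    (tet : Q ≃ {t : Finset V // t ∈ facesOver K 4 ∅ ∧ t ≠ σ}),
    IsFourColorableManifold K ∧ σ ∈ facesOver K 4 ∅ ∧
    S = Submodule.span (ZMod 2)
      ({g | ∃ v : V, v ∉ σ ∧ g = xOp {q | v ∈ (tet q).1}} ∪
       {g | ∃ e ∈ facesOver K 2 ∅, ¬ e ⊆ σ ∧ g = zOp {q | e ⊆ (tet q).1}})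

/-! ### The triangular hexagonal (6.6.6) 2D color code of distance `2 * m + 1`

Points of the triangular lattice are written `(a, b)`, with third barycentric coordinate
`3 * m - a - b`. In the triangle of side `3 * m`, the points with `a - b ≡ 1` modulo 3 are the
centers of the plaquettes, and all the other points are the qubits. The qubits around a center form
a hexagon, or a quadrilateral for a center on a side of the triangle. -/

/-- The points of the triangular lattice in the triangle of side `3 * m`. -/
noncomputable def trianglePoints (m : ℕ) : Finset (ℤ × ℤ) :=
  (Finset.Icc (0 : ℤ) (3 * m) ×ˢ Finset.Icc (0 : ℤ) (3 * m)).filter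
    fun p => p.1 + p.2 ≤ 3 * m

/-- The qubits of the 2D code. -/
abbrev HexQubit (m : ℕ) : Type :=
  {p : ℤ × ℤ // p ∈ (trianglePoints m).filter fun p => (p.1 - p.2) % 3 ≠ 1}

/-- The plaquettes of the 2D code, given by their centers. -/
abbrev HexPlaquette (m : ℕ) : Type :=
  {p : ℤ × ℤ // p ∈ (trianglePoints m).filter fun p => (p.1 - p.2) % 3 = 1}

/-- Nearest neighbors in the triangular lattice. -/
def Neighbors (p q : ℤ × ℤ) : Prop :=
  q - p ∈ ({(1, 0), (-1, 0), (0, 1), (0, -1), (1, -1), (-1, 1)} : Finset (ℤ × ℤ))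

/-- The qubits of a plaquette. -/
def plaquette (m : ℕ) (P : HexPlaquette m) : Set (HexQubit m) :=
  {v | Neighbors P.1 v.1}

/-- Two qubits lie on a common side of the triangle. -/
def SameSide (m : ℕ) (u v : HexQubit m) : Prop :=
  (u.1.1 = 0 ∧ v.1.1 = 0) ∨ (u.1.2 = 0 ∧ v.1.2 = 0) ∨
    (u.1.1 + u.1.2 = 3 * m ∧ v.1.1 + v.1.2 = 3 * m)

/-- The edges of the hexagonal lattice: they join neighboring qubits, and, along a side of the
triangle, the two qubits of a plaquette that lie on this side. -/
def hexGraph (m : ℕ) : SimpleGraph (HexQubit m) :=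
  SimpleGraph.fromRel fun u v =>
    Neighbors u.1 v.1 ∨ (SameSide m u v ∧ ∃ P, u ∈ plaquette m P ∧ v ∈ plaquette m P)

/-- The two qubits of an edge. -/
def edgeQubits {m : ℕ} (e : Sym2 (HexQubit m)) : Set (HexQubit m) := {v | v ∈ e}

/-- The stabilizer group of the 2D color code, generated by the `X` and `Z` plaquette operators. -/
noncomputable def hexCode (m : ℕ) : Submodule (ZMod 2) (Pauli (HexQubit m)) :=
  Submodule.span (ZMod 2)
    (Set.range (fun P => xOp (plaquette m P)) ∪ Set.range (fun P => zOp (plaquette m P)))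

/-- A set `E` of edges whose `Z` operators, along with the `Z` plaquette operators, generate the
`Z` operator of every edge of the lattice. -/
def IsGaugeEdgeSet (m : ℕ) (E : Set (Sym2 (HexQubit m))) : Prop :=
  E ⊆ (hexGraph m).edgeSet ∧
  ∀ e ∈ (hexGraph m).edgeSet, zOp (edgeQubits e) ∈ Submodule.span (ZMod 2)
    ((fun e => zOp (edgeQubits e)) '' E ∪ Set.range (fun P => zOp (plaquette m P)))

/-! ### The stacked code -/

/-- The qubits of the stack: `2 * m` copies of the 2D code, and a single ancilla qubit. -/
abbrev StackQubit (m : ℕ) : Type := (Fin (2 * m) × HexQubit m) ⊕ Unit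

/-- Layers are numbered from `1` to `2 * m + 1`; the last one is the ancilla qubit. -/
def layerOf {m : ℕ} : StackQubit m → ℕ
  | Sum.inl (i, _) => i + 1
  | Sum.inr _ => 2 * m + 1

/-- The copy on the layer `l` of a set of qubits of the 2D code. -/
def onLayer {m : ℕ} (l : ℕ) (s : Set (HexQubit m)) : Set (StackQubit m) :=
  {q | layerOf q = l ∧ ∃ i, ∃ v ∈ s, q = Sum.inl (i, v)}

/-- All qubits of the layer `l`. The `X` and `Z` operators on this set are the logical `X` and `Z`
operators of the layer. -/
def wholeLayer {m : ℕ} (l : ℕ) : Set (StackQubit m) := {q | layerOf q = l}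

/-- The stabilizer group of the `(d - 1) + 1` stacked code, `d = 2 * m + 1`, with the gauge edges
`E`. For `1 ≤ k ≤ m` it is generated by the weight-4 `Z` gauge operators of the layers `2 * k - 1`
and `2 * k`, the `Z` plaquettes of the layer `2 * k - 1`, the products of corresponding `X`
plaquettes, and of corresponding `Z` plaquettes, of these two layers, and the joint logical
`X` and `Z` (Bell) operators of the layers `2 * k` and `2 * k + 1`. -/
noncomputable def stackedCode (m : ℕ) (E : Set (Sym2 (HexQubit m))) :
    Submodule (ZMod 2) (Pauli (StackQubit m)) :=
  Submodule.span (ZMod 2) {g | ∃ k : ℕ, 1 ≤ k ∧ k ≤ m ∧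
    ((∃ e ∈ E, g = zOp (onLayer (2 * k - 1) (edgeQubits e)) + zOp (onLayer (2 * k) (edgeQubits e)))
    ∨ (∃ P, g = zOp (onLayer (2 * k - 1) (plaquette m P)))
    ∨ (∃ P, g = xOp (onLayer (2 * k - 1) (plaquette m P)) + xOp (onLayer (2 * k) (plaquette m P)))
    ∨ (∃ P, g = zOp (onLayer (2 * k - 1) (plaquette m P)) + zOp (onLayer (2 * k) (plaquette m P)))
    ∨ g = xOp (wholeLayer (2 * k)) + xOp (wholeLayer (2 * k + 1))
    ∨ g = zOp (wholeLayer (2 * k)) + zOp (wholeLayer (2 * k + 1)))}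

/-! All groups here are CSS, so each is a product of a space of X supports and a space of Z supports
over the field with two elements; commutation is orthogonality of the two, and the distance can be
bounded separately for X type and Z type operators.

The 2D code. A qubit `q` is recorded by `tri q`, its three surrounding plaquettes sorted by color,
with `none` where a side of the triangle takes the place of a plaquette. The two ends of an edge
share two of these labels. Pairing qubits along the edges opposite to a fixed color shows that
plaquettes overlap evenly. They are independent (`exists_pivot`), and there are `2p + 1` qubits for
`p` plaquettes, so the vectors orthogonal to all plaquettes are spanned by the plaquettes and the
all-ones vector (`exists_eq_of_orthogonal`). A nontrivial logical operator is therefore supported on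
the complement of a sum of marked plaquettes, and its weight is the number of qubits with an even
number of marked plaquettes around them. A discharging argument bounds this number
(`card_triVal_sum_eq_zero_ge`): `flux` assigns integers to the ends of edges so that each qubit
receives at most 3 if its number of marked plaquettes is even and at most 0 otherwise, while the
ends of an edge cancel except along the sides, which makes the total `3 * (2 * m + 1)` for every
marking. A side of the triangle attains the bound.

The distance of the stack. An X operator commuting with the Z stabilizers is orthogonal to the
plaquettes on every layer. If some layer has odd parity, the 2D bound applies to it; if not, the
double edges force the two layers of each pair to agree, and the operator is a stabilizer. For a Z
operator the 2D bound applies to the sum of the two layers of a pair, if that sum is odd for some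
pair. If not, the Bell operators make the parity the same on all layers: even parity gives a
stabilizer, odd parity forces a nonzero entry on each of the `2 * m + 1` layers.

The 3D color code. Take one tetrahedron per qubit and an extra tetrahedron at the bottom, which is
removed. Three vertices of a tetrahedron are the labels of its qubit, plaquettes being shared by the
layers `2k - 1` and `2k`; the fourth vertex is a cell shared by the layers `2k` and `2k + 1`. The
first layer shares its cell with the removed tetrahedron, and the last one with the ancilla.
Vertices outside the removed tetrahedron then give double plaquettes and Bell operators; edges give
single plaquettes, double lattice edges, and, up to plaquettes, Bell operators. The manifold axioms
are checked on labels (`isFourColorableManifold_labelComplex`): neighbors across triangles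
(`existsUnique_facetLabel`), connected stars (`facetLabel_chain`) and spherical links
(`euler_facetLabel`). -/

/-! ### Colored complexes given by a labelling of their facets -/

/-- The vertices used by a labelling: pairs of a color and a label of that color. -/
abbrev LabelVertex {F ι X : Type} (lab : F → ι → X) : Type :=
  {p : ι × X // ∃ f, lab f p.1 = p.2}

/-- The vertex of color `i` of the facet `f`. -/
def labelVertex {F ι X : Type} (lab : F → ι → X) (f : F) (i : ι) : LabelVertex lab :=
  ⟨(i, lab f i), f, rfl⟩

theorem labelVertex_injective {F ι X : Type} (lab : F → ι → X) (f : F) :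
    Function.Injective (labelVertex lab f) := fun _ _ h =>
  congrArg (fun v : LabelVertex lab => v.1.1) h

theorem finite_labelVertex {F ι X : Type} [Finite F] [Finite ι] (lab : F → ι → X) :
    Finite (LabelVertex lab) :=
  Finite.of_surjective (fun p : F × ι => labelVertex lab p.1 p.2)
    fun ⟨⟨i, _⟩, f, hf⟩ => ⟨(f, i), Subtype.ext (Prod.ext rfl hf)⟩

/-- The vertex set of the facet `f`. -/
def labelFacet {F ι X : Type} [Fintype ι] (lab : F → ι → X) (f : F) : Finset (LabelVertex lab) :=
  Finset.univ.map ⟨labelVertex lab f, labelVertex_injective lab f⟩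

theorem mem_labelFacet {F ι X : Type} [Fintype ι] {lab : F → ι → X} {f : F}
    {v : LabelVertex lab} : v ∈ labelFacet lab f ↔ lab f v.1.1 = v.1.2 := by
  obtain ⟨⟨i, x⟩, hv⟩ := v
  simp [labelFacet, labelVertex, Prod.ext_iff]

theorem labelVertex_mem {F ι X : Type} [Fintype ι] {lab : F → ι → X} {f g : F} {i : ι} :
    labelVertex lab g i ∈ labelFacet lab f ↔ lab f i = lab g i := mem_labelFacet

theorem card_labelFacet {F ι X : Type} [Fintype ι] (lab : F → ι → X) (f : F) :
    (labelFacet lab f).card = Fintype.card ι := by simp [labelFacet]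

theorem labelFacet_injective {F ι X : Type} [Fintype ι] {lab : F → ι → X}
    (inj : Function.Injective lab) : Function.Injective (labelFacet lab) := by
  intro f g h
  refine inj (funext fun i => ?_)
  have : labelVertex lab g i ∈ labelFacet lab f := h ▸ labelVertex_mem.2 rfl
  exact labelVertex_mem.1 this

/-- The complex whose facets are given by a labelling. -/
def labelComplex {F ι X : Type} [Fintype ι] (lab : F → ι → X) :
    AbstractSimplicialComplex (LabelVertex lab) where
  faces := {s | s.Nonempty ∧ ∃ f, s ⊆ labelFacet lab f}
  isRelLowerSet_faces := fun _ h => ⟨h.1, fun _ hb hn => ⟨hn, h.2.imp fun _ hf => hb.trans hf⟩⟩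
  singleton_mem := fun v => ⟨Finset.singleton_nonempty v, v.2.imp fun f hf => by
    simpa [mem_labelFacet] using hf⟩

section labelComplex

variable {F ι X : Type} [Fintype ι] {lab : F → ι → X}

theorem facesOver_four (hι : Fintype.card ι = 4) (s : Finset (LabelVertex lab)) :
    facesOver (labelComplex lab) 4 s = labelFacet lab '' {f | s ⊆ labelFacet lab f} := by
  ext t
  constructor
  · rintro ⟨⟨-, f, hf⟩, hc, hs⟩
    have : t = labelFacet lab f :=
      Finset.eq_of_subset_of_card_le hf (by rw [card_labelFacet, hc, hι])
    exact ⟨f, (show s ⊆ labelFacet lab f from this ▸ hs), this.symm⟩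
  · rintro ⟨f, hf, rfl⟩
    refine ⟨⟨?_, f, subset_rfl⟩, by rw [card_labelFacet, hι], hf⟩
    rw [← Finset.card_pos, card_labelFacet, hι]; norm_num

/-- The face of the facet `f` opposite to its vertex of color `i`. -/
def labelFace [DecidableEq ι] (lab : F → ι → X) (f : F) (i : ι) : Finset (LabelVertex lab) :=
  (Finset.univ.erase i).map ⟨labelVertex lab f, labelVertex_injective lab f⟩

theorem mem_labelFace [DecidableEq ι] {f : F} {i : ι} {v : LabelVertex lab} :
    v ∈ labelFace lab f i ↔ v.1.1 ≠ i ∧ lab f v.1.1 = v.1.2 := by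
  obtain ⟨⟨j, x⟩, hv⟩ := v
  simp only [labelFace, labelVertex, Finset.mem_map, Finset.mem_erase, Finset.mem_univ,
    Function.Embedding.coeFn_mk, Subtype.mk.injEq, Prod.mk.injEq]
  constructor
  · rintro ⟨k, hk, rfl, h⟩
    exact ⟨hk.1, h⟩
  · rintro ⟨h1, h2⟩
    exact ⟨j, ⟨h1, trivial⟩, rfl, h2⟩

theorem labelFace_mem_facesOver [DecidableEq ι] (hι : Fintype.card ι = 4) {f : F} {i : ι}
    {s : Finset (LabelVertex lab)} (hs : s ⊆ labelFacet lab f) (hi : ∀ v ∈ s, v.1.1 ≠ i) :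
    labelFace lab f i ∈ facesOver (labelComplex lab) 3 s := by
  have hc : (labelFace lab f i).card = 3 := by
    simp [labelFace, Finset.card_erase_of_mem, hι]
  refine ⟨⟨?_, f, fun v hv => mem_labelFacet.2 (mem_labelFace.1 hv).2⟩, hc, fun v hv =>
    mem_labelFace.2 ⟨hi v hv, mem_labelFacet.1 (hs hv)⟩⟩
  rw [← Finset.card_pos, hc]; norm_num

theorem exists_eq_labelFace [DecidableEq ι] (hι : Fintype.card ι = 4) {f : F}
    {s : Finset (LabelVertex lab)} (hs : s ⊆ labelFacet lab f) (hc : s.card = 3) :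
    ∃ i, s = labelFace lab f i := by
  obtain ⟨i, hi⟩ : ∃ i, labelVertex lab f i ∉ s := by
    by_contra! h
    have : labelFacet lab f ⊆ s := fun v hv => by
      obtain ⟨i, -, rfl⟩ := Finset.mem_map.1 hv
      exact h i
    have := Finset.card_le_card this
    rw [card_labelFacet] at this
    omega
  refine ⟨i, Finset.eq_of_subset_of_card_le (fun v hv => mem_labelFace.2 ⟨?_, ?_⟩) ?_⟩
  · rintro rfl
    refine hi ?_
    have := mem_labelFacet.1 (hs hv)
    convert hv using 1
    exact Subtype.ext (Prod.ext rfl this)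
  · exact mem_labelFacet.1 (hs hv)
  · simp [labelFace, Finset.card_erase_of_mem, hι, hc]

theorem ncard_facesOver_labelFace [DecidableEq ι] (hι : Fintype.card ι = 4)
    (inj : Function.Injective lab)
    (closed : ∀ f i, ∃! g, g ≠ f ∧ ∀ j, j ≠ i → lab g j = lab f j) (f : F) (i : ι) :
    (facesOver (labelComplex lab) 4 (labelFace lab f i)).ncard = 2 := by
  obtain ⟨g, ⟨hgf, hg⟩, huniq⟩ := closed f i
  have hsub : ∀ h, labelFace lab f i ⊆ labelFacet lab h ↔ ∀ j, j ≠ i → lab h j = lab f j := by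
    intro h
    constructor
    · intro hh j hj
      exact labelVertex_mem.1 (hh (mem_labelFace (v := labelVertex lab f j).2 ⟨hj, rfl⟩))
    · intro hh v hv
      obtain ⟨h1, h2⟩ := mem_labelFace.1 hv
      exact mem_labelFacet.2 ((hh _ h1).trans h2)
  have : {h | labelFace lab f i ⊆ labelFacet lab h} = {f, g} := by
    ext h
    simp only [Set.mem_ofPred_eq, hsub, Set.mem_insert_iff, Set.mem_singleton_iff]
    constructor
    · intro hh
      by_cases hf : h = f
      · exact Or.inl hf
      · exact Or.inr (huniq h ⟨hf, hh⟩)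
    · rintro (rfl | rfl)
      · exact fun _ _ => rfl
      · exact hg
  rw [facesOver_four hι, this, Set.ncard_image_of_injective _ (labelFacet_injective inj),
    Set.ncard_pair hgf.symm]

/-- Double counting in the star of `v`: each triangle through `v` lies in two tetrahedra, and each
tetrahedron through `v` has three triangles through `v`. This eliminates triangles from the Euler
characteristic of the link. -/
theorem ncard_facesOver_three [Finite F] [DecidableEq ι] (hι : Fintype.card ι = 4)
    (inj : Function.Injective lab)
    (closed : ∀ f i, ∃! g, g ≠ f ∧ ∀ j, j ≠ i → lab g j = lab f j) (v : LabelVertex lab) :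
    2 * (facesOver (labelComplex lab) 3 {v}).ncard
      = 3 * (facesOver (labelComplex lab) 4 {v}).ncard := by
  classical
  have hfin := finite_labelVertex lab
  have h3 : (facesOver (labelComplex lab) 3 {v}).Finite := Set.toFinite _
  have h4 : (facesOver (labelComplex lab) 4 {v}).Finite := Set.toFinite _
  have key := Finset.sum_card_bipartiteAbove_eq_sum_card_bipartiteBelow
    (s := h3.toFinset) (t := h4.toFinset) (fun a b => a ⊆ b)
  rw [Set.ncard_eq_toFinset_card _ h3, Set.ncard_eq_toFinset_card _ h4]
  have e1 : ∀ a ∈ h3.toFinset,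
      (Finset.bipartiteAbove (fun a b => a ⊆ b) h4.toFinset a).card = 2 := by
    intro a ha
    rw [Set.Finite.mem_toFinset] at ha
    obtain ⟨f, hf⟩ := ha.1.2
    obtain ⟨i, hi⟩ := exists_eq_labelFace hι hf ha.2.1
    rw [← ncard_facesOver_labelFace hι inj closed f i, ← hi, ← Set.ncard_coe_finset]
    congr 1
    ext b
    simp only [Finset.bipartiteAbove, Finset.coe_filter, Set.Finite.mem_toFinset,
      Set.mem_ofPred_eq, facesOver]
    constructor
    · rintro ⟨⟨h1, h2, -⟩, h3⟩
      exact ⟨h1, h2, h3⟩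
    · rintro ⟨h1, h2, h3⟩
      exact ⟨⟨h1, h2, ha.2.2.trans h3⟩, h3⟩
  have e2 : ∀ b ∈ h4.toFinset,
      (Finset.bipartiteBelow (fun a b => a ⊆ b) h3.toFinset b).card = 3 := by
    intro b hb
    rw [Set.Finite.mem_toFinset] at hb
    obtain ⟨⟨-, f, hf⟩, hc, hv⟩ := hb
    have hvb : v ∈ b := hv (Finset.mem_singleton_self v)
    -- The triangles through `v` in `b` arise by deleting one of the other three vertices.
    have : Finset.bipartiteBelow (fun a b => a ⊆ b) h3.toFinset b = (b.erase v).image b.erase := by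
      ext a
      simp only [Finset.bipartiteBelow, Finset.mem_filter, Set.Finite.mem_toFinset,
        Finset.mem_image, Finset.mem_erase]
      constructor
      · rintro ⟨⟨-, hac, hva⟩, hab⟩
        obtain ⟨w, hw⟩ : ∃ w, b \ a = {w} := by
          rw [← Finset.card_eq_one, Finset.card_sdiff_of_subset hab, hac, hc]
        have hwm : w ∈ b \ a := hw ▸ Finset.mem_singleton_self w
        rw [Finset.mem_sdiff] at hwm
        refine ⟨w, ⟨?_, hwm.1⟩, ?_⟩
        · rintro rfl
          exact hwm.2 (hva (Finset.mem_singleton_self _))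
        · rw [← Finset.sdiff_singleton_eq_erase, ← hw, Finset.sdiff_sdiff_eq_self hab]
      · rintro ⟨w, ⟨hwv, hwb⟩, rfl⟩
        refine ⟨⟨⟨⟨v, Finset.mem_erase.2 ⟨hwv.symm, hvb⟩⟩, f,
          (Finset.erase_subset _ _).trans hf⟩, ?_, ?_⟩, Finset.erase_subset _ _⟩
        · rw [Finset.card_erase_of_mem hwb, hc]
        · simpa using ⟨hwv.symm, hvb⟩
    rw [this, Finset.card_image_of_injOn, Finset.card_erase_of_mem hvb, hc]
    intro w hw w' hw' h
    simp only [Finset.coe_erase, Set.mem_sdiff, Finset.mem_coe] at hw hw'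
    by_contra hne
    have : w ∈ b.erase w' := Finset.mem_erase.2 ⟨hne, hw.1⟩
    rw [← show b.erase w = b.erase w' from h] at this
    simp at this
  rw [Finset.sum_congr rfl e1, Finset.sum_congr rfl e2] at key
  simp only [Finset.sum_const, smul_eq_mul] at key
  omega

/-- An edge at a vertex is determined by its other end, whose color differs from `i`; so the edges
are counted by the color `j` of that end and the labels which occur there. -/
theorem ncard_facesOver_two [Fintype F] [DecidableEq ι] [DecidableEq X] (i : ι) (x : X)
    (hx : ∃ f, lab f i = x) :
    (facesOver (labelComplex lab) 2 {⟨(i, x), hx⟩}).ncard = ∑ j ∈ Finset.univ.erase i,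
      ((Finset.univ.filter fun f => lab f i = x).image fun f => lab f j).card := by
  classical
  have hfin := finite_labelVertex lab
  have := Fintype.ofFinite (LabelVertex lab)
  set v : LabelVertex lab := ⟨(i, x), hx⟩ with hv
  let N : Finset (LabelVertex lab) := Finset.univ.filter fun w =>
    w.1.1 ≠ i ∧ ∃ f, lab f i = x ∧ lab f w.1.1 = w.1.2
  have hN : facesOver (labelComplex lab) 2 {v} = ↑(N.image fun w => ({v, w} : Finset (LabelVertex lab))) := by
    ext s
    simp only [facesOver, Finset.coe_image, Set.mem_image, Finset.mem_coe, Set.mem_ofPred_eq,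
      Finset.singleton_subset_iff, N, Finset.mem_filter, Finset.mem_univ, true_and]
    constructor
    · rintro ⟨⟨-, f, hf⟩, hc, hvs⟩
      obtain ⟨a, b, hab, rfl⟩ := Finset.card_eq_two.1 hc
      have : ∃ w, w ≠ v ∧ ({a, b} : Finset (LabelVertex lab)) = {v, w} := by
        rcases Finset.mem_insert.1 hvs with h | h
        · exact ⟨b, by rw [h]; exact hab.symm, by rw [h]⟩
        · rw [Finset.mem_singleton] at h
          exact ⟨a, by rw [h]; exact hab, by rw [h, Finset.pair_comm]⟩
      obtain ⟨w, hw, hs⟩ := this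
      rw [hs] at hf
      have h1 := mem_labelFacet.1 (hf (Finset.mem_insert_self v _))
      have h2 := mem_labelFacet.1 (hf (Finset.mem_insert_of_mem (Finset.mem_singleton_self w)))
      refine ⟨w, ⟨fun hi => hw (Subtype.ext (Prod.ext hi ?_)), f, h1, h2⟩, hs.symm⟩
      rw [← h2, hi]; exact h1
    · rintro ⟨w, ⟨hwi, f, h1, h2⟩, rfl⟩
      refine ⟨⟨Finset.insert_nonempty _ _, f, ?_⟩, Finset.card_pair ?_, Finset.mem_insert_self _ _⟩
      · intro u hu
        rcases Finset.mem_insert.1 hu with rfl | hu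
        · exact mem_labelFacet.2 h1
        · rw [Finset.mem_singleton] at hu
          subst hu
          exact mem_labelFacet.2 h2
      · rintro rfl
        exact hwi rfl
  rw [hN, Set.ncard_coe_finset, Finset.card_image_of_injOn,
    Finset.card_eq_sum_card_fiberwise (f := fun w : LabelVertex lab => w.1.1)
      (t := Finset.univ.erase i)]
  · refine Finset.sum_congr rfl fun j hj => ?_
    refine Finset.card_bij (fun w _ => w.1.2) ?_ ?_ ?_
    · intro w hw
      simp only [N, Finset.mem_filter, Finset.mem_univ, true_and] at hw
      obtain ⟨⟨-, f, h1, h2⟩, rfl⟩ := hw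
      exact Finset.mem_image.2 ⟨f, by simpa using h1, h2⟩
    · intro w hw w' hw' h
      simp only [Finset.mem_filter] at hw hw'
      exact Subtype.ext (Prod.ext (hw.2.trans hw'.2.symm) h)
    · intro y hy
      obtain ⟨f, hf, rfl⟩ := Finset.mem_image.1 hy
      simp only [Finset.mem_filter, Finset.mem_univ, true_and] at hf
      refine ⟨labelVertex lab f j, ?_, rfl⟩
      simp only [N, Finset.mem_filter, Finset.mem_univ, true_and]
      exact ⟨⟨(Finset.mem_erase.1 hj).1, f, hf, rfl⟩, rfl⟩
  · intro w hw
    simp only [N, Finset.coe_filter, Finset.mem_univ, true_and, Set.mem_ofPred_eq] at hw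
    simpa using hw.1
  · intro w hw w' hw' h
    simp only [N, Finset.coe_filter, Finset.mem_univ, true_and, Set.mem_ofPred_eq] at hw hw'
    have hwv : w ≠ v := by rintro rfl; exact hw.1 rfl
    have : w ∈ ({v, w'} : Finset (LabelVertex lab)) := by
      rw [← show ({v, w} : Finset (LabelVertex lab)) = {v, w'} from h]; simp
    simpa [hwv] using this

end labelComplex

/-- A labelling of facets by vertices of four colors describes a 3-manifold if it is injective,
every facet has exactly one neighbor across each of its triangles, the stars are connected, and
the links of vertices have the Euler characteristic of a sphere. -/
theorem isFourColorableManifold_labelComplex {F ι X : Type} [Fintype F] [Fintype ι]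
    [DecidableEq ι] [DecidableEq X] (lab : F → ι → X) (hι : Fintype.card ι = 4)
    (inj : Function.Injective lab)
    (closed : ∀ f i, ∃! g, g ≠ f ∧ ∀ j, j ≠ i → lab g j = lab f j)
    (conn : ∀ f g, Relation.ReflTransGen (fun a b =>
      (∀ j, lab f j = lab g j → lab a j = lab f j ∧ lab b j = lab f j) ∧
        ∃ i, lab f i ≠ lab g i ∧ ∀ j, j ≠ i → lab a j = lab b j) f g)
    (euler : ∀ i x, (∃ f, lab f i = x) → 2 * ∑ j ∈ Finset.univ.erase i,
      ((Finset.univ.filter fun f => lab f i = x).image fun f => lab f j).card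
        = (Finset.univ.filter fun f => lab f i = x).card + 4) :
    IsFourColorableManifold (labelComplex lab) where
  finite := finite_labelVertex lab
  pure := by
    rintro s ⟨-, f, hf⟩
    rw [facesOver_four hι]
    exact ⟨_, f, hf, rfl⟩
  colorable := by
    refine ⟨fun v => Fintype.equivFinOfCardEq hι v.1.1, ?_⟩
    rintro s ⟨-, f, hf⟩ v hv w hw h
    have h1 := mem_labelFacet.1 (hf hv)
    have h2 := mem_labelFacet.1 (hf hw)
    have h3 : v.1.1 = w.1.1 := (Fintype.equivFinOfCardEq hι).injective h
    exact Subtype.ext (Prod.ext h3 (by rw [← h1, ← h2, h3]))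
  closed := by
    rintro s ⟨-, f, hf⟩ hc
    obtain ⟨i, rfl⟩ := exists_eq_labelFace hι hf hc
    exact ncard_facesOver_labelFace hι inj closed f i
  connected := by
    intro s t ht t' ht'
    rw [facesOver_four hι] at ht ht'
    obtain ⟨f, hf, rfl⟩ := ht
    obtain ⟨g, hg, rfl⟩ := ht'
    refine (conn f g).lift (labelFacet lab) ?_
    rintro a b ⟨hab, i, hi, h⟩
    have hs : ∀ v ∈ s, lab f v.1.1 = lab g v.1.1 := fun v hv =>
      (mem_labelFacet.1 (hf hv)).trans (mem_labelFacet.1 (hg hv)).symm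
    have ha : s ⊆ labelFacet lab a := fun v hv => mem_labelFacet.2
      ((hab _ (hs v hv)).1.trans (mem_labelFacet.1 (hf hv)))
    have hb : s ⊆ labelFacet lab b := fun v hv => mem_labelFacet.2
      ((hab _ (hs v hv)).2.trans (mem_labelFacet.1 (hf hv)))
    rw [facesOver_four hι]
    -- The vertices of `s` are common to `f` and `g`, so none of them has the color `i` in which `f`
    -- and `g` differ. The triangle opposite to color `i` hence still contains `s`.
    refine ⟨⟨b, hb, rfl⟩, labelFace lab a i, labelFace_mem_facesOver hι ha ?_, ?_, ?_⟩
    · rintro v hv rfl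
      exact hi (hs v hv)
    · exact fun v hv => mem_labelFacet.2 (mem_labelFace.1 hv).2
    · intro v hv
      obtain ⟨h1, h2⟩ := mem_labelFace.1 hv
      exact mem_labelFacet.2 ((h _ h1).symm.trans h2)
  link_sphere := by
    rintro ⟨⟨i, x⟩, hx⟩
    -- If the link has `V` vertices, `E` edges and `F` triangles, then `2E = 3F`, and `V + F = E +
    -- 2` becomes the hypothesis `2V = F + 4`.
    have h3 := ncard_facesOver_three hι inj closed ⟨(i, x), hx⟩
    have h2 := ncard_facesOver_two i x hx
    have h4 : (facesOver (labelComplex lab) 4 {⟨(i, x), hx⟩}).ncard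
        = (Finset.univ.filter fun f => lab f i = x).card := by
      rw [facesOver_four hι, Set.ncard_image_of_injective _ (labelFacet_injective inj),
        ← Set.ncard_coe_finset]
      congr 1
      ext f
      simp [mem_labelFacet]
    have := euler i x hx
    omega

/-- The facet `none` serves as the removed tetrahedron. Vertices become pairs of a color and an
occurring label, edges become two such pairs of distinct colors that occur on a common facet. -/
theorem is3DColorCode_of_labelling {Q ι X : Type} [Fintype Q] [Fintype ι]
    [DecidableEq ι] [DecidableEq X] (lab : Option Q → ι → X) (hι : Fintype.card ι = 4)
    (inj : Function.Injective lab) (man : IsFourColorableManifold (labelComplex lab)) :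
    Is3DColorCode (Submodule.span (ZMod 2)
      ({g | ∃ i x, (∃ f, lab f i = x) ∧ lab none i ≠ x ∧ g = xOp {q | lab (some q) i = x}} ∪
       {g | ∃ i j x y, i ≠ j ∧ (∃ f, lab f i = x ∧ lab f j = y) ∧
        ¬ (lab none i = x ∧ lab none j = y) ∧
        g = zOp {q | lab (some q) i = x ∧ lab (some q) j = y}})) := by
  classical
  have hfo : ∀ t, t ∈ facesOver (labelComplex lab) 4 ∅ ↔ ∃ f, labelFacet lab f = t := by
    intro t; rw [facesOver_four hι]; simp
  have hbij : Function.Bijective (fun q : Q => (⟨labelFacet lab (some q), (hfo _).2 ⟨_, rfl⟩,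
      fun h => Option.some_ne_none q (labelFacet_injective inj h)⟩ :
      {t // t ∈ facesOver (labelComplex lab) 4 ∅ ∧ t ≠ labelFacet lab none})) := by
    constructor
    · intro q q' h
      exact Option.some_injective _ (labelFacet_injective inj (congrArg Subtype.val h))
    · rintro ⟨t, ht, hne⟩
      obtain ⟨f, rfl⟩ := (hfo t).1 ht
      cases f with
      | none => exact absurd rfl hne
      | some q => exact ⟨q, rfl⟩
  refine ⟨LabelVertex lab, labelComplex lab, labelFacet lab none, Equiv.ofBijective _ hbij, man,
    (hfo _).2 ⟨_, rfl⟩, ?_⟩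
  congr 1
  congr 1
  · ext g
    constructor
    · rintro ⟨i, x, hx, hn, rfl⟩
      refine ⟨⟨(i, x), hx⟩, fun h => hn (mem_labelFacet.1 h), ?_⟩
      congr 1
      ext q
      simp [mem_labelFacet]
    · rintro ⟨⟨⟨i, x⟩, hx⟩, hv, rfl⟩
      refine ⟨i, x, hx, fun h => hv (mem_labelFacet.2 h), ?_⟩
      congr 1
      ext q
      simp [mem_labelFacet]
  · ext g
    constructor
    · rintro ⟨i, j, x, y, hij, ⟨f, hx, hy⟩, hn, rfl⟩
      have hsub : ∀ h, ({⟨(i, x), f, hx⟩, ⟨(j, y), f, hy⟩} : Finset (LabelVertex lab)) ⊆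
          labelFacet lab h ↔ lab h i = x ∧ lab h j = y := by
        intro h
        simp [Finset.insert_subset_iff, mem_labelFacet]
      refine ⟨{⟨(i, x), f, hx⟩, ⟨(j, y), f, hy⟩}, ⟨⟨Finset.insert_nonempty _ _, f,
        (hsub f).2 ⟨hx, hy⟩⟩, Finset.card_pair ?_, Finset.empty_subset _⟩, ?_, ?_⟩
      · intro h
        exact hij (congrArg (fun v : LabelVertex lab => v.1.1) h)
      · rw [hsub]; exact hn
      · congr 1
        ext q
        exact (hsub (some q)).symm
    · rintro ⟨e, ⟨⟨-, f, hf⟩, hc, -⟩, hn, rfl⟩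
      obtain ⟨v, w, hvw, rfl⟩ := Finset.card_eq_two.1 hc
      have hsub : ∀ h, ({v, w} : Finset (LabelVertex lab)) ⊆
          labelFacet lab h ↔ lab h v.1.1 = v.1.2 ∧ lab h w.1.1 = w.1.2 := by
        intro h
        simp [Finset.insert_subset_iff, mem_labelFacet]
      rw [hsub] at hf hn
      refine ⟨v.1.1, w.1.1, v.1.2, w.1.2, ?_, ⟨f, hf⟩, hn, ?_⟩
      · intro h
        exact hvw (Subtype.ext (Prod.ext h (by rw [← hf.1, ← hf.2, h])))
      · congr 1
        ext q
        exact hsub (some q)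

/-! ### Coordinates: the plaquettes and sides around a qubit -/

theorem mem_trianglePoints {m : ℕ} {p : ℤ × ℤ} :
    p ∈ trianglePoints m ↔ 0 ≤ p.1 ∧ 0 ≤ p.2 ∧ p.1 + p.2 ≤ 3 * m := by
  simp only [trianglePoints, Finset.mem_filter, Finset.mem_product, Finset.mem_Icc]
  constructor
  · rintro ⟨⟨⟨h1, h2⟩, h3, h4⟩, h5⟩
    exact ⟨h1, h3, h5⟩
  · rintro ⟨h1, h2, h3⟩
    exact ⟨⟨⟨h1, by omega⟩, h2, by omega⟩, h3⟩

theorem mem_hexQubit {m : ℕ} {p : ℤ × ℤ} :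
    (p ∈ (trianglePoints m).filter fun p => (p.1 - p.2) % 3 ≠ 1) ↔
      (0 ≤ p.1 ∧ 0 ≤ p.2 ∧ p.1 + p.2 ≤ 3 * m) ∧ (p.1 - p.2) % 3 ≠ 1 := by
  rw [Finset.mem_filter, mem_trianglePoints]

theorem mem_hexPlaquette {m : ℕ} {p : ℤ × ℤ} :
    (p ∈ (trianglePoints m).filter fun p => (p.1 - p.2) % 3 = 1) ↔
      (0 ≤ p.1 ∧ 0 ≤ p.2 ∧ p.1 + p.2 ≤ 3 * m) ∧ (p.1 - p.2) % 3 = 1 := by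
  rw [Finset.mem_filter, mem_trianglePoints]

theorem neighbors_iff {p q : ℤ × ℤ} : Neighbors p q ↔
    (q.1 = p.1 + 1 ∧ q.2 = p.2) ∨ (q.1 = p.1 - 1 ∧ q.2 = p.2) ∨
    (q.1 = p.1 ∧ q.2 = p.2 + 1) ∨ (q.1 = p.1 ∧ q.2 = p.2 - 1) ∨
    (q.1 = p.1 + 1 ∧ q.2 = p.2 - 1) ∨ (q.1 = p.1 - 1 ∧ q.2 = p.2 + 1) := by
  simp only [Neighbors, Finset.mem_insert, Finset.mem_singleton, Prod.ext_iff, Prod.fst_sub,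
    Prod.snd_sub]
  omega

/-- The center of color `i` next to the point `p`. -/
def centerOf (i : Fin 3) (p : ℤ × ℤ) : ℤ × ℤ :=
  if (p.1 - p.2) % 3 = 0 then
    -- A center of color `i` has first coordinate congruent to `i + 2` modulo 3, and the first
    -- coordinates of the three centers around `p` differ by `0`, `1` and `-1` from that of `p`. The
    -- residue therefore selects the center.
    if ((i : ℤ) + 2 - p.1) % 3 = 0 then (p.1, p.2 - 1)
    else if ((i : ℤ) + 2 - p.1) % 3 = 1 then (p.1 + 1, p.2) else (p.1 - 1, p.2 + 1)
  else
    if ((i : ℤ) + 2 - p.1) % 3 = 0 then (p.1, p.2 + 1)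
    else if ((i : ℤ) + 2 - p.1) % 3 = 1 then (p.1 + 1, p.2 - 1) else (p.1 - 1, p.2)

/-- The distance to the side `i` of the triangle. -/
def sideCoord (m : ℕ) (i : Fin 3) (p : ℤ × ℤ) : ℤ :=
  if i = 0 then p.1 else if i = 1 then p.2 else 3 * m - p.1 - p.2

/-- The color of a plaquette. -/
def plaqColor {m : ℕ} (P : HexPlaquette m) : Fin 3 :=
  ⟨((P.1.1 + 1) % 3).toNat, by omega⟩

theorem plaqColor_eq_iff {m : ℕ} {P : HexPlaquette m} {i : Fin 3} :
    plaqColor P = i ↔ (P.1.1 + 1) % 3 = i := by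
  rw [Fin.ext_iff, plaqColor]
  simp only
  omega

/-- The three plaquettes around a qubit, by color; `none` if the qubit lies on the side of the
triangle without plaquettes of this color. -/
noncomputable def tri {m : ℕ} (q : HexQubit m) (i : Fin 3) : Option (HexPlaquette m) :=
  if h : centerOf i q.1 ∈ (trianglePoints m).filter fun p => (p.1 - p.2) % 3 = 1
  then some ⟨_, h⟩ else none

theorem qubit_facts {m : ℕ} (q : HexQubit m) :
    0 ≤ q.1.1 ∧ 0 ≤ q.1.2 ∧ q.1.1 + q.1.2 ≤ 3 * m ∧
      ((q.1.1 - q.1.2) % 3 = 0 ∨ (q.1.1 - q.1.2) % 3 = 2) := by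
  have := mem_hexQubit.1 q.2
  omega

theorem plaquette_facts {m : ℕ} (P : HexPlaquette m) :
    0 ≤ P.1.1 ∧ 0 ≤ P.1.2 ∧ P.1.1 + P.1.2 ≤ 3 * m ∧ (P.1.1 - P.1.2) % 3 = 1 := by
  have := mem_hexPlaquette.1 P.2
  omega

/-- Colors and sides are numbered to match: next to a qubit on the side `i`, the center of color `i`
would be one step outside the triangle, and no other center can leave the triangle through that
side. -/
theorem tri_eq_none_iff {m : ℕ} {q : HexQubit m} {i : Fin 3} :
    tri q i = none ↔ sideCoord m i q.1 = 0 := by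
  obtain ⟨h1, h2, h3, h4⟩ := qubit_facts q
  rw [tri, dite_eq_right_iff]
  simp only [reduceCtorEq, imp_false, mem_hexPlaquette, centerOf, sideCoord]
  fin_cases i <;> simp <;> split_ifs <;> simp <;> omega

theorem tri_eq_some_iff {m : ℕ} {q : HexQubit m} {i : Fin 3} {P : HexPlaquette m} :
    tri q i = some P ↔ plaqColor P = i ∧ q ∈ plaquette m P := by
  obtain ⟨h1, h2, h3, h4⟩ := qubit_facts q
  obtain ⟨k1, k2, k3, k4⟩ := plaquette_facts P
  have hP : tri q i = some P ↔ centerOf i q.1 = P.1 := by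
    rw [tri]
    constructor
    · intro h
      split_ifs at h with h'
      exact congrArg (fun P => P.1) (Option.some.inj h)
    · intro h
      rw [dif_pos (h ▸ P.2)]
      exact congrArg some (Subtype.ext h)
  rw [hP, plaqColor_eq_iff, plaquette, Set.mem_ofPred_eq, neighbors_iff, Prod.ext_iff, centerOf]
  fin_cases i <;> simp <;> split_ifs <;> simp <;> omega

theorem tri_congr {m : ℕ} {u v : HexQubit m} {i : Fin 3} (h : centerOf i u.1 = centerOf i v.1) :
    tri u i = tri v i := by
  unfold tri
  simp only [h]

theorem tri_eq_tri_iff {m : ℕ} {u v : HexQubit m} {i : Fin 3} :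
    tri u i = tri v i ↔ (sideCoord m i u.1 = 0 ∧ sideCoord m i v.1 = 0) ∨
      centerOf i u.1 = centerOf i v.1 := by
  constructor
  · intro h
    cases hu : tri u i with
    | none => exact Or.inl ⟨tri_eq_none_iff.1 hu, tri_eq_none_iff.1 (h ▸ hu)⟩
    | some P =>
      have hv := h ▸ hu
      unfold tri at hu hv
      split_ifs at hu hv
      exact Or.inr (congrArg Subtype.val (Option.some.inj (hu.trans hv.symm)))
  · rintro (⟨h1, h2⟩ | h)
    · rw [tri_eq_none_iff.2 h1, tri_eq_none_iff.2 h2]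
    · exact tri_congr h

/-- Qubits come in two types, `u.1 - u.2` being `0` or `2` modulo 3 (the two classes of the
bipartite hexagonal lattice). Around a center, the qubits of one type form a triangle; the residue
tells in which direction from `u` the center lies, and so where the other two are. -/
theorem sub_of_centerOf_eq_zero {i : Fin 3} {u v : ℤ × ℤ} (hu : (u.1 - u.2) % 3 = 0)
    (hv : (v.1 - v.2) % 3 = 0) (h : centerOf i u = centerOf i v) :
    (v.1 = u.1 ∧ v.2 = u.2) ∨
    (((i : ℤ) + 2 - u.1) % 3 = 0 ∧
      ((v.1 = u.1 - 1 ∧ v.2 = u.2 - 1) ∨ (v.1 = u.1 + 1 ∧ v.2 = u.2 - 2))) ∨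
    (((i : ℤ) + 2 - u.1) % 3 = 1 ∧
      ((v.1 = u.1 + 1 ∧ v.2 = u.2 + 1) ∨ (v.1 = u.1 + 2 ∧ v.2 = u.2 - 1))) ∨
    (((i : ℤ) + 2 - u.1) % 3 = 2 ∧
      ((v.1 = u.1 - 1 ∧ v.2 = u.2 + 2) ∨ (v.1 = u.1 - 2 ∧ v.2 = u.2 + 1))) := by
  rw [centerOf, centerOf] at h
  have hr : ((i : ℤ) + 2 - u.1) % 3 = 0 ∨ ((i : ℤ) + 2 - u.1) % 3 = 1 ∨
    ((i : ℤ) + 2 - u.1) % 3 = 2 := by omega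
  have hs : ((i : ℤ) + 2 - v.1) % 3 = 0 ∨ ((i : ℤ) + 2 - v.1) % 3 = 1 ∨
    ((i : ℤ) + 2 - v.1) % 3 = 2 := by omega
  rcases hr with hr | hr | hr <;> rcases hs with hs | hs | hs <;>
    simp [hu, hv, hr, hs] at h <;>
    first
    | exact Or.inl ⟨by omega, by omega⟩
    | exact Or.inr (Or.inl ⟨hr, by omega⟩)
    | exact Or.inr (Or.inr (Or.inl ⟨hr, by omega⟩))
    | exact Or.inr (Or.inr (Or.inr ⟨hr, by omega⟩))

theorem sub_of_centerOf_eq_two {i : Fin 3} {u v : ℤ × ℤ} (hu : (u.1 - u.2) % 3 = 2)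
    (hv : (v.1 - v.2) % 3 = 2) (h : centerOf i u = centerOf i v) :
    (v.1 = u.1 ∧ v.2 = u.2) ∨
    (((i : ℤ) + 2 - u.1) % 3 = 0 ∧
      ((v.1 = u.1 - 1 ∧ v.2 = u.2 + 2) ∨ (v.1 = u.1 + 1 ∧ v.2 = u.2 + 1))) ∨
    (((i : ℤ) + 2 - u.1) % 3 = 1 ∧
      ((v.1 = u.1 + 1 ∧ v.2 = u.2 - 2) ∨ (v.1 = u.1 + 2 ∧ v.2 = u.2 - 1))) ∨
    (((i : ℤ) + 2 - u.1) % 3 = 2 ∧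
      ((v.1 = u.1 - 1 ∧ v.2 = u.2 - 1) ∨ (v.1 = u.1 - 2 ∧ v.2 = u.2 + 1))) := by
  rw [centerOf, centerOf] at h
  have hr : ((i : ℤ) + 2 - u.1) % 3 = 0 ∨ ((i : ℤ) + 2 - u.1) % 3 = 1 ∨
    ((i : ℤ) + 2 - u.1) % 3 = 2 := by omega
  have hs : ((i : ℤ) + 2 - v.1) % 3 = 0 ∨ ((i : ℤ) + 2 - v.1) % 3 = 1 ∨
    ((i : ℤ) + 2 - v.1) % 3 = 2 := by omega
  rcases hr with hr | hr | hr <;> rcases hs with hs | hs | hs <;>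
    simp [hu, hv, hr, hs] at h <;>
    first
    | exact Or.inl ⟨by omega, by omega⟩
    | exact Or.inr (Or.inl ⟨hr, by omega⟩)
    | exact Or.inr (Or.inr (Or.inl ⟨hr, by omega⟩))
    | exact Or.inr (Or.inr (Or.inr ⟨hr, by omega⟩))

theorem sub_of_centerOf_eq_mixed {i : Fin 3} {u v : ℤ × ℤ} (hu : (u.1 - u.2) % 3 = 0)
    (hv : (v.1 - v.2) % 3 = 2) (h : centerOf i u = centerOf i v) :
    (((i : ℤ) + 2 - u.1) % 3 = 0 ∧
      ((v.1 = u.1 ∧ v.2 = u.2 - 2) ∨ (v.1 = u.1 - 1 ∧ v.2 = u.2) ∨ (v.1 = u.1 + 1 ∧ v.2 = u.2 - 1))) ∨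
    (((i : ℤ) + 2 - u.1) % 3 = 1 ∧
      ((v.1 = u.1 + 1 ∧ v.2 = u.2 - 1) ∨ (v.1 = u.1 ∧ v.2 = u.2 + 1) ∨ (v.1 = u.1 + 2 ∧ v.2 = u.2))) ∨
    (((i : ℤ) + 2 - u.1) % 3 = 2 ∧
      ((v.1 = u.1 - 1 ∧ v.2 = u.2) ∨ (v.1 = u.1 - 2 ∧ v.2 = u.2 + 2) ∨ (v.1 = u.1 ∧ v.2 = u.2 + 1))) := by
  rw [centerOf, centerOf] at h
  have hr : ((i : ℤ) + 2 - u.1) % 3 = 0 ∨ ((i : ℤ) + 2 - u.1) % 3 = 1 ∨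
    ((i : ℤ) + 2 - u.1) % 3 = 2 := by omega
  have hs : ((i : ℤ) + 2 - v.1) % 3 = 0 ∨ ((i : ℤ) + 2 - v.1) % 3 = 1 ∨
    ((i : ℤ) + 2 - v.1) % 3 = 2 := by omega
  rcases hr with hr | hr | hr <;> rcases hs with hs | hs | hs <;>
    simp [hu, hv, hr, hs] at h <;>
    first
    | exact Or.inl ⟨hr, by omega⟩
    | exact Or.inr (Or.inl ⟨hr, by omega⟩)
    | exact Or.inr (Or.inr ⟨hr, by omega⟩)

/-- Plaquettes or sides of two different colors meet at most in one edge or corner, and the ends of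
an edge have opposite types. -/
theorem eq_of_tri_eq_of_type {m : ℕ} {u v : HexQubit m} {i j : Fin 3} (hij : i ≠ j)
    (hi : tri u i = tri v i) (hj : tri u j = tri v j)
    (ht : (u.1.1 - u.1.2) % 3 = (v.1.1 - v.1.2) % 3) : u = v := by
  have hij' : (i : ℤ) ≠ j := fun h => hij (Fin.ext (by exact_mod_cast h))
  have hi3 := i.2
  have hj3 := j.2
  have side : ∀ k : Fin 3, sideCoord m k u.1 = 0 → sideCoord m k v.1 = 0 →
      ((k : ℤ) = 0 ∧ u.1.1 = 0 ∧ v.1.1 = 0) ∨ ((k : ℤ) = 1 ∧ u.1.2 = 0 ∧ v.1.2 = 0) ∨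
      ((k : ℤ) = 2 ∧ u.1.1 + u.1.2 = 3 * m ∧ v.1.1 + v.1.2 = 3 * m) := by
    intro k
    fin_cases k <;> simp [sideCoord] <;> omega
  suffices u.1.1 = v.1.1 ∧ u.1.2 = v.1.2 from Subtype.ext (Prod.ext this.1 this.2)
  rw [tri_eq_tri_iff] at hi hj
  obtain ⟨-, -, -, hu | hu⟩ := qubit_facts u
  · have hv : (v.1.1 - v.1.2) % 3 = 0 := by omega
    rcases hi with ⟨h1, h2⟩ | hi <;> rcases hj with ⟨h3, h4⟩ | hj
    · have := side i h1 h2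
      have := side j h3 h4
      omega
    · have := side i h1 h2
      have := sub_of_centerOf_eq_zero hu hv hj
      omega
    · have := side j h3 h4
      have := sub_of_centerOf_eq_zero hu hv hi
      omega
    · have h1 := sub_of_centerOf_eq_zero hu hv hi
      have h2 := sub_of_centerOf_eq_zero hu hv hj
      rcases h1 with h1 | ⟨h0, h1 | h1⟩ | ⟨h0, h1 | h1⟩ | ⟨h0, h1 | h1⟩ <;> omega
  · have hv : (v.1.1 - v.1.2) % 3 = 2 := by omega
    rcases hi with ⟨h1, h2⟩ | hi <;> rcases hj with ⟨h3, h4⟩ | hj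
    · have := side i h1 h2
      have := side j h3 h4
      omega
    · have := side i h1 h2
      have := sub_of_centerOf_eq_two hu hv hj
      omega
    · have := side j h3 h4
      have := sub_of_centerOf_eq_two hu hv hi
      omega
    · have h1 := sub_of_centerOf_eq_two hu hv hi
      have h2 := sub_of_centerOf_eq_two hu hv hj
      rcases h1 with h1 | ⟨h0, h1 | h1⟩ | ⟨h0, h1 | h1⟩ | ⟨h0, h1 | h1⟩ <;> omega

/-! ### Edges of the lattice as pairs of qubits with two common labels -/

/-- Two qubits are adjacent across the plaquettes of the two colors other than `i`. -/
def TriAdj {m : ℕ} (i : Fin 3) (u v : HexQubit m) : Prop :=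
  u ≠ v ∧ ∀ j, j ≠ i → tri u j = tri v j

theorem TriAdj.symm {m : ℕ} {i : Fin 3} {u v : HexQubit m} (h : TriAdj i u v) : TriAdj i v u :=
  ⟨h.1.symm, fun j hj => (h.2 j hj).symm⟩

theorem exists_other_colors (i : Fin 3) : ∃ j k : Fin 3, j ≠ k ∧ j ≠ i ∧ k ≠ i ∧
    ∀ l, l ≠ i → l = j ∨ l = k := by
  revert i; decide

theorem eq_of_tri_eq_off {m : ℕ} {u v : HexQubit m} {i : Fin 3}
    (h : ∀ j, j ≠ i → tri u j = tri v j)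
    (ht : (u.1.1 - u.1.2) % 3 = (v.1.1 - v.1.2) % 3) : u = v := by
  obtain ⟨j, k, hjk, hj, hk, -⟩ := exists_other_colors i
  exact eq_of_tri_eq_of_type hjk (h j hj) (h k hk) ht

theorem TriAdj.type_ne {m : ℕ} {i : Fin 3} {u v : HexQubit m} (h : TriAdj i u v) :
    (u.1.1 - u.1.2) % 3 ≠ (v.1.1 - v.1.2) % 3 := fun ht => h.1 (eq_of_tri_eq_off h.2 ht)

/-- Both partners have the type opposite to that of `u`, so they agree in type as well as in two
labels. -/
theorem TriAdj.unique {m : ℕ} {i : Fin 3} {u v w : HexQubit m} (h : TriAdj i u v)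
    (h' : TriAdj i u w) : v = w := by
  refine eq_of_tri_eq_off (i := i) (fun j hj => (h.2 j hj).symm.trans (h'.2 j hj)) ?_
  have := h.type_ne
  have := h'.type_ne
  have := (qubit_facts u).2.2.2
  have := (qubit_facts v).2.2.2
  have := (qubit_facts w).2.2.2
  omega

theorem sideCoord_cases {m : ℕ} {k : Fin 3} {p : ℤ × ℤ} (h : sideCoord m k p = 0) :
    ((k : ℤ) = 0 ∧ p.1 = 0) ∨ ((k : ℤ) = 1 ∧ p.2 = 0) ∨ ((k : ℤ) = 2 ∧ p.1 + p.2 = 3 * m) := by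
  revert h
  fin_cases k <;> simp [sideCoord] <;> omega

/-- Around qubits of opposite types the three colors run in opposite cyclic orders. The proof writes
one coordinate relation per color and refutes the combinations by the residue of `u.1`. -/
theorem tri_ne_of_type {m : ℕ} {u v : HexQubit m} (hu : (u.1.1 - u.1.2) % 3 = 0)
    (hv : (v.1.1 - v.1.2) % 3 = 2) : tri u ≠ tri v := by
  intro h
  have key : ∀ i : Fin 3, _ := fun i => tri_eq_tri_iff.1 (congrFun h i)
  have h' : ∀ i : Fin 3, ((((i : ℤ) = 0 ∧ u.1.1 = 0 ∧ v.1.1 = 0) ∨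
      ((i : ℤ) = 1 ∧ u.1.2 = 0 ∧ v.1.2 = 0) ∨
      ((i : ℤ) = 2 ∧ u.1.1 + u.1.2 = 3 * m ∧ v.1.1 + v.1.2 = 3 * m))) ∨ _ := fun i =>
    (key i).imp (fun h => by
      have h1 := sideCoord_cases h.1
      have h2 := sideCoord_cases h.2
      omega) (sub_of_centerOf_eq_mixed hu hv)
  have h0 := h' 0
  have h1 := h' 1
  have h2 := h' 2
  have e0 : (((0 : Fin 3) : ℕ) : ℤ) = 0 := rfl
  have e1 : (((1 : Fin 3) : ℕ) : ℤ) = 1 := rfl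
  have e2 : (((2 : Fin 3) : ℕ) : ℤ) = 2 := rfl
  have hu0 := (qubit_facts u).1
  rw [e0] at h0
  rw [e1] at h1
  rw [e2] at h2
  clear h' key h
  have hr : u.1.1 % 3 = 0 ∨ u.1.1 % 3 = 1 ∨ u.1.1 % 3 = 2 := by omega
  rcases hr with hr | hr | hr <;> rcases h0 with h0 | h0 | h0 | h0 <;> omega

theorem tri_injective {m : ℕ} : Function.Injective (tri (m := m)) := by
  intro u v h
  by_contra hne
  have ht : (u.1.1 - u.1.2) % 3 ≠ (v.1.1 - v.1.2) % 3 := fun ht =>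
    hne (eq_of_tri_eq_off (i := 0) (fun j _ => congrFun h j) ht)
  rcases (qubit_facts u).2.2.2 with hu | hu <;> rcases (qubit_facts v).2.2.2 with hv | hv
  · omega
  · exact tri_ne_of_type hu hv h
  · exact tri_ne_of_type hv hu h.symm
  · omega

theorem fin_three_coe (i : Fin 3) : (i : ℤ) = 0 ∨ (i : ℤ) = 1 ∨ (i : ℤ) = 2 := by
  have := i.2
  omega

theorem fin_three_coe_ne {i j : Fin 3} (h : i ≠ j) : (i : ℤ) ≠ j := fun h' =>
  h (Fin.ext (by exact_mod_cast h'))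

theorem sideCoord_eq_zero_iff {m : ℕ} {k : Fin 3} {p : ℤ × ℤ} : sideCoord m k p = 0 ↔
    ((k : ℤ) = 0 ∧ p.1 = 0) ∨ ((k : ℤ) = 1 ∧ p.2 = 0) ∨ ((k : ℤ) = 2 ∧ p.1 + p.2 = 3 * m) := by
  refine ⟨sideCoord_cases, ?_⟩
  fin_cases k <;> simp [sideCoord] <;> omega

/-- The position of the neighbor `v` of a qubit `u` with `u.1 ≡ u.2` modulo 3, across the edge
opposite to the color `i`. -/
def AdjFormula (m : ℕ) (i : Fin 3) (u v : ℤ × ℤ) : Prop :=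
  (((i : ℤ) + 2 - u.1) % 3 = 1 ∧ ((v.1 = u.1 - 1 ∧ v.2 = u.2) ∨
    (u.1 = 0 ∧ v.1 = 0 ∧ v.2 = u.2 - 2))) ∨
  (((i : ℤ) + 2 - u.1) % 3 = 2 ∧ ((v.1 = u.1 + 1 ∧ v.2 = u.2 - 1) ∨
    (u.2 = 0 ∧ v.1 = u.1 + 2 ∧ v.2 = 0))) ∨
  (((i : ℤ) + 2 - u.1) % 3 = 0 ∧ ((v.1 = u.1 ∧ v.2 = u.2 + 1) ∨
    (u.1 + u.2 = 3 * m ∧ v.1 = u.1 - 2 ∧ v.2 = u.2 + 2)))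

theorem centerOf_zero {i : Fin 3} {u : ℤ × ℤ} (hu : (u.1 - u.2) % 3 = 0) :
    (((i : ℤ) + 2 - u.1) % 3 = 0 ∧ (centerOf i u).1 = u.1 ∧ (centerOf i u).2 = u.2 - 1) ∨
    (((i : ℤ) + 2 - u.1) % 3 = 1 ∧ (centerOf i u).1 = u.1 + 1 ∧ (centerOf i u).2 = u.2) ∨
    (((i : ℤ) + 2 - u.1) % 3 = 2 ∧ (centerOf i u).1 = u.1 - 1 ∧ (centerOf i u).2 = u.2 + 1) := by
  rw [centerOf, if_pos hu]
  split_ifs <;> simp <;> omega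

theorem centerOf_two {i : Fin 3} {u : ℤ × ℤ} (hu : (u.1 - u.2) % 3 = 2) :
    (((i : ℤ) + 2 - u.1) % 3 = 0 ∧ (centerOf i u).1 = u.1 ∧ (centerOf i u).2 = u.2 + 1) ∨
    (((i : ℤ) + 2 - u.1) % 3 = 1 ∧ (centerOf i u).1 = u.1 + 1 ∧ (centerOf i u).2 = u.2 - 1) ∨
    (((i : ℤ) + 2 - u.1) % 3 = 2 ∧ (centerOf i u).1 = u.1 - 1 ∧ (centerOf i u).2 = u.2) := by
  rw [centerOf, if_neg (show ¬ (u.1 - u.2) % 3 = 0 by omega)]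
  split_ifs <;> simp <;> omega

set_option maxHeartbeats 1000000 in
theorem triAdj_of_formula {m : ℕ} {i : Fin 3} {u v : HexQubit m}
    (hu : (u.1.1 - u.1.2) % 3 = 0) (h : AdjFormula m i u.1 v.1) : TriAdj i u v := by
  have hv : (v.1.1 - v.1.2) % 3 = 2 := by
    have := qubit_facts v
    unfold AdjFormula at h
    omega
  refine ⟨by rintro rfl; omega, fun j hj => ?_⟩
  rw [tri_eq_tri_iff, sideCoord_eq_zero_iff, sideCoord_eq_zero_iff, Prod.ext_iff]
  have hij := fin_three_coe_ne hj
  have h1 := fin_three_coe i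
  have h2 := fin_three_coe j
  have c1 := centerOf_zero (i := j) hu
  have c2 := centerOf_two (i := j) hv
  unfold AdjFormula at h
  -- For a step to a nearest neighbor, both remaining centers are common. For a step of length two
  -- along a side, one of the two colors is that of the side, where both labels are `none` (`left`).
  rcases h with ⟨h, h' | h'⟩ | ⟨h, h' | h'⟩ | ⟨h, h' | h'⟩
  · right
    rcases c1 with c1 | c1 | c1 <;> omega
  · rcases c1 with c1 | c1 | c1
    · right; omega
    · omega
    · left; omega
  · right
    rcases c1 with c1 | c1 | c1 <;> omega
  · rcases c1 with c1 | c1 | c1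
    · left; omega
    · right; omega
    · omega
  · right
    rcases c1 with c1 | c1 | c1 <;> omega
  · rcases c1 with c1 | c1 | c1
    · omega
    · left; omega
    · right; omega

theorem eq_of_tri_eq_none {m : ℕ} {i : Fin 3} {u v : HexQubit m}
    (hu : ∀ j, j ≠ i → tri u j = none) (hv : ∀ j, j ≠ i → tri v j = none) : u = v := by
  obtain ⟨j, k, hjk, hj, hk, -⟩ := exists_other_colors i
  have h1 := sideCoord_cases (tri_eq_none_iff.1 (hu j hj))
  have h2 := sideCoord_cases (tri_eq_none_iff.1 (hu k hk))
  have h3 := sideCoord_cases (tri_eq_none_iff.1 (hv j hj))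
  have h4 := sideCoord_cases (tri_eq_none_iff.1 (hv k hk))
  have hjk := fin_three_coe_ne hjk
  exact Subtype.ext (Prod.ext (by omega) (by omega))

/-- The qubit at the corner of the triangle opposite to the side `i`. -/
theorem exists_corner (m : ℕ) (i : Fin 3) : ∃ q : HexQubit m, ∀ j, j ≠ i → tri q j = none := by
  simp only [tri_eq_none_iff, sideCoord_eq_zero_iff]
  rcases fin_three_coe i with h | h | h
  · refine ⟨⟨(3 * m, 0), mem_hexQubit.2 (by refine ⟨⟨?_, ?_, ?_⟩, ?_⟩ <;> simp only <;> omega)⟩, fun j hj => ?_⟩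
    have := fin_three_coe_ne hj
    have := fin_three_coe j
    simp only [and_true, add_zero, zero_add]
    omega
  · refine ⟨⟨(0, 3 * m), mem_hexQubit.2 (by refine ⟨⟨?_, ?_, ?_⟩, ?_⟩ <;> simp only <;> omega)⟩, fun j hj => ?_⟩
    have := fin_three_coe_ne hj
    have := fin_three_coe j
    simp only [and_true, add_zero, zero_add]
    omega
  · refine ⟨⟨(0, 0), mem_hexQubit.2 (by simp)⟩, fun j hj => ?_⟩
    have := fin_three_coe_ne hj
    have := fin_three_coe j
    simp only [and_true, add_zero, zero_add]
    omega

/-- The partner lies one step away from the center of color `i`. If this step leaves the triangle,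
`u` is on a side and the partner is found two steps along it, at the other end of the side of a
quadrilateral; only at the end of the side does this fail too. -/
theorem exists_formula_or_corner {m : ℕ} (i : Fin 3) {u : HexQubit m}
    (hu : (u.1.1 - u.1.2) % 3 = 0) :
    (∃ v : HexQubit m, AdjFormula m i u.1 v.1) ∨ ∀ j, j ≠ i → tri u j = none := by
  obtain ⟨h1, h2, h3, -⟩ := qubit_facts u
  have hr : ((i : ℤ) + 2 - u.1.1) % 3 = 0 ∨ ((i : ℤ) + 2 - u.1.1) % 3 = 1 ∨
    ((i : ℤ) + 2 - u.1.1) % 3 = 2 := by omega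
  simp only [tri_eq_none_iff, sideCoord_eq_zero_iff, AdjFormula]
  have hc : ∀ x y : ℤ, (0 ≤ x ∧ 0 ≤ y ∧ x + y ≤ 3 * m) ∧ (x - y) % 3 ≠ 1 →
      ∃ v : HexQubit m, v.1.1 = x ∧ v.1.2 = y := fun x y h =>
    ⟨⟨(x, y), mem_hexQubit.2 h⟩, rfl, rfl⟩
  have hi := fin_three_coe i
  rcases hr with hr | hr | hr
  · by_cases h : u.1.1 + u.1.2 = 3 * m
    · by_cases h' : u.1.1 = 0
      · refine Or.inr fun j hj => ?_
        have := fin_three_coe_ne hj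
        have := fin_three_coe j
        omega
      · obtain ⟨v, hv⟩ := hc (u.1.1 - 2) (u.1.2 + 2) (by omega)
        exact Or.inl ⟨v, Or.inr (Or.inr ⟨by omega, Or.inr (by omega)⟩)⟩
    · obtain ⟨v, hv⟩ := hc u.1.1 (u.1.2 + 1) (by omega)
      exact Or.inl ⟨v, Or.inr (Or.inr ⟨by omega, Or.inl (by omega)⟩)⟩
  · by_cases h : u.1.1 = 0
    · by_cases h' : u.1.2 = 0
      · refine Or.inr fun j hj => ?_
        have := fin_three_coe_ne hj
        have := fin_three_coe j
        omega
      · obtain ⟨v, hv⟩ := hc 0 (u.1.2 - 2) (by omega)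
        exact Or.inl ⟨v, Or.inl ⟨by omega, Or.inr (by omega)⟩⟩
    · obtain ⟨v, hv⟩ := hc (u.1.1 - 1) u.1.2 (by omega)
      exact Or.inl ⟨v, Or.inl ⟨by omega, Or.inl (by omega)⟩⟩
  · by_cases h : u.1.2 = 0
    · by_cases h' : u.1.1 = 3 * m
      · refine Or.inr fun j hj => ?_
        have := fin_three_coe_ne hj
        have := fin_three_coe j
        omega
      · obtain ⟨v, hv⟩ := hc (u.1.1 + 2) 0 (by omega)
        exact Or.inl ⟨v, Or.inr (Or.inl ⟨by omega, Or.inr (by omega)⟩)⟩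
    · obtain ⟨v, hv⟩ := hc (u.1.1 + 1) (u.1.2 - 1) (by omega)
      exact Or.inl ⟨v, Or.inr (Or.inl ⟨by omega, Or.inl (by omega)⟩)⟩

/-- The three corners have type `0`, so there is no exception for type `2`. -/
theorem exists_formula_to {m : ℕ} (i : Fin 3) {v : HexQubit m}
    (hv : (v.1.1 - v.1.2) % 3 = 2) : ∃ u : HexQubit m, AdjFormula m i u.1 v.1 := by
  obtain ⟨h1, h2, h3, -⟩ := qubit_facts v
  have hr : ((i : ℤ) + 2 - v.1.1) % 3 = 0 ∨ ((i : ℤ) + 2 - v.1.1) % 3 = 1 ∨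
    ((i : ℤ) + 2 - v.1.1) % 3 = 2 := by omega
  simp only [AdjFormula]
  have hc : ∀ x y : ℤ, (0 ≤ x ∧ 0 ≤ y ∧ x + y ≤ 3 * m) ∧ (x - y) % 3 ≠ 1 →
      ∃ v : HexQubit m, v.1.1 = x ∧ v.1.2 = y := fun x y h =>
    ⟨⟨(x, y), mem_hexQubit.2 h⟩, rfl, rfl⟩
  have hi := fin_three_coe i
  rcases hr with hr | hr | hr
  · by_cases h : v.1.2 = 0
    · obtain ⟨u, hu⟩ := hc (v.1.1 - 2) 0 (by omega)
      exact ⟨u, Or.inr (Or.inl ⟨by omega, Or.inr (by omega)⟩)⟩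
    · obtain ⟨u, hu⟩ := hc v.1.1 (v.1.2 - 1) (by omega)
      exact ⟨u, Or.inr (Or.inr ⟨by omega, Or.inl (by omega)⟩)⟩
  · by_cases h : v.1.1 = 0
    · obtain ⟨u, hu⟩ := hc 0 (v.1.2 + 2) (by omega)
      exact ⟨u, Or.inl ⟨by omega, Or.inr (by omega)⟩⟩
    · obtain ⟨u, hu⟩ := hc (v.1.1 - 1) (v.1.2 + 1) (by omega)
      exact ⟨u, Or.inr (Or.inl ⟨by omega, Or.inl (by omega)⟩)⟩
  · by_cases h : v.1.1 + v.1.2 = 3 * m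
    · obtain ⟨u, hu⟩ := hc (v.1.1 + 2) (v.1.2 - 2) (by omega)
      exact ⟨u, Or.inr (Or.inr ⟨by omega, Or.inr (by omega)⟩)⟩
    · obtain ⟨u, hu⟩ := hc (v.1.1 + 1) v.1.2 (by omega)
      exact ⟨u, Or.inl ⟨by omega, Or.inl (by omega)⟩⟩

theorem AdjFormula.type {m : ℕ} {i : Fin 3} {u v : HexQubit m} (h : AdjFormula m i u.1 v.1)
    (hv : (v.1.1 - v.1.2) % 3 = 2) : (u.1.1 - u.1.2) % 3 = 0 := by
  have := qubit_facts u
  unfold AdjFormula at h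
  omega

theorem exists_triAdj_or_corner {m : ℕ} (i : Fin 3) (q : HexQubit m) :
    (∃ v, TriAdj i q v) ∨ ∀ j, j ≠ i → tri q j = none := by
  rcases (qubit_facts q).2.2.2 with h | h
  · exact (exists_formula_or_corner i h).imp (fun ⟨v, hv⟩ => ⟨v, triAdj_of_formula h hv⟩) id
  · obtain ⟨u, hu⟩ := exists_formula_to i h
    exact Or.inl ⟨u, (triAdj_of_formula (hu.type h) hu).symm⟩

theorem not_triAdj_of_corner {m : ℕ} {i : Fin 3} {u v : HexQubit m}
    (h : ∀ j, j ≠ i → tri u j = none) : ¬ TriAdj i u v := fun h' =>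
  h'.1 (eq_of_tri_eq_none h fun j hj => (h'.2 j hj).symm.trans (h j hj))

theorem TriAdj.formula {m : ℕ} {i : Fin 3} {u v : HexQubit m} (h : TriAdj i u v)
    (hu : (u.1.1 - u.1.2) % 3 = 0) : AdjFormula m i u.1 v.1 := by
  rcases exists_formula_or_corner i hu with ⟨w, hw⟩ | hc
  · rwa [h.unique (triAdj_of_formula hu hw)]
  · exact absurd h (not_triAdj_of_corner hc)

theorem exists_residue (a : ℤ) : ∀ r : ℤ, 0 ≤ r → r < 3 → ∃ i : Fin 3,
    ((i : ℤ) + 2 - a) % 3 = r := fun r h0 h3 =>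
  ⟨⟨((r + a + 1) % 3).toNat, by omega⟩, by simp only; omega⟩

theorem mem_plaquette_iff {m : ℕ} {q : HexQubit m} {P : HexPlaquette m} :
    q ∈ plaquette m P ↔ tri q (plaqColor P) = some P := by
  simp [tri_eq_some_iff]

theorem SameSide.exists_tri_eq_none {m : ℕ} {u v : HexQubit m} (h : SameSide m u v) :
    ∃ j, tri u j = none ∧ tri v j = none := by
  simp only [tri_eq_none_iff, sideCoord_eq_zero_iff]
  rcases h with h | h | h
  · exact ⟨0, Or.inl ⟨rfl, h.1⟩, Or.inl ⟨rfl, h.2⟩⟩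
  · exact ⟨1, Or.inr (Or.inl ⟨rfl, h.1⟩), Or.inr (Or.inl ⟨rfl, h.2⟩)⟩
  · exact ⟨2, Or.inr (Or.inr ⟨rfl, h.1⟩), Or.inr (Or.inr ⟨rfl, h.2⟩)⟩

theorem exists_triAdj_of_neighbors {m : ℕ} {u v : HexQubit m} (h : Neighbors u.1 v.1) :
    ∃ i, TriAdj i u v := by
  rw [neighbors_iff] at h
  have hv := (qubit_facts v).2.2.2
  rcases (qubit_facts u).2.2.2 with hu | hu
  · obtain ⟨r, hr0, hr3, hr⟩ : ∃ r : ℤ, 0 ≤ r ∧ r < 3 ∧ ((r = 1 ∧ v.1.1 = u.1.1 - 1 ∧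
        v.1.2 = u.1.2) ∨ (r = 2 ∧ v.1.1 = u.1.1 + 1 ∧ v.1.2 = u.1.2 - 1) ∨
        (r = 0 ∧ v.1.1 = u.1.1 ∧ v.1.2 = u.1.2 + 1)) := by
      rcases h with h | h | h | h | h | h
      · omega
      · exact ⟨1, by omega⟩
      · exact ⟨0, by omega⟩
      · omega
      · exact ⟨2, by omega⟩
      · omega
    obtain ⟨i, hi⟩ := exists_residue u.1.1 r hr0 hr3
    refine ⟨i, triAdj_of_formula hu ?_⟩
    unfold AdjFormula
    rcases hr with ⟨rfl, hr⟩ | ⟨rfl, hr⟩ | ⟨rfl, hr⟩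
    · exact Or.inl ⟨hi, Or.inl hr⟩
    · exact Or.inr (Or.inl ⟨hi, Or.inl hr⟩)
    · exact Or.inr (Or.inr ⟨hi, Or.inl hr⟩)
  · obtain ⟨r, hr0, hr3, hr⟩ : ∃ r : ℤ, 0 ≤ r ∧ r < 3 ∧ ((r = 1 ∧ u.1.1 = v.1.1 - 1 ∧
        u.1.2 = v.1.2) ∨ (r = 2 ∧ u.1.1 = v.1.1 + 1 ∧ u.1.2 = v.1.2 - 1) ∨
        (r = 0 ∧ u.1.1 = v.1.1 ∧ u.1.2 = v.1.2 + 1)) := by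
      rcases h with h | h | h | h | h | h
      · exact ⟨1, by omega⟩
      · omega
      · omega
      · exact ⟨0, by omega⟩
      · omega
      · exact ⟨2, by omega⟩
    obtain ⟨i, hi⟩ := exists_residue v.1.1 r hr0 hr3
    refine ⟨i, (triAdj_of_formula (by omega) ?_).symm⟩
    unfold AdjFormula
    rcases hr with ⟨rfl, hr⟩ | ⟨rfl, hr⟩ | ⟨rfl, hr⟩
    · exact Or.inl ⟨hi, Or.inl hr⟩
    · exact Or.inr (Or.inl ⟨hi, Or.inl hr⟩)
    · exact Or.inr (Or.inr ⟨hi, Or.inl hr⟩)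

theorem exists_third_color {j k : Fin 3} (h : j ≠ k) :
    ∃ i, j ≠ i ∧ k ≠ i ∧ ∀ l, l ≠ i → l = j ∨ l = k := by
  revert j k; decide

theorem exists_triAdj_of_sameSide {m : ℕ} {u v : HexQubit m} (hne : u ≠ v) (h : SameSide m u v)
    (hP : ∃ P, u ∈ plaquette m P ∧ v ∈ plaquette m P) : ∃ i, TriAdj i u v := by
  obtain ⟨j, hu, hv⟩ := h.exists_tri_eq_none
  obtain ⟨P, hPu, hPv⟩ := hP
  rw [mem_plaquette_iff] at hPu hPv
  have hjk : j ≠ plaqColor P := by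
    rintro rfl
    simp [hu] at hPu
  obtain ⟨i, -, -, hi⟩ := exists_third_color hjk
  refine ⟨i, hne, fun l hl => ?_⟩
  rcases hi l hl with rfl | rfl
  · rw [hu, hv]
  · rw [hPu, hPv]

/-- Links the edge operators of the code with edges of the 3D triangulation, which are given by
pairs of labels. -/
theorem hexGraph_adj_iff {m : ℕ} {u v : HexQubit m} :
    (hexGraph m).Adj u v ↔ ∃ i, TriAdj i u v := by
  have hrel : ∀ {u v : HexQubit m} {i}, TriAdj i u v → (u.1.1 - u.1.2) % 3 = 0 →
      Neighbors u.1 v.1 ∨ (SameSide m u v ∧ ∃ P, u ∈ plaquette m P ∧ v ∈ plaquette m P) := by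
    intro u v i h hu
    by_cases hn : Neighbors u.1 v.1
    · exact Or.inl hn
    · have hf := h.formula hu
      rw [neighbors_iff] at hn
      unfold AdjFormula at hf
      have hs : SameSide m u v := by
        unfold SameSide
        rcases hf with ⟨-, hf | hf⟩ | ⟨-, hf | hf⟩ | ⟨-, hf | hf⟩
        · omega
        · exact Or.inl (by omega)
        · omega
        · exact Or.inr (Or.inl (by omega))
        · omega
        · exact Or.inr (Or.inr (by omega))
      refine Or.inr ⟨hs, ?_⟩
      -- Without a common plaquette, the two shared labels would both be sides, and a corner has no
      -- partner.
      by_contra hP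
      refine not_triAdj_of_corner (fun j hj => ?_) h
      by_contra hj'
      obtain ⟨P, hP'⟩ := Option.ne_none_iff_exists'.1 hj'
      exact hP ⟨P, (tri_eq_some_iff.1 hP').2, (tri_eq_some_iff.1 ((h.2 j hj).symm.trans hP')).2⟩
  rw [hexGraph, SimpleGraph.fromRel_adj]
  constructor
  · rintro ⟨hne, (h | ⟨h, hP⟩) | (h | ⟨h, hP⟩)⟩
    · exact exists_triAdj_of_neighbors h
    · exact exists_triAdj_of_sameSide hne h hP
    · exact (exists_triAdj_of_neighbors h).imp fun _ => TriAdj.symm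
    · exact (exists_triAdj_of_sameSide hne.symm h hP).imp fun _ => TriAdj.symm
  · rintro ⟨i, h⟩
    refine ⟨h.1, ?_⟩
    rcases (qubit_facts u).2.2.2 with hu | hu
    · exact Or.inl (hrel h hu)
    · refine Or.inr (hrel h.symm ?_)
      have := h.type_ne
      have := (qubit_facts v).2.2.2
      omega

/-! ### Connectivity of the patch, of its plaquettes and of its sides -/

/-- Steps between adjacent qubits whose plaquette (or side) of color `j` is `x`. -/
def StarStep {m : ℕ} (j : Fin 3) (x : Option (HexPlaquette m)) (a b : HexQubit m) : Prop :=
  tri a j = x ∧ tri b j = x ∧ ∃ i, TriAdj i a b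

theorem StarStep.symm {m : ℕ} {j : Fin 3} {x : Option (HexPlaquette m)} {a b : HexQubit m}
    (h : StarStep j x a b) : StarStep j x b a :=
  ⟨h.2.1, h.1, h.2.2.imp fun _ => TriAdj.symm⟩

theorem reflTransGen_symm {α : Type} {r : α → α → Prop} (hr : ∀ {a b}, r a b → r b a) {a b : α}
    (h : Relation.ReflTransGen r a b) : Relation.ReflTransGen r b a := by
  induction h with
  | refl => exact .refl
  | tail _ h ih => exact (Relation.ReflTransGen.single (hr h)).trans ih

theorem exists_qubit {m : ℕ} {x y : ℤ} (h : (0 ≤ x ∧ 0 ≤ y ∧ x + y ≤ 3 * m) ∧ (x - y) % 3 ≠ 1) :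
    ∃ v : HexQubit m, v.1.1 = x ∧ v.1.2 = y := ⟨⟨(x, y), mem_hexQubit.2 h⟩, rfl, rfl⟩

/-- The second qubit on the same side of a quadrilateral. -/
theorem exists_triAdj_of_side_step {m : ℕ} {u v : HexQubit m} (hu : (u.1.1 - u.1.2) % 3 = 0)
    (h : (u.1.1 = 0 ∧ v.1.1 = 0 ∧ v.1.2 = u.1.2 - 2) ∨ (u.1.2 = 0 ∧ v.1.1 = u.1.1 + 2 ∧ v.1.2 = 0) ∨
      (u.1.1 + u.1.2 = 3 * m ∧ v.1.1 = u.1.1 - 2 ∧ v.1.2 = u.1.2 + 2)) : ∃ i, TriAdj i u v := by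
  rcases h with h | h | h
  · obtain ⟨i, hi⟩ := exists_residue u.1.1 1 (by norm_num) (by norm_num)
    exact ⟨i, triAdj_of_formula hu (Or.inl ⟨hi, Or.inr h⟩)⟩
  · obtain ⟨i, hi⟩ := exists_residue u.1.1 2 (by norm_num) (by norm_num)
    exact ⟨i, triAdj_of_formula hu (Or.inr (Or.inl ⟨hi, Or.inr h⟩))⟩
  · obtain ⟨i, hi⟩ := exists_residue u.1.1 0 (by norm_num) (by norm_num)
    exact ⟨i, triAdj_of_formula hu (Or.inr (Or.inr ⟨hi, Or.inr h⟩))⟩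

/-- Descent on the coordinate sum: away from the origin some adjacent qubit has a smaller sum, with
a step of length two where a side blocks the short one. -/
theorem reach_origin {m : ℕ} {o : HexQubit m} (ho : o.1.1 = 0 ∧ o.1.2 = 0) (u : HexQubit m) :
    Relation.ReflTransGen (fun a b => ∃ i, TriAdj i a b) u o := by
  obtain ⟨N, hN⟩ : ∃ N : ℕ, u.1.1 + u.1.2 = N := by
    have := qubit_facts u
    exact ⟨(u.1.1 + u.1.2).toNat, by omega⟩
  induction N using Nat.strong_induction_on generalizing u with
  | _ N ih =>
    have hstep : ∀ v : HexQubit m, v.1.1 + v.1.2 < N → (∃ i, TriAdj i u v) →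
        Relation.ReflTransGen (fun a b => ∃ i, TriAdj i a b) u o := by
      intro v hv h
      have := qubit_facts v
      exact .head h (ih (v.1.1 + v.1.2).toNat (by omega) v (by omega))
    obtain ⟨h1, h2, h3, h4 | h4⟩ := qubit_facts u
    · by_cases ha : u.1.1 = 0
      · by_cases hb : u.1.2 = 0
        · rw [show u = o from Subtype.ext (Prod.ext (by omega) (by omega))]
        · obtain ⟨v, hv⟩ := exists_qubit (m := m) (x := 0) (y := u.1.2 - 2) (by omega)
          exact hstep v (by omega) (exists_triAdj_of_side_step h4 (Or.inl (by omega)))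
      · obtain ⟨v, hv⟩ := exists_qubit (m := m) (x := u.1.1 - 1) (y := u.1.2) (by omega)
        exact hstep v (by omega) (exists_triAdj_of_neighbors
          (neighbors_iff.2 (Or.inr (Or.inl hv))))
    · by_cases hb : u.1.2 = 0
      · obtain ⟨v, hv⟩ := exists_qubit (m := m) (x := u.1.1 - 2) (y := 0) (by omega)
        refine hstep v (by omega) ((exists_triAdj_of_side_step (u := v) (v := u) (by omega)
          (Or.inr (Or.inl (by omega)))).imp fun _ => TriAdj.symm)
      · obtain ⟨v, hv⟩ := exists_qubit (m := m) (x := u.1.1) (y := u.1.2 - 1) (by omega)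
        exact hstep v (by omega) (exists_triAdj_of_neighbors
          (neighbors_iff.2 (Or.inr (Or.inr (Or.inr (Or.inl hv))))))

theorem triAdj_connected {m : ℕ} (u v : HexQubit m) :
    Relation.ReflTransGen (fun a b => ∃ i, TriAdj i a b) u v := by
  obtain ⟨o, ho⟩ := exists_qubit (m := m) (x := 0) (y := 0) (by simp)
  exact (reach_origin ho u).trans
    (reflTransGen_symm (fun h => h.imp fun _ => TriAdj.symm) (reach_origin ho v))

/-- The potential `2 * u.1 + u.2` decreases strictly along each of the three sides towards the
chosen corner, so one descent handles them all. -/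
theorem reach_side_corner {m : ℕ} {j : Fin 3} {o : HexQubit m} (ho : o.1.1 = 0)
    (ho' : ((j : ℤ) = 2 ∧ o.1.2 = 3 * m) ∨ ((j : ℤ) ≠ 2 ∧ o.1.2 = 0)) (u : HexQubit m)
    (hu : tri u j = none) : Relation.ReflTransGen (StarStep j none) u o := by
  obtain ⟨N, hN⟩ : ∃ N : ℕ, 2 * u.1.1 + u.1.2 = N := by
    have := qubit_facts u
    exact ⟨(2 * u.1.1 + u.1.2).toNat, by omega⟩
  induction N using Nat.strong_induction_on generalizing u with
  | _ N ih =>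
    have hstep : ∀ v : HexQubit m, 2 * v.1.1 + v.1.2 < N → sideCoord m j v.1 = 0 →
        (∃ i, TriAdj i u v) → Relation.ReflTransGen (StarStep j none) u o := by
      intro v hv hv' h
      have := qubit_facts v
      rw [← tri_eq_none_iff] at hv'
      exact .head ⟨hu, hv', h⟩ (ih (2 * v.1.1 + v.1.2).toNat (by omega) v hv' (by omega))
    have hs := sideCoord_cases (tri_eq_none_iff.1 hu)
    obtain ⟨h1, h2, h3, h4⟩ := qubit_facts u
    simp only [sideCoord_eq_zero_iff] at hstep
    by_cases hend : u.1.1 = o.1.1 ∧ u.1.2 = o.1.2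
    · rw [show u = o from Subtype.ext (Prod.ext hend.1 hend.2)]
    rcases hs with ⟨hj, hs⟩ | ⟨hj, hs⟩ | ⟨hj, hs⟩
    · rcases h4 with h4 | h4
      · obtain ⟨v, hv⟩ := exists_qubit (m := m) (x := 0) (y := u.1.2 - 2) (by omega)
        exact hstep v (by omega) (Or.inl ⟨hj, hv.1⟩)
          (exists_triAdj_of_side_step h4 (Or.inl (by omega)))
      · obtain ⟨v, hv⟩ := exists_qubit (m := m) (x := u.1.1) (y := u.1.2 - 1) (by omega)
        exact hstep v (by omega) (Or.inl ⟨hj, by omega⟩) (exists_triAdj_of_neighbors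
          (neighbors_iff.2 (Or.inr (Or.inr (Or.inr (Or.inl hv))))))
    · rcases h4 with h4 | h4
      · obtain ⟨v, hv⟩ := exists_qubit (m := m) (x := u.1.1 - 1) (y := u.1.2) (by omega)
        exact hstep v (by omega) (Or.inr (Or.inl ⟨hj, by omega⟩)) (exists_triAdj_of_neighbors
          (neighbors_iff.2 (Or.inr (Or.inl hv))))
      · obtain ⟨v, hv⟩ := exists_qubit (m := m) (x := u.1.1 - 2) (y := 0) (by omega)
        exact hstep v (by omega) (Or.inr (Or.inl ⟨hj, by omega⟩))
          ((exists_triAdj_of_side_step (u := v) (v := u) (by omega)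
            (Or.inr (Or.inl (by omega)))).imp fun _ => TriAdj.symm)
    · rcases h4 with h4 | h4
      · obtain ⟨v, hv⟩ := exists_qubit (m := m) (x := u.1.1 - 2) (y := u.1.2 + 2) (by omega)
        exact hstep v (by omega) (Or.inr (Or.inr ⟨hj, by omega⟩))
          (exists_triAdj_of_side_step h4 (Or.inr (Or.inr (by omega))))
      · obtain ⟨v, hv⟩ := exists_qubit (m := m) (x := u.1.1 - 1) (y := u.1.2 + 1) (by omega)
        exact hstep v (by omega) (Or.inr (Or.inr ⟨hj, by omega⟩)) (exists_triAdj_of_neighbors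
          (neighbors_iff.2 (Or.inr (Or.inr (Or.inr (Or.inr (Or.inr hv)))))))

theorem reach_of_path {m : ℕ} (P : HexPlaquette m) : ∀ (l : List (ℤ × ℤ)) (p : ℤ × ℤ),
    (∀ x ∈ p :: l, ((0 ≤ x.1 ∧ 0 ≤ x.2 ∧ x.1 + x.2 ≤ 3 * m) ∧ (x.1 - x.2) % 3 ≠ 1) ∧
      Neighbors P.1 x) → List.IsChain Neighbors (p :: l) → ∀ u v : HexQubit m,
    u.1 = p → v.1 ∈ p :: l →
      Relation.ReflTransGen (StarStep (plaqColor P) (some P)) u v := by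
  intro l
  induction l with
  | nil =>
    intro p _ _ u v hu hv
    rw [List.mem_singleton] at hv
    rw [Subtype.ext (hu.trans hv.symm)]
  | cons q l ih =>
    intro p hall hch u v hu hv
    rw [List.isChain_cons_cons] at hch
    rcases List.mem_cons.1 hv with hv | hv
    · rw [Subtype.ext (hu.trans hv.symm)]
    · have hq := hall q (by simp)
      let w : HexQubit m := ⟨q, mem_hexQubit.2 hq.1⟩
      refine .head (b := w) ⟨?_, ?_, exists_triAdj_of_neighbors (hu ▸ hch.1)⟩
        (ih q (fun x hx => hall x (List.mem_cons_of_mem _ hx)) hch.2 w v rfl hv)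
      · exact mem_plaquette_iff.1 (show Neighbors P.1 u.1 from hu ▸ (hall p (by simp)).2)
      · exact mem_plaquette_iff.1 hq.2

/-- Walk along the polygon: the lists give its qubits in cyclic order, four for a center on a side
and six otherwise. A center is never a corner, so at most one side matters. -/
theorem reach_plaquette {m : ℕ} (P : HexPlaquette m) : ∃ o : HexQubit m, ∀ v ∈ plaquette m P,
    Relation.ReflTransGen (StarStep (plaqColor P) (some P)) o v := by
  obtain ⟨h1, h2, h3, h4⟩ := plaquette_facts P
  suffices ∃ (p : ℤ × ℤ) (l : List (ℤ × ℤ)), (∀ x ∈ p :: l,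
      ((0 ≤ x.1 ∧ 0 ≤ x.2 ∧ x.1 + x.2 ≤ 3 * m) ∧ (x.1 - x.2) % 3 ≠ 1) ∧ Neighbors P.1 x) ∧
      List.IsChain Neighbors (p :: l) ∧ ∀ v ∈ plaquette m P, v.1 ∈ p :: l by
    obtain ⟨p, l, hall, hch, hv⟩ := this
    exact ⟨⟨p, mem_hexQubit.2 (hall p (by simp)).1⟩, fun v hv' =>
      reach_of_path P l p hall hch _ v rfl (hv v hv')⟩
  by_cases hx : P.1.1 = 0
  · refine ⟨(P.1.1, P.1.2 + 1), [(P.1.1 + 1, P.1.2), (P.1.1 + 1, P.1.2 - 1), (P.1.1, P.1.2 - 1)], ?_, ?_, ?_⟩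
    · intro z hz
      simp only [List.mem_cons, List.not_mem_nil, or_false, Prod.ext_iff] at hz
      rw [neighbors_iff]
      rcases hz with hz | hz | hz | hz <;> omega
    · simp [neighbors_iff]
    · intro v hv
      have := qubit_facts v
      have hv := neighbors_iff.1 hv
      simp only [List.mem_cons, List.not_mem_nil, or_false, Prod.ext_iff]
      omega
  by_cases hy : P.1.2 = 0
  · refine ⟨(P.1.1 + 1, P.1.2), [(P.1.1, P.1.2 + 1), (P.1.1 - 1, P.1.2 + 1), (P.1.1 - 1, P.1.2)], ?_, ?_, ?_⟩
    · intro z hz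
      simp only [List.mem_cons, List.not_mem_nil, or_false, Prod.ext_iff] at hz
      rw [neighbors_iff]
      rcases hz with hz | hz | hz | hz <;> omega
    · simp [neighbors_iff]
    · intro v hv
      have := qubit_facts v
      have hv := neighbors_iff.1 hv
      simp only [List.mem_cons, List.not_mem_nil, or_false, Prod.ext_iff]
      omega
  by_cases hz : P.1.1 + P.1.2 = 3 * m
  · refine ⟨(P.1.1 - 1, P.1.2 + 1), [(P.1.1 - 1, P.1.2), (P.1.1, P.1.2 - 1), (P.1.1 + 1, P.1.2 - 1)], ?_, ?_, ?_⟩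
    · intro z hz
      simp only [List.mem_cons, List.not_mem_nil, or_false, Prod.ext_iff] at hz
      rw [neighbors_iff]
      rcases hz with hz | hz | hz | hz <;> omega
    · simp [neighbors_iff]
    · intro v hv
      have := qubit_facts v
      have hv := neighbors_iff.1 hv
      simp only [List.mem_cons, List.not_mem_nil, or_false, Prod.ext_iff]
      omega
  · refine ⟨(P.1.1 + 1, P.1.2), [(P.1.1, P.1.2 + 1), (P.1.1 - 1, P.1.2 + 1), (P.1.1 - 1, P.1.2), (P.1.1, P.1.2 - 1), (P.1.1 + 1, P.1.2 - 1)], ?_, ?_, ?_⟩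
    · intro z hz
      simp only [List.mem_cons, List.not_mem_nil, or_false, Prod.ext_iff] at hz
      rw [neighbors_iff]
      rcases hz with hz | hz | hz | hz | hz | hz <;> omega
    · simp [neighbors_iff]
    · intro v hv
      have := qubit_facts v
      have hv := neighbors_iff.1 hv
      simp only [List.mem_cons, List.not_mem_nil, or_false, Prod.ext_iff]
      omega

theorem star_connected {m : ℕ} {j : Fin 3} {x : Option (HexPlaquette m)} {u v : HexQubit m}
    (hu : tri u j = x) (hv : tri v j = x) : Relation.ReflTransGen (StarStep j x) u v := by
  suffices ∃ o, ∀ w, tri w j = x → Relation.ReflTransGen (StarStep j x) w o by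
    obtain ⟨o, ho⟩ := this
    exact (ho u hu).trans (reflTransGen_symm StarStep.symm (ho v hv))
  cases x with
  | none =>
    rcases fin_three_coe j with h | h | h
    · obtain ⟨o, ho⟩ := exists_qubit (m := m) (x := 0) (y := 0) (by simp)
      exact ⟨o, reach_side_corner ho.1 (Or.inr ⟨by omega, ho.2⟩)⟩
    · obtain ⟨o, ho⟩ := exists_qubit (m := m) (x := 0) (y := 0) (by simp)
      exact ⟨o, reach_side_corner ho.1 (Or.inr ⟨by omega, ho.2⟩)⟩
    · obtain ⟨o, ho⟩ := exists_qubit (m := m) (x := 0) (y := 3 * m) (by omega)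
      exact ⟨o, reach_side_corner ho.1 (Or.inl ⟨by omega, ho.2⟩)⟩
  | some P =>
    obtain ⟨o, ho⟩ := reach_plaquette P
    obtain ⟨rfl, -⟩ := tri_eq_some_iff.1 hu
    exact ⟨o, fun w hw => reflTransGen_symm StarStep.symm (ho w (tri_eq_some_iff.1 hw).2)⟩

/-- Two qubits are joined by a chain of adjacent qubits that stays in the star of their common
plaquettes and sides. -/
theorem tri_chain {m : ℕ} (u v : HexQubit m) : Relation.ReflTransGen (fun a b =>
    (∀ j, tri u j = tri v j → tri a j = tri u j ∧ tri b j = tri u j) ∧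
      ∃ i, tri u i ≠ tri v i ∧ ∀ j, j ≠ i → tri a j = tri b j) u v := by
  by_cases huv : u = v
  · rw [huv]
  by_cases hagree : ∃ j, tri u j = tri v j
  · obtain ⟨j, hj⟩ := hagree
    by_cases hedge : ∃ k, k ≠ j ∧ tri u k = tri v k
    · obtain ⟨k, hkj, hk⟩ := hedge
      obtain ⟨i, -, -, hi'⟩ := exists_third_color hkj
      have hoff : ∀ l, l ≠ i → tri u l = tri v l := fun l hl => by
        rcases hi' l hl with rfl | rfl <;> assumption
      refine .single ⟨fun l hl => ⟨rfl, hl.symm⟩, i, fun h => huv (tri_injective ?_), hoff⟩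
      funext l
      by_cases hl : l = i
      · rw [hl, h]
      · exact hoff l hl
    · refine Relation.ReflTransGen.mono ?_ _ _ (star_connected rfl hj.symm)
      rintro a b ⟨ha, hb, i, h⟩
      refine ⟨fun l hl => ?_, i, fun hi => ?_, h.2⟩
      · by_cases hlj : l = j
        · rw [hlj]; exact ⟨ha, hb⟩
        · exact absurd ⟨l, hlj, hl⟩ hedge
      -- A step changing only the color `j` would keep all labels, since `j` is fixed as well.
      · by_cases hij : i = j
        · refine h.1 (tri_injective (funext fun l => ?_))
          by_cases hl : l = i
          · rw [hl, hij, ha, hb]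
          · exact h.2 l hl
        · exact hedge ⟨i, hij, hi⟩
  · refine Relation.ReflTransGen.mono ?_ _ _ (triAdj_connected u v)
    rintro a b ⟨i, h⟩
    exact ⟨fun l hl => absurd ⟨l, hl⟩ hagree, i, fun hi => hagree ⟨i, hi⟩, h.2⟩

/-! ### Counting qubits and plaquettes -/

/-- Points are sorted by `p.1 - p.2` modulo 3. Swapping coordinates exchanges class `2` with the
centers. A unit shift carries class `0` to the centers, where points of the hypotenuse wrap around
to the side `p.1 = 0`; the corner `(0, 3 * m)` is left over. -/
theorem card_hexQubit (m : ℕ) :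
    Fintype.card (HexQubit m) = 2 * Fintype.card (HexPlaquette m) + 1 := by
  rw [Fintype.card_coe, Fintype.card_coe]
  have h2 : ((trianglePoints m).filter fun p => (p.1 - p.2) % 3 = 2).card
      = ((trianglePoints m).filter fun p => (p.1 - p.2) % 3 = 1).card := by
    refine Finset.card_nbij' Prod.swap Prod.swap ?_ ?_ ?_ ?_
    · intro p hp
      simp only [Finset.coe_filter, mem_trianglePoints, Set.mem_ofPred_eq, Prod.fst_swap,
        Prod.snd_swap] at hp ⊢
      omega
    · intro p hp
      simp only [Finset.coe_filter, mem_trianglePoints, Set.mem_ofPred_eq, Prod.fst_swap,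
        Prod.snd_swap] at hp ⊢
      omega
    · intro p _; simp
    · intro p _; simp
  have h0 : (((trianglePoints m).filter fun p => (p.1 - p.2) % 3 = 0).erase (0, 3 * m)).card
      = ((trianglePoints m).filter fun p => (p.1 - p.2) % 3 = 1).card := by
    refine Finset.card_nbij'
      (fun p => if p.1 + p.2 = 3 * m then (0, p.1 - 1) else (p.1 + 1, p.2))
      (fun p => if p.1 = 0 then (p.2 + 1, 3 * m - p.2 - 1) else (p.1 - 1, p.2)) ?_ ?_ ?_ ?_
    · rintro ⟨a, b⟩ hp
      simp only [Finset.coe_erase, Finset.coe_filter, mem_trianglePoints, Set.mem_sdiff,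
        Set.mem_ofPred_eq, Set.mem_singleton_iff, Prod.mk.injEq] at hp ⊢
      split_ifs
      · simp only; omega
      · simp only; omega
    · rintro ⟨a, b⟩ hp
      simp only [Finset.coe_erase, Finset.coe_filter, mem_trianglePoints, Set.mem_sdiff,
        Set.mem_ofPred_eq, Set.mem_singleton_iff] at hp ⊢
      split_ifs <;> simp only [Prod.mk.injEq] <;> omega
    · rintro ⟨a, b⟩ hp
      simp only [Finset.coe_erase, Finset.coe_filter, mem_trianglePoints, Set.mem_sdiff,
        Set.mem_ofPred_eq, Set.mem_singleton_iff, Prod.mk.injEq] at hp ⊢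
      by_cases h : a + b = 3 * m
      · simp only [h, if_true, Prod.mk.injEq]; omega
      · rw [if_neg h, if_neg (show ¬ a + 1 = 0 by omega)]
        simp only [Prod.mk.injEq, and_true]; omega
    · rintro ⟨a, b⟩ hp
      simp only [Finset.coe_filter, mem_trianglePoints, Set.mem_ofPred_eq] at hp ⊢
      by_cases h : a = 0
      · rw [if_pos h, if_pos (show b + 1 + (3 * m - b - 1) = (3 * m : ℤ) by omega)]
        simp only [Prod.mk.injEq, and_true]; omega
      · rw [if_neg h, if_neg (show ¬ a - 1 + b = 3 * m by omega)]
        simp only [Prod.mk.injEq, and_true]; omega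
  have hmem : ((0, 3 * m) : ℤ × ℤ) ∈ (trianglePoints m).filter fun p => (p.1 - p.2) % 3 = 0 := by
    simp only [Finset.mem_filter, mem_trianglePoints]
    refine ⟨⟨le_refl _, ?_, ?_⟩, ?_⟩ <;> simp
  rw [Finset.card_erase_of_mem hmem] at h0
  have hpos := Finset.card_pos.2 ⟨_, hmem⟩
  have hunion : ((trianglePoints m).filter fun p => (p.1 - p.2) % 3 ≠ 1)
      = ((trianglePoints m).filter fun p => (p.1 - p.2) % 3 = 0) ∪
        ((trianglePoints m).filter fun p => (p.1 - p.2) % 3 = 2) := by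
    ext p
    simp only [Finset.mem_union, Finset.mem_filter]
    rw [← and_or_left, and_congr_right_iff]
    intro _
    omega
  rw [hunion, Finset.card_union_of_disjoint, h2]
  · omega
  · rw [Finset.disjoint_filter]
    intro p _ h
    omega

/-- Of the `3 * m + 1` lattice points on a side, `m` are centers. The three functions below
enumerate the others. -/
theorem card_side {m : ℕ} (i : Fin 3) :
    (Finset.univ.filter fun q : HexQubit m => tri q i = none).card = 2 * m + 1 := by
  have key : ∀ f : ℤ → ℤ × ℤ, (∀ t : ℤ, 0 ≤ t ∧ t < 2 * m + 1 → ((0 ≤ (f t).1 ∧ 0 ≤ (f t).2 ∧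
      (f t).1 + (f t).2 ≤ 3 * m) ∧ ((f t).1 - (f t).2) % 3 ≠ 1) ∧ sideCoord m i (f t) = 0) →
      (∀ s t, f s = f t → s = t) → (∀ q : HexQubit m, sideCoord m i q.1 = 0 →
        ∃ t : ℤ, (0 ≤ t ∧ t < 2 * m + 1) ∧ f t = q.1) →
      (Finset.univ.filter fun q : HexQubit m => tri q i = none).card = 2 * m + 1 := by
    intro f hf hinj hsurj
    have : (Finset.Ico (0 : ℤ) (2 * m + 1)).card = 2 * m + 1 := by
      rw [Int.card_Ico]; omega
    rw [← this]
    symm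
    refine Finset.card_bij (fun t ht => ⟨f t, mem_hexQubit.2 (hf t (Finset.mem_Ico.1 ht)).1⟩)
      ?_ ?_ ?_
    · intro t ht
      simpa [tri_eq_none_iff] using (hf t (Finset.mem_Ico.1 ht)).2
    · intro s _ t _ h
      exact hinj s t (congrArg Subtype.val h)
    · intro q hq
      obtain ⟨t, ht, h⟩ := hsurj q (tri_eq_none_iff.1 (by simpa using hq))
      exact ⟨t, Finset.mem_Ico.2 ht, Subtype.ext h⟩
  rcases fin_three_coe i with h | h | h
  · refine key (fun t => (0, 3 * (t / 2) + t % 2)) ?_ ?_ ?_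
    · intro t ht
      rw [sideCoord_eq_zero_iff]
      simp only
      exact ⟨by omega, Or.inl ⟨h, trivial⟩⟩
    · intro s t hst
      simp only [Prod.mk.injEq] at hst
      omega
    · intro q hq
      have := sideCoord_cases hq
      have := qubit_facts q
      exact ⟨2 * (q.1.2 / 3) + q.1.2 % 3, by omega, Prod.ext (by simp only; omega)
        (by simp only; omega)⟩
  · refine key (fun t => (3 * ((t + 1) / 2) - t % 2, 0)) ?_ ?_ ?_
    · intro t ht
      rw [sideCoord_eq_zero_iff]
      simp only
      exact ⟨by omega, Or.inr (Or.inl ⟨h, trivial⟩)⟩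
    · intro s t hst
      simp only [Prod.mk.injEq] at hst
      omega
    · intro q hq
      have := sideCoord_cases hq
      have := qubit_facts q
      exact ⟨2 * ((q.1.1 + 1) / 3) - (-q.1.1) % 3, by omega, Prod.ext (by simp only; omega)
        (by simp only; omega)⟩
  · refine key (fun t => (3 * (t / 2) + t % 2, 3 * m - (3 * (t / 2) + t % 2))) ?_ ?_ ?_
    · intro t ht
      rw [sideCoord_eq_zero_iff]
      simp only
      exact ⟨by omega, Or.inr (Or.inr ⟨h, by omega⟩)⟩
    · intro s t hst
      simp only [Prod.mk.injEq] at hst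
      omega
    · intro q hq
      have := sideCoord_cases hq
      have := qubit_facts q
      exact ⟨2 * (q.1.1 / 3) + q.1.1 % 3, by omega, Prod.ext (by simp only; omega)
        (by simp only; omega)⟩

theorem card_corner {m : ℕ} {j k : Fin 3} (hjk : j ≠ k) :
    (Finset.univ.filter fun q : HexQubit m => tri q j = none ∧ tri q k = none).card = 1 := by
  obtain ⟨i, hji, hki, hi⟩ := exists_third_color hjk
  obtain ⟨q, hq⟩ := exists_corner m i
  refine Finset.card_eq_one.2 ⟨q, ?_⟩
  ext v
  simp only [Finset.mem_filter, Finset.mem_univ, true_and, Finset.mem_singleton]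
  constructor
  · rintro ⟨h1, h2⟩
    refine eq_of_tri_eq_none (i := i) (fun l hl => ?_) hq
    rcases hi l hl with rfl | rfl <;> assumption
  · rintro rfl
    exact ⟨hq j hji, hq k hki⟩

theorem exists_triAdj_of_ne_none {m : ℕ} {q : HexQubit m} {i j : Fin 3} (hj : j ≠ i)
    (h : tri q j ≠ none) : ∃ v, TriAdj i q v :=
  (exists_triAdj_or_corner i q).resolve_right fun hc => h (hc j hj)

theorem edge_eq_pair {m : ℕ} {i j k : Fin 3} (hi : ∀ l, l ≠ i → l = j ∨ l = k)
    (hji : j ≠ i) (hki : k ≠ i) {u v : HexQubit m} (h : TriAdj i u v) (w : HexQubit m) :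
    (tri w j = tri u j ∧ tri w k = tri u k) ↔ w = u ∨ w = v := by
  constructor
  · rintro ⟨h1, h2⟩
    by_cases hw : w = u
    · exact Or.inl hw
    · refine Or.inr (TriAdj.unique (i := i) ⟨Ne.symm hw, fun l hl => ?_⟩ h)
      rcases hi l hl with rfl | rfl
      · exact h1.symm
      · exact h2.symm
  · rintro (rfl | rfl)
    · exact ⟨rfl, rfl⟩
    · exact ⟨(h.2 j hji).symm, (h.2 k hki).symm⟩

theorem card_edge {m : ℕ} {j k : Fin 3} (hjk : j ≠ k) {u : HexQubit m}
    (hu : tri u j ≠ none ∨ tri u k ≠ none) :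
    (Finset.univ.filter fun q : HexQubit m => tri q j = tri u j ∧ tri q k = tri u k).card = 2 := by
  obtain ⟨i, hji, hki, hi⟩ := exists_third_color hjk
  obtain ⟨v, hv⟩ : ∃ v, TriAdj i u v := by
    rcases hu with h | h
    · exact exists_triAdj_of_ne_none hji h
    · exact exists_triAdj_of_ne_none hki h
  simp only [edge_eq_pair hi hji hki hv]
  refine Finset.card_eq_two.2 ⟨u, v, hv.1, ?_⟩
  ext w
  simp

/-- The number of plaquettes of a given color around a plaquette of another color. -/
theorem card_image_tri_plaquette {m : ℕ} {j k : Fin 3} (hjk : j ≠ k) (P : HexPlaquette m) :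
    2 * ((Finset.univ.filter fun q : HexQubit m => tri q j = some P).image fun q => tri q k).card
      = (Finset.univ.filter fun q : HexQubit m => tri q j = some P).card := by
  rw [Finset.card_eq_sum_card_image (fun q => tri q k)
    (Finset.univ.filter fun q : HexQubit m => tri q j = some P), Finset.sum_const_nat (m := 2),
    mul_comm]
  intro y hy
  obtain ⟨u, hu, rfl⟩ := Finset.mem_image.1 hy
  have hu : tri u j = some P := by simpa using hu
  rw [Finset.filter_filter, ← hu]
  exact card_edge hjk (Or.inl (by simp [hu]))

/-- The number of plaquettes of a given color along a side. -/
theorem card_image_tri_side {m : ℕ} {j k : Fin 3} (hjk : j ≠ k) :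
    ((Finset.univ.filter fun q : HexQubit m => tri q j = none).image fun q => tri q k).card
      = m + 1 := by
  have h := Finset.card_eq_sum_card_image (fun q => tri q k)
    (Finset.univ.filter fun q : HexQubit m => tri q j = none)
  rw [card_side] at h
  have hnone : none ∈ (Finset.univ.filter fun q : HexQubit m => tri q j = none).image
      fun q => tri q k := by
    obtain ⟨q, hq⟩ := Finset.card_pos.1 ((card_corner (m := m) hjk).symm ▸ Nat.one_pos)
    simp only [Finset.mem_filter, Finset.mem_univ, true_and] at hq
    exact Finset.mem_image.2 ⟨q, by simpa using hq.1, hq.2⟩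
  -- On the side `j` each plaquette of color `k` that occurs has two qubits, and `none` occurs once,
  -- at a corner: `2 * m + 1 = 1 + 2 * (N - 1)` for `N` labels.
  rw [← Finset.add_sum_erase _ _ hnone, Finset.filter_filter, card_corner hjk,
    Finset.sum_const_nat (m := 2)] at h
  · rw [Finset.card_erase_of_mem hnone] at h
    have := Finset.card_pos.2 ⟨_, hnone⟩
    omega
  · intro y hy
    obtain ⟨hy0, hy⟩ := Finset.mem_erase.1 hy
    obtain ⟨u, hu, rfl⟩ := Finset.mem_image.1 hy
    have hu : tri u j = none := by simpa using hu
    rw [Finset.filter_filter, ← card_edge hjk (Or.inr hy0)]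
    simp only [hu]

theorem exists_qubit_of_plaquette {m : ℕ} (P : HexPlaquette m) :
    ∃ q : HexQubit m, tri q (plaqColor P) = some P := by
  obtain ⟨h1, h2, h3, h4⟩ := plaquette_facts P
  by_cases hx : P.1.1 = 0
  · obtain ⟨q, hq⟩ := exists_qubit (m := m) (x := 0) (y := P.1.2 - 1) (by omega)
    exact ⟨q, mem_plaquette_iff.1 (neighbors_iff.2 (by omega))⟩
  · obtain ⟨q, hq⟩ := exists_qubit (m := m) (x := P.1.1 - 1) (y := P.1.2) (by omega)
    exact ⟨q, mem_plaquette_iff.1 (neighbors_iff.2 (by omega))⟩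

/-! ### The discharging argument for the 2D distance -/

/-- The value at a qubit of the indicator of a plaquette color, zero on the side of that color. -/
noncomputable def triVal {m : ℕ} (S : HexPlaquette m → ZMod 2) (q : HexQubit m) (i : Fin 3) : ZMod 2 :=
  (tri q i).elim 0 S

/-- A local potential. Its sum around a qubit is at most three if the plaquette values add up to
zero, and at most zero otherwise. -/
def flux (k : ZMod 3) (x y : ZMod 2) : ℤ :=
  if k = 0 then (if x = 0 then (if y = 0 then 1 else 0) else (if y = 0 then -1 else 0))
  else if k = 1 then (if x = 0 then (if y = 0 then -3 else 2) else (if y = 0 then 1 else 0))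
  else (if x = 0 then (if y = 0 then -1 else -2) else (if y = 0 then 3 else 0))

theorem flux_sum_le : ∀ (k : ZMod 3) (x y z : ZMod 2),
    flux k y z + flux k z x + flux k x y ≤ if x + y + z = 0 then 3 else 0 := by
  unfold flux; decide

/-- The arguments are `2 * i + 1 - k` modulo 3 for the colors `i = 0, 1, 2`, as in the second case
of `edgeFlux`. -/
theorem neg_flux_sum_le : ∀ (k : ZMod 3) (x y z : ZMod 2),
    -flux (1 - k) y z + -flux (-k) z x + -flux (2 - k) x y ≤ if x + y + z = 0 then 3 else 0 := by
  unfold flux; decide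

/-- The defect along a side: the label on the side has value `0`, the arguments at the two ends of
the edge are `0` and `2`, and the sum is one unit per end. -/
theorem flux_zero_sub_flux_two : ∀ y : ZMod 2, flux 0 0 y - flux 2 0 y = 2 := by
  unfold flux; decide

/-- The potential flowing through the edge at `q` opposite to the color `i`. -/
noncomputable def edgeFlux {m : ℕ} (S : HexPlaquette m → ZMod 2) (i : Fin 3) (q : HexQubit m) :
    ℤ :=
  if (q.1.1 - q.1.2) % 3 = 0 then flux (q.1.1 : ℤ) (triVal S q (i + 1)) (triVal S q (i + 2))
  -- For an edge opposite to color `i` from `u` of type `0` to `v` of type `2`, `2 * i + 1 - v.1`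
  -- agrees with `u.1` modulo 3 unless the edge lies on the side `i + 1`. So the two ends cancel
  -- everywhere else.
  else -flux ((2 * (i : ℤ) + 1 - q.1.1 : ℤ)) (triVal S q (i + 1)) (triVal S q (i + 2))

theorem sum_edgeFlux_le {m : ℕ} (S : HexPlaquette m → ZMod 2) (q : HexQubit m) :
    ∑ i, edgeFlux S i q ≤ if ∑ i, triVal S q i = 0 then 3 else 0 := by
  rw [Fin.sum_univ_three, Fin.sum_univ_three]
  unfold edgeFlux
  have e1 : (2 + 1 : Fin 3) = 0 := rfl
  have e2 : (1 + 2 : Fin 3) = 0 := rfl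
  have e3 : (1 + 1 : Fin 3) = 2 := rfl
  have e4 : (2 + 2 : Fin 3) = 1 := rfl
  split_ifs with h h' h'
  · have := flux_sum_le (q.1.1 : ℤ) (triVal S q 0) (triVal S q 1) (triVal S q 2)
    rw [if_pos h'] at this
    simpa [e1, e2, e3, e4] using this
  · have := flux_sum_le (q.1.1 : ℤ) (triVal S q 0) (triVal S q 1) (triVal S q 2)
    rw [if_neg h'] at this
    simpa [e1, e2, e3, e4] using this
  all_goals
    have := neg_flux_sum_le (q.1.1 : ℤ) (triVal S q 0) (triVal S q 1) (triVal S q 2)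
    have c0 : (((0 : Fin 3) : ℕ) : ℤ) = 0 := rfl
    have c1 : (((1 : Fin 3) : ℕ) : ℤ) = 1 := rfl
    have c2 : (((2 : Fin 3) : ℕ) : ℤ) = 2 := rfl
    have k1 : ((2 * (((1 : Fin 3) : ℕ) : ℤ) + 1 - q.1.1 : ℤ) : ZMod 3) = -(q.1.1 : ℤ) := by
      rw [c1]
      push_cast
      linear_combination (by decide : (3 : ZMod 3) = 0)
    have k2 : ((2 * (((2 : Fin 3) : ℕ) : ℤ) + 1 - q.1.1 : ℤ) : ZMod 3) = 2 - (q.1.1 : ℤ) := by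
      rw [c2]
      push_cast
      linear_combination (by decide : (3 : ZMod 3) = 0)
    have k0 : ((2 * (((0 : Fin 3) : ℕ) : ℤ) + 1 - q.1.1 : ℤ) : ZMod 3) = 1 - (q.1.1 : ℤ) := by
      rw [c0]
      push_cast
      ring
    rw [k0, k1, k2, e1, e2, e3, e4]
  · rw [if_pos h'] at this
    simpa using this
  · rw [if_neg h'] at this
    simpa using this

theorem zmod_three_eq {a b : ℤ} (h : a % 3 = b % 3) : (a : ZMod 3) = (b : ℤ) :=
  (ZMod.intCast_eq_intCast_iff a b 3).2 h

theorem triVal_none {m : ℕ} (S : HexPlaquette m → ZMod 2) {q : HexQubit m} {i : Fin 3}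
    (h : tri q i = none) : triVal S q i = 0 := by simp [triVal, h]

theorem fin_three_succ_coe (i : Fin 3) : ((i + 1 : Fin 3) : ℤ) = ((i : ℤ) + 1) % 3 := by
  revert i; decide

theorem fin_three_add_two_coe (i : Fin 3) : ((i + 2 : Fin 3) : ℤ) = ((i : ℤ) + 2) % 3 := by
  revert i; decide

theorem fin_three_add_one_ne (i : Fin 3) : i + 1 ≠ i := by revert i; decide

theorem fin_three_add_two_ne (i : Fin 3) : i + 2 ≠ i := by revert i; decide

theorem edgeFlux_add_edgeFlux {m : ℕ} (S : HexPlaquette m → ZMod 2) {i : Fin 3}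
    {u v : HexQubit m} (h : TriAdj i u v) : edgeFlux S i u + edgeFlux S i v =
      (if tri u (i + 1) = none then 1 else 0) + (if tri v (i + 1) = none then 1 else 0) := by
  have main : ∀ {u v : HexQubit m}, TriAdj i u v → (u.1.1 - u.1.2) % 3 = 0 →
      edgeFlux S i u + edgeFlux S i v =
      (if tri u (i + 1) = none then 1 else 0) + (if tri v (i + 1) = none then 1 else 0) := by
    intro u v h hu
    have hv : ¬ (v.1.1 - v.1.2) % 3 = 0 := fun hv => h.type_ne (hu.trans hv.symm)
    have h1 : tri v (i + 1) = tri u (i + 1) := (h.2 _ (fin_three_add_one_ne i)).symm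
    have h2 : tri v (i + 2) = tri u (i + 2) := (h.2 _ (fin_three_add_two_ne i)).symm
    unfold edgeFlux triVal
    rw [if_pos hu, if_neg hv, h1, h2]
    have hf := h.formula hu
    have hs := fin_three_succ_coe i
    unfold AdjFormula at hf
    by_cases hn : tri u (i + 1) = none
    · have hcu := sideCoord_cases (tri_eq_none_iff.1 hn)
      have hcv := sideCoord_cases (tri_eq_none_iff.1 (h1.trans hn))
      rw [if_pos hn, hn, zmod_three_eq (show u.1.1 % 3 = 0 % 3 by omega),
        zmod_three_eq (show (2 * (i : ℤ) + 1 - v.1.1) % 3 = 2 % 3 by omega)]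
      exact flux_zero_sub_flux_two _
    · have hcu := mt (fun h => tri_eq_none_iff.2 (sideCoord_eq_zero_iff.2 h)) hn
      rw [if_neg hn, zmod_three_eq (show u.1.1 % 3 = (2 * (i : ℤ) + 1 - v.1.1) % 3 by omega)]
      ring
  rcases (qubit_facts u).2.2.2 with hu | hu
  · exact main h hu
  · rw [add_comm, main h.symm, add_comm]
    have := (qubit_facts v).2.2.2
    have := h.type_ne
    omega

/-- The corner has no partner, yet it is on the side `i + 1` and contributes one unit like every
other qubit there. -/
theorem edgeFlux_corner {m : ℕ} (S : HexPlaquette m → ZMod 2) {i : Fin 3} {q : HexQubit m}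
    (h : ∀ j, j ≠ i → tri q j = none) : edgeFlux S i q = 1 := by
  have h1 := h (i + 1) (fin_three_add_one_ne i)
  have h2 := h (i + 2) (fin_three_add_two_ne i)
  have hs := fin_three_succ_coe i
  have ht := fin_three_add_two_coe i
  have c1 := sideCoord_cases (tri_eq_none_iff.1 h1)
  have c2 := sideCoord_cases (tri_eq_none_iff.1 h2)
  have := fin_three_coe i
  unfold edgeFlux
  rw [if_pos (by omega), triVal_none S h1, triVal_none S h2,
    zmod_three_eq (show q.1.1 % 3 = 0 % 3 by omega)]
  decide

/-- The qubit adjacent to `q` across the edge opposite to the color `i`. -/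
noncomputable def triNeighbor {m : ℕ} (i : Fin 3) (q : HexQubit m) : HexQubit m :=
  open Classical in if h : ∃ v, TriAdj i q v then h.choose else q

theorem triNeighbor_eq {m : ℕ} {i : Fin 3} {u v : HexQubit m} (h : TriAdj i u v) :
    triNeighbor i u = v := by
  have h' : ∃ v, TriAdj i u v := ⟨v, h⟩
  rw [triNeighbor, dif_pos h']
  exact h'.choose_spec.unique h

theorem triNeighbor_corner {m : ℕ} {i : Fin 3} {q : HexQubit m} (h : ¬ ∃ v, TriAdj i q v) :
    triNeighbor i q = q := dif_neg h

/-- A function that changes sign along the edges opposite to the color `i`, and vanishes at the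
corner, adds up to zero. -/
theorem sum_eq_zero_of_triAdj {m : ℕ} {M : Type} [AddCommMonoid M] (i : Fin 3)
    (f : HexQubit m → M) (hadj : ∀ u v, TriAdj i u v → f u + f v = 0)
    (hcorner : ∀ q, (∀ j, j ≠ i → tri q j = none) → f q = 0) : ∑ q, f q = 0 := by
  refine Finset.sum_involution (fun q _ => triNeighbor i q) ?_ ?_ (fun _ _ => Finset.mem_univ _) ?_
  · intro q _
    rcases exists_triAdj_or_corner i q with ⟨v, hv⟩ | h
    · rw [triNeighbor_eq hv]; exact hadj q v hv
    · rw [triNeighbor_corner fun ⟨v, hv⟩ => not_triAdj_of_corner h hv, hcorner q h, add_zero]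
  · intro q _ hq
    rcases exists_triAdj_or_corner i q with ⟨v, hv⟩ | h
    · rw [triNeighbor_eq hv]; exact hv.1.symm
    · exact absurd (hcorner q h) hq
  · intro q _
    rcases exists_triAdj_or_corner i q with ⟨v, hv⟩ | h
    · simp only [triNeighbor_eq hv, triNeighbor_eq hv.symm]
    · have := triNeighbor_corner fun ⟨v, hv⟩ => not_triAdj_of_corner h hv
      simp only [this]

/-- At least `2 * m + 1` qubits have an even number of marked plaquettes around them. -/
theorem card_triVal_sum_eq_zero_ge {m : ℕ} (S : HexPlaquette m → ZMod 2) :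
    2 * m + 1 ≤ (Finset.univ.filter fun q : HexQubit m => ∑ i, triVal S q i = 0).card := by
  have h1 : ∀ i : Fin 3, ∑ q : HexQubit m, edgeFlux S i q = 2 * m + 1 := by
    intro i
    -- After subtracting the indicator of the side `i + 1`, the flux cancels in pairs and vanishes
    -- at the corner. The total flux is thus the number of qubits on that side.
    have : ∑ q : HexQubit m, (edgeFlux S i q - if tri q (i + 1) = none then 1 else 0) = 0 := by
      refine sum_eq_zero_of_triAdj i _ (fun u v h => ?_) fun q h => ?_
      · have := edgeFlux_add_edgeFlux S h
        linarith
      · rw [edgeFlux_corner S h, if_pos (h _ (fin_three_add_one_ne i)), sub_self]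
    rw [Finset.sum_sub_distrib, Finset.sum_boole, card_side] at this
    push_cast at this
    linarith
  -- Summed over the three colors: `3 * (2 * m + 1)` is at most three times the number of qubits
  -- with even sum.
  have h2 := Finset.sum_le_sum fun q (_ : q ∈ Finset.univ) => sum_edgeFlux_le S q
  rw [Finset.sum_comm, Fin.sum_univ_three, h1, h1, h1, ← Finset.sum_filter, Finset.sum_const,
    nsmul_eq_mul] at h2
  omega

/-! ### CSS codes: stabilizer condition and distance -/

/-- The number of nonzero coordinates of a vector. -/
def supportCard {Q : Type} [Fintype Q] (x : Q → ZMod 2) : ℕ :=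
  (Finset.univ.filter fun q => x q ≠ 0).card

theorem zmod_two_cases (x : ZMod 2) : x = 0 ∨ x = 1 := by revert x; decide

theorem span_xOp_union_zOp {Q : Type} {U W : Set (Set Q)} :
    Submodule.span (ZMod 2) (xOp '' U ∪ zOp '' W) =
      (Submodule.span (ZMod 2) ((fun s : Set Q => s.indicator (1 : Q → ZMod 2)) '' U)).prod
        (Submodule.span (ZMod 2) ((fun s : Set Q => s.indicator (1 : Q → ZMod 2)) '' W)) := by
  rw [← LinearMap.span_inl_union_inr]
  simp only [Set.image_image]
  rfl

theorem pauliCommute_iff {Q : Type} [Fintype Q] (g h : Pauli Q) :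
    PauliCommute g h ↔ g.1 ⬝ᵥ h.2 + g.2 ⬝ᵥ h.1 = 0 := by
  rw [PauliCommute, Finset.sum_add_distrib]; rfl

theorem dotProduct_eq_zero_of_mem_span {Q : Type} [Fintype Q] {x y : Q → ZMod 2}
    {W : Set (Q → ZMod 2)} (h : ∀ w ∈ W, x ⬝ᵥ w = 0) (hy : y ∈ Submodule.span (ZMod 2) W) :
    x ⬝ᵥ y = 0 := by
  induction hy using Submodule.span_induction with
  | mem w hw => exact h w hw
  | zero => exact dotProduct_zero x
  | add a b _ _ ha hb => rw [dotProduct_add, ha, hb, add_zero]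
  | smul c a _ ha => rw [dotProduct_smul, ha, smul_zero]

theorem isStabilizerGroup_prod {Q : Type} [Fintype Q] {U W : Set (Q → ZMod 2)}
    (h : ∀ u ∈ U, ∀ w ∈ W, u ⬝ᵥ w = 0) :
    IsStabilizerGroup ((Submodule.span (ZMod 2) U).prod (Submodule.span (ZMod 2) W)) := by
  have key : ∀ u ∈ Submodule.span (ZMod 2) U, ∀ w ∈ Submodule.span (ZMod 2) W, u ⬝ᵥ w = 0 := by
    intro u hu w hw
    refine dotProduct_eq_zero_of_mem_span (fun w hw => ?_) hw
    rw [dotProduct_comm]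
    refine dotProduct_eq_zero_of_mem_span (fun u hu => ?_) hu
    rw [dotProduct_comm]
    exact h u hu w hw
  rintro ⟨a, b⟩ ⟨ha, hb⟩ ⟨a', b'⟩ ⟨ha', hb'⟩
  rw [pauliCommute_iff]
  simp only at ha hb ha' hb' ⊢
  rw [key a ha b' hb', dotProduct_comm, key a' ha' b hb, add_zero]

/-- The distance of a code whose stabilizer group is generated by an `X` part and a `Z` part. -/
theorem hasCodeDistance_prod {Q : Type} [Fintype Q] {U W : Set (Q → ZMod 2)} {d : ℕ}
    (hX : ∀ a, (∀ w ∈ W, a ⬝ᵥ w = 0) → a ∉ Submodule.span (ZMod 2) U → d ≤ supportCard a)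
    (hZ : ∀ b, (∀ u ∈ U, b ⬝ᵥ u = 0) → b ∉ Submodule.span (ZMod 2) W → d ≤ supportCard b)
    (hex : ∃ b, (∀ u ∈ U, b ⬝ᵥ u = 0) ∧ b ∉ Submodule.span (ZMod 2) W ∧ supportCard b = d) :
    HasCodeDistance ((Submodule.span (ZMod 2) U).prod (Submodule.span (ZMod 2) W)) d := by
  constructor
  · obtain ⟨b, hb, hbW, hd⟩ := hex
    refine ⟨(0, b), ⟨?_, fun h => hbW h.2⟩, ?_⟩
    · rintro ⟨a', b'⟩ ⟨ha', hb'⟩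
      rw [pauliCommute_iff]
      simp only [zero_dotProduct, zero_add]
      exact dotProduct_eq_zero_of_mem_span hb ha'
    · rw [← hd, pauliWeight, supportCard]
      simp
  · rintro w ⟨⟨a, b⟩, ⟨hcomm, hnot⟩, rfl⟩
    have ha : ∀ w ∈ W, a ⬝ᵥ w = 0 := fun w hw => by
      have := (pauliCommute_iff _ _).1 (hcomm (0, w) ⟨zero_mem _, Submodule.subset_span hw⟩)
      simpa using this
    have hb : ∀ u ∈ U, b ⬝ᵥ u = 0 := fun u hu => by
      have := (pauliCommute_iff _ _).1 (hcomm (u, 0) ⟨Submodule.subset_span hu, zero_mem _⟩)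
      simpa using this
    -- One of the two parts is not a stabilizer, and the weight is at least the weight of either
    -- part.
    by_cases h : a ∈ Submodule.span (ZMod 2) U
    · refine (hZ b hb fun h' => hnot ⟨h, h'⟩).trans (Finset.card_le_card fun q hq => ?_)
      simp only [Finset.mem_filter, Finset.mem_univ, true_and] at hq ⊢
      exact Or.inr hq
    · refine (hX a ha h).trans (Finset.card_le_card fun q hq => ?_)
      simp only [Finset.mem_filter, Finset.mem_univ, true_and] at hq ⊢
      exact Or.inl hq

/-! ### Linear algebra and distance of the 2D code -/

/-- The incidence matrix of plaquettes and qubits. -/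
noncomputable def plaqMatrix (m : ℕ) : Matrix (HexPlaquette m) (HexQubit m) (ZMod 2) :=
  fun P => (plaquette m P).indicator 1

theorem plaqMatrix_apply {m : ℕ} (P : HexPlaquette m) (q : HexQubit m) :
    plaqMatrix m P q = if tri q (plaqColor P) = some P then 1 else 0 := by
  classical
  rw [plaqMatrix, Set.indicator_apply]
  simp only [mem_plaquette_iff, Pi.one_apply]

/-- The span of the plaquettes. -/
noncomputable def plaqSpan (m : ℕ) : Submodule (ZMod 2) (HexQubit m → ZMod 2) :=
  Submodule.span (ZMod 2) (Set.range (plaqMatrix m))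

theorem hexCode_eq (m : ℕ) : hexCode m = (plaqSpan m).prod (plaqSpan m) := by
  have := span_xOp_union_zOp (U := Set.range (plaquette m)) (W := Set.range (plaquette m))
  rw [← Set.range_comp, ← Set.range_comp, ← Set.range_comp] at this
  exact this

theorem mulVec_transpose_apply {m : ℕ} (S : HexPlaquette m → ZMod 2) (q : HexQubit m) :
    ((plaqMatrix m).transpose.mulVec S) q = ∑ i, triVal S q i := by
  have h1 : ∀ i, triVal S q i = ∑ P, if tri q i = some P then S P else 0 := by
    intro i
    rw [triVal]
    cases h : tri q i with
    | none => simp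
    | some P => simp
  have h2 : ∀ P, plaqMatrix m P q * S P = ∑ i, if tri q i = some P then S P else 0 := by
    intro P
    rw [plaqMatrix_apply, Finset.sum_eq_single (plaqColor P)]
    · simp
    · intro i _ hi
      rw [if_neg]
      exact fun h => hi (tri_eq_some_iff.1 h).1.symm
    · simp
  simp only [Matrix.mulVec, dotProduct, Matrix.transpose_apply, h1, h2]
  exact Finset.sum_comm

theorem mulVec_transpose_mem {m : ℕ} (S : HexPlaquette m → ZMod 2) :
    (plaqMatrix m).transpose.mulVec S ∈ plaqSpan m := by
  have : (plaqMatrix m).transpose.mulVec S = ∑ P, S P • plaqMatrix m P := by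
    ext q
    simp [Matrix.mulVec, dotProduct, mul_comm]
  rw [this]
  exact Submodule.sum_mem _ fun P _ => Submodule.smul_mem _ _ (Submodule.subset_span ⟨P, rfl⟩)

/-- Ordering plaquettes by the coordinate sum of their centers makes the incidence matrix
triangular: the pivot qubit is one step from the center towards smaller sum, and every other
plaquette around it comes earlier. -/
theorem exists_pivot {m : ℕ} (P : HexPlaquette m) : ∃ q : HexQubit m,
    tri q (plaqColor P) = some P ∧
      ∀ i R, tri q i = some R → R ≠ P → R.1.1 + R.1.2 < P.1.1 + P.1.2 := by
  obtain ⟨h1, h2, h3, h4⟩ := plaquette_facts P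
  have key : ∀ q : HexQubit m, q ∈ plaquette m P → (∀ R : HexPlaquette m, Neighbors R.1 q.1 →
      ¬ (R.1.1 = P.1.1 ∧ R.1.2 = P.1.2) → R.1.1 + R.1.2 < P.1.1 + P.1.2) → ∃ q : HexQubit m,
      tri q (plaqColor P) = some P ∧
        ∀ i R, tri q i = some R → R ≠ P → R.1.1 + R.1.2 < P.1.1 + P.1.2 := by
    intro q hq h
    refine ⟨q, mem_plaquette_iff.1 hq, fun i R hR hRP => h R (tri_eq_some_iff.1 hR).2 ?_⟩
    exact fun h => hRP (Subtype.ext (Prod.ext h.1 h.2))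
  by_cases hx : P.1.1 = 0
  · obtain ⟨q, hq⟩ := exists_qubit (m := m) (x := 0) (y := P.1.2 - 1) (by omega)
    refine key q (neighbors_iff.2 (by omega)) fun R hR hne => ?_
    have := plaquette_facts R
    rw [neighbors_iff] at hR
    omega
  · obtain ⟨q, hq⟩ := exists_qubit (m := m) (x := P.1.1 - 1) (y := P.1.2) (by omega)
    refine key q (neighbors_iff.2 (by omega)) fun R hR hne => ?_
    have := plaquette_facts R
    rw [neighbors_iff] at hR
    omega

theorem eq_zero_of_mulVec_transpose {m : ℕ} {S : HexPlaquette m → ZMod 2}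
    (h : (plaqMatrix m).transpose.mulVec S = 0) : S = 0 := by
  funext P
  obtain ⟨N, hN⟩ : ∃ N : ℕ, P.1.1 + P.1.2 = N := by
    have := plaquette_facts P
    exact ⟨(P.1.1 + P.1.2).toNat, by omega⟩
  induction N using Nat.strong_induction_on generalizing P with
  | _ N ih =>
    obtain ⟨q, hq, hlt⟩ := exists_pivot P
    have hsum := congrFun h q
    rw [mulVec_transpose_apply, Finset.sum_eq_single (plaqColor P)] at hsum
    · simpa [triVal, hq] using hsum
    · intro i _ hi
      rw [triVal]
      cases hR : tri q i with
      | none => rfl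
      | some R =>
        have hRP : R ≠ P := by
          rintro rfl
          exact hi (tri_eq_some_iff.1 hR).1.symm
        have := hlt i R hR hRP
        have := plaquette_facts R
        exact ih (R.1.1 + R.1.2).toNat (by omega) R (by omega)
    · simp

/-- Choose a color `i` different from the colors of `P` and `R`. An edge opposite to `i` keeps both
labels, so its two ends lie together in `P ∩ R` or together outside; the unpaired corner lies in
neither plaquette. -/
theorem plaqMatrix_mul_transpose {m : ℕ} (P R : HexPlaquette m) :
    plaqMatrix m P ⬝ᵥ plaqMatrix m R = 0 := by
  obtain ⟨i, hP, hR⟩ : ∃ i, plaqColor P ≠ i ∧ plaqColor R ≠ i := by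
    generalize plaqColor P = a
    generalize plaqColor R = b
    revert a b; decide
  refine sum_eq_zero_of_triAdj i _ (fun u v h => ?_) fun q h => ?_
  · rw [plaqMatrix_apply, plaqMatrix_apply, plaqMatrix_apply, plaqMatrix_apply, h.2 _ hP, h.2 _ hR]
    exact CharTwo.add_self_eq_zero _
  · rw [plaqMatrix_apply, h _ hP]
    simp

/-- A zero-one vector has the same product with itself as with the all-ones vector, so the even
weight follows from self-orthogonality. -/
theorem plaqMatrix_dot_one {m : ℕ} (P : HexPlaquette m) : plaqMatrix m P ⬝ᵥ 1 = 0 := by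
  rw [← plaqMatrix_mul_transpose P P]
  refine Finset.sum_congr rfl fun q _ => ?_
  rw [plaqMatrix_apply]
  split_ifs <;> simp

theorem one_dot_one (m : ℕ) : (1 : HexQubit m → ZMod 2) ⬝ᵥ 1 = 1 := by
  simp only [dotProduct, Pi.one_apply, mul_one, Finset.sum_const, Finset.card_univ,
    card_hexQubit, nsmul_eq_mul]
  push_cast
  rw [show (2 : ZMod 2) = 0 from rfl]
  simp

/-- Vectors orthogonal to all plaquettes are combinations of plaquettes and the all-ones vector. -/
theorem exists_eq_of_orthogonal {m : ℕ} {x : HexQubit m → ZMod 2}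
    (hx : ∀ P, plaqMatrix m P ⬝ᵥ x = 0) :
    ∃ S, x = (plaqMatrix m).transpose.mulVec S + (x ⬝ᵥ 1) • (1 : HexQubit m → ZMod 2) := by
  let A := plaqMatrix m
  let f : (HexPlaquette m → ZMod 2) × ZMod 2 →ₗ[ZMod 2] (HexQubit m → ZMod 2) :=
    A.transpose.mulVecLin.coprod (LinearMap.toSpanSingleton (ZMod 2) _ 1)
  have hf : ∀ p, f p = A.transpose.mulVec p.1 + p.2 • (1 : HexQubit m → ZMod 2) := fun p => by
    rw [LinearMap.coprod_apply, Matrix.mulVecLin_apply, LinearMap.toSpanSingleton_apply]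
  have hone : ∀ S, A.transpose.mulVec S ⬝ᵥ 1 = 0 := fun S => by
    rw [dotProduct_comm]
    refine dotProduct_eq_zero_of_mem_span ?_ (mulVec_transpose_mem S)
    rintro _ ⟨P, rfl⟩
    rw [dotProduct_comm]
    exact plaqMatrix_dot_one P
  -- As the number of qubits is odd and plaquettes are even, pairing with the all-ones vector reads
  -- off the coefficient `p.2`.
  have hdot : ∀ p, f p ⬝ᵥ 1 = p.2 := fun p => by
    rw [hf, add_dotProduct, hone, smul_dotProduct, one_dot_one, zero_add, smul_eq_mul, mul_one]
  have hinj : Function.Injective f := by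
    rw [← LinearMap.ker_eq_bot, LinearMap.ker_eq_bot']
    rintro ⟨S, c⟩ h
    have hc : c = 0 := by
      have := hdot (S, c)
      rwa [h, zero_dotProduct, eq_comm] at this
    subst hc
    rw [hf] at h
    simp only [zero_smul, add_zero] at h
    rw [eq_zero_of_mulVec_transpose h]
    rfl
  -- With `p` plaquettes the range has dimension `p + 1`, and the kernel has dimension `(2p + 1) -
  -- p`.
  have hker : LinearMap.range f = LinearMap.ker A.mulVecLin := by
    refine Submodule.eq_of_le_of_finrank_eq ?_ ?_
    · rintro _ ⟨p, rfl⟩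
      rw [LinearMap.mem_ker, Matrix.mulVecLin_apply]
      funext P
      rw [hf]
      change A P ⬝ᵥ _ = 0
      rw [dotProduct_add, dotProduct_smul, plaqMatrix_dot_one, smul_zero, add_zero]
      refine dotProduct_eq_zero_of_mem_span ?_ (mulVec_transpose_mem p.1)
      rintro _ ⟨R, rfl⟩
      exact plaqMatrix_mul_transpose P R
    · have h1 := LinearMap.finrank_range_of_inj hinj
      have h2 := LinearMap.finrank_range_add_finrank_ker A.mulVecLin
      have h3 : Module.finrank (ZMod 2) (LinearMap.range A.mulVecLin)
          = Fintype.card (HexPlaquette m) := by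
        change A.rank = _
        rw [← Matrix.rank_transpose]
        have : Function.Injective A.transpose.mulVecLin := by
          rw [← LinearMap.ker_eq_bot, LinearMap.ker_eq_bot']
          exact fun S h => eq_zero_of_mulVec_transpose h
        have := LinearMap.finrank_range_of_inj this
        rw [Module.finrank_fintype_fun_eq_card] at this
        exact this
      rw [Module.finrank_prod, Module.finrank_fintype_fun_eq_card, Module.finrank_self] at h1
      rw [Module.finrank_fintype_fun_eq_card, h3, card_hexQubit] at h2
      omega
  have hmem : x ∈ LinearMap.ker A.mulVecLin := by
    rw [LinearMap.mem_ker, Matrix.mulVecLin_apply]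
    exact funext hx
  rw [← hker] at hmem
  obtain ⟨⟨S, c⟩, rfl⟩ := hmem
  refine ⟨S, ?_⟩
  rw [hdot, hf]

theorem mem_plaqSpan_of_orthogonal {m : ℕ} {x : HexQubit m → ZMod 2}
    (hx : ∀ P, plaqMatrix m P ⬝ᵥ x = 0) (h : x ⬝ᵥ 1 = 0) : x ∈ plaqSpan m := by
  obtain ⟨S, hS⟩ := exists_eq_of_orthogonal hx
  rw [hS, h, zero_smul, add_zero]
  exact mulVec_transpose_mem S

/-- The distance bound of the 2D code: an odd vector orthogonal to all plaquettes has weight at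
least `2 * m + 1`. -/
theorem supportCard_ge_of_orthogonal {m : ℕ} {x : HexQubit m → ZMod 2}
    (hx : ∀ P, plaqMatrix m P ⬝ᵥ x = 0) (h : x ⬝ᵥ 1 ≠ 0) : 2 * m + 1 ≤ supportCard x := by
  obtain ⟨S, hS⟩ := exists_eq_of_orthogonal hx
  have h1 : x ⬝ᵥ 1 = 1 := (zmod_two_cases _).resolve_left h
  rw [h1, one_smul] at hS
  -- Where the number of marked plaquettes is even, the all-ones summand survives.
  refine (card_triVal_sum_eq_zero_ge S).trans (Finset.card_le_card fun q hq => ?_)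
  simp only [Finset.mem_filter, Finset.mem_univ, true_and] at hq ⊢
  rw [hS, Pi.add_apply, mulVec_transpose_apply, hq]
  simp

/-- The indicator of a side of the triangle. -/
noncomputable def sideVec (m : ℕ) (i : Fin 3) : HexQubit m → ZMod 2 :=
  fun q => if tri q i = none then 1 else 0

/-- Each qubit lies in exactly one plaquette of color `i`, unless it is on the side `i`. Modulo
stabilizers, every side is therefore the full logical operator. -/
theorem sideVec_eq (m : ℕ) (i : Fin 3) : sideVec m i =
    1 + (plaqMatrix m).transpose.mulVec fun P => if plaqColor P = i then 1 else 0 := by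
  funext q
  rw [Pi.add_apply, mulVec_transpose_apply, Finset.sum_eq_single i]
  · rw [sideVec, triVal]
    cases h : tri q i with
    | none => simp
    | some P =>
      simp only [reduceCtorEq, if_false, Option.elim_some, (tri_eq_some_iff.1 h).1, if_true]
      rfl
  · intro j _ hj
    rw [triVal]
    cases h : tri q j with
    | none => rfl
    | some P =>
      simp only [Option.elim_some, (tri_eq_some_iff.1 h).1, if_neg hj]
  · simp

theorem one_add_sideVec_mem (m : ℕ) (i : Fin 3) : 1 + sideVec m i ∈ plaqSpan m := by
  rw [sideVec_eq, ← add_assoc, show (1 : HexQubit m → ZMod 2) + 1 = 0 from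
    funext fun _ => CharTwo.add_self_eq_zero (1 : ZMod 2), zero_add]
  exact mulVec_transpose_mem _

theorem dot_eq_zero_of_mem_plaqSpan {m : ℕ} {x y : HexQubit m → ZMod 2}
    (hx : ∀ P, plaqMatrix m P ⬝ᵥ x = 0) (hy : y ∈ plaqSpan m) : x ⬝ᵥ y = 0 := by
  refine dotProduct_eq_zero_of_mem_span ?_ hy
  rintro _ ⟨P, rfl⟩
  rw [dotProduct_comm]
  exact hx P

theorem plaqMatrix_dot_sideVec {m : ℕ} (P : HexPlaquette m) (i : Fin 3) :
    plaqMatrix m P ⬝ᵥ sideVec m i = 0 := by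
  have h := dot_eq_zero_of_mem_plaqSpan (plaqMatrix_mul_transpose · P) (one_add_sideVec_mem m i)
  rwa [dotProduct_add, plaqMatrix_dot_one, zero_add] at h

theorem sideVec_dot_one (m : ℕ) (i : Fin 3) : sideVec m i ⬝ᵥ 1 = 1 := by
  have h := dot_eq_zero_of_mem_plaqSpan (m := m) plaqMatrix_dot_one (one_add_sideVec_mem m i)
  rw [dotProduct_add, one_dot_one, dotProduct_comm] at h
  have := zmod_two_cases (sideVec m i ⬝ᵥ 1)
  rcases this with h' | h'
  · rw [h'] at h; simp at h
  · exact h'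

theorem supportCard_sideVec (m : ℕ) (i : Fin 3) : supportCard (sideVec m i) = 2 * m + 1 := by
  rw [← card_side i, supportCard]
  congr 1
  ext q
  simp [sideVec]

theorem hexCode_isStabilizerGroup (m : ℕ) : IsStabilizerGroup (hexCode m) := by
  rw [hexCode_eq]
  refine isStabilizerGroup_prod ?_
  rintro _ ⟨P, rfl⟩ _ ⟨R, rfl⟩
  exact plaqMatrix_mul_transpose P R

theorem hexCode_hasCodeDistance (m : ℕ) : HasCodeDistance (hexCode m) (2 * m + 1) := by
  rw [hexCode_eq]
  have key : ∀ a : HexQubit m → ZMod 2, (∀ w ∈ Set.range (plaqMatrix m), a ⬝ᵥ w = 0) →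
      a ∉ Submodule.span (ZMod 2) (Set.range (plaqMatrix m)) → 2 * m + 1 ≤ supportCard a := by
    intro a ha hmem
    have ha' : ∀ P, plaqMatrix m P ⬝ᵥ a = 0 := fun P => by
      rw [dotProduct_comm]; exact ha _ ⟨P, rfl⟩
    exact supportCard_ge_of_orthogonal ha' fun h => hmem (mem_plaqSpan_of_orthogonal ha' h)
  refine hasCodeDistance_prod key key ⟨sideVec m 0, ?_, ?_, supportCard_sideVec m 0⟩
  · rintro _ ⟨P, rfl⟩
    rw [dotProduct_comm]
    exact plaqMatrix_dot_sideVec P 0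
  -- Stabilizers have even weight, a side has odd weight.
  · intro h
    have := dot_eq_zero_of_mem_plaqSpan plaqMatrix_dot_one h
    rw [dotProduct_comm, sideVec_dot_one] at this
    exact one_ne_zero this

/-! ### Vectors on the layers of the stack; edges and even vectors -/

/-- A vector on the 2D code, placed on one layer of the stack. -/
def liftLayer {m : ℕ} (t : Fin (2 * m)) :
    (HexQubit m → ZMod 2) →ₗ[ZMod 2] (StackQubit m → ZMod 2) where
  toFun x := Sum.elim (fun p => if p.1 = t then x p.2 else 0) fun _ => 0
  map_add' x y := by
    ext (p | _)
    · by_cases h : p.1 = t <;> simp [h]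
    · simp
  map_smul' c x := by
    ext (p | _)
    · by_cases h : p.1 = t <;> simp [h]
    · simp

theorem liftLayer_inl {m : ℕ} (t s : Fin (2 * m)) (x : HexQubit m → ZMod 2) (q : HexQubit m) :
    liftLayer t x (Sum.inl (s, q)) = if s = t then x q else 0 := rfl

theorem liftLayer_inr {m : ℕ} (t : Fin (2 * m)) (x : HexQubit m → ZMod 2) (u : Unit) :
    liftLayer t x (Sum.inr u) = 0 := rfl

/-- The restriction of a vector to a layer. -/
def layerVec {m : ℕ} (A : StackQubit m → ZMod 2) (t : Fin (2 * m)) : HexQubit m → ZMod 2 :=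
  fun q => A (Sum.inl (t, q))

theorem dot_liftLayer {m : ℕ} (A : StackQubit m → ZMod 2) (t : Fin (2 * m))
    (x : HexQubit m → ZMod 2) : A ⬝ᵥ liftLayer t x = layerVec A t ⬝ᵥ x := by
  rw [dotProduct, Fintype.sum_sum_type, Fintype.sum_prod_type, Finset.sum_eq_single t]
  · simp [liftLayer_inl, liftLayer_inr, dotProduct, layerVec]
  · intro s _ hs
    simp [liftLayer_inl, hs]
  · simp

theorem layerVec_liftLayer_self {m : ℕ} (t : Fin (2 * m)) (x : HexQubit m → ZMod 2) :
    layerVec (liftLayer t x) t = x := by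
  funext q
  simp [layerVec, liftLayer_inl]

theorem layerVec_liftLayer_of_ne {m : ℕ} {s t : Fin (2 * m)} (h : s ≠ t)
    (x : HexQubit m → ZMod 2) : layerVec (liftLayer t x) s = 0 := by
  funext q
  simp [layerVec, liftLayer_inl, h]

/-- The indicator of a whole layer. -/
noncomputable def wholeVec (m l : ℕ) : StackQubit m → ZMod 2 := (wholeLayer l).indicator 1

/-- The lower layer of a pair. -/
def lowerLayer {m : ℕ} (k : Fin m) : Fin (2 * m) := ⟨2 * k, by omega⟩

/-- The upper layer of a pair. -/
def upperLayer {m : ℕ} (k : Fin m) : Fin (2 * m) := ⟨2 * k + 1, by omega⟩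

theorem lowerLayer_ne_upperLayer {m : ℕ} (k l : Fin m) : lowerLayer k ≠ upperLayer l := by
  simp only [lowerLayer, upperLayer, ne_eq, Fin.mk.injEq]
  omega

theorem upperLayer_ne_lowerLayer {m : ℕ} (k l : Fin m) : upperLayer k ≠ lowerLayer l :=
  (lowerLayer_ne_upperLayer l k).symm

theorem layer_cases {m : ℕ} (t : Fin (2 * m)) : ∃ k : Fin m, t = lowerLayer k ∨ t = upperLayer k := by
  refine ⟨⟨t / 2, by omega⟩, ?_⟩
  simp only [lowerLayer, upperLayer, Fin.ext_iff]
  omega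

theorem indicator_onLayer {m : ℕ} (t : Fin (2 * m)) (s : Set (HexQubit m)) :
    (onLayer (t + 1) s).indicator (1 : StackQubit m → ZMod 2) = liftLayer t (s.indicator 1) := by
  classical
  ext (⟨i, q⟩ | u)
  · rw [liftLayer_inl, Set.indicator_apply, Set.indicator_apply, ← ite_and]
    congr 1
    simp only [onLayer, layerOf, Set.mem_ofPred_eq, Sum.inl.injEq, Prod.mk.injEq, eq_iff_iff,
      Fin.ext_iff]
    constructor
    · rintro ⟨h, j, v, hv, hj, rfl⟩
      exact ⟨by omega, hv⟩
    · rintro ⟨h, hq⟩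
      exact ⟨by omega, i, q, hq, rfl, rfl⟩
  · rw [liftLayer_inr, Set.indicator_apply, if_neg]
    simp [onLayer]

theorem wholeVec_layer {m : ℕ} (t : Fin (2 * m)) : wholeVec m (t + 1) = liftLayer t 1 := by
  classical
  ext (⟨i, q⟩ | u)
  · rw [liftLayer_inl, wholeVec, Set.indicator_apply]
    congr 1
    simp only [wholeLayer, layerOf, Set.mem_ofPred_eq, Fin.ext_iff, eq_iff_iff]
    omega
  · rw [liftLayer_inr, wholeVec, Set.indicator_apply, if_neg]
    simp only [wholeLayer, layerOf, Set.mem_ofPred_eq]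
    omega

theorem wholeVec_ancilla (m : ℕ) :
    wholeVec m (2 * m + 1) = Sum.elim (fun _ => 0) fun _ => 1 := by
  classical
  ext (⟨i, q⟩ | u)
  · rw [wholeVec, Set.indicator_apply, if_neg]
    · rfl
    · simp only [wholeLayer, layerOf, Set.mem_ofPred_eq]
      omega
  · rw [wholeVec, Set.indicator_apply, if_pos]
    · rfl
    · simp only [wholeLayer, layerOf, Set.mem_ofPred_eq]

theorem dot_wholeVec_layer {m : ℕ} (A : StackQubit m → ZMod 2) (t : Fin (2 * m)) :
    A ⬝ᵥ wholeVec m (t + 1) = layerVec A t ⬝ᵥ 1 := by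
  rw [wholeVec_layer, dot_liftLayer]

theorem dot_wholeVec_ancilla {m : ℕ} (A : StackQubit m → ZMod 2) :
    A ⬝ᵥ wholeVec m (2 * m + 1) = A (Sum.inr ()) := by
  rw [wholeVec_ancilla, dotProduct, Fintype.sum_sum_type]
  simp

/-- The indicator of an edge. -/
noncomputable def edgeVec {m : ℕ} (e : Sym2 (HexQubit m)) : HexQubit m → ZMod 2 :=
  (edgeQubits e).indicator 1

theorem edgeVec_mk {m : ℕ} {u v : HexQubit m} (h : u ≠ v) :
    edgeVec s(u, v) = Pi.single u 1 + Pi.single v 1 := by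
  classical
  funext q
  rw [edgeVec, Set.indicator_apply, Pi.add_apply, Pi.single_apply, Pi.single_apply]
  by_cases h1 : q = u
  · subst h1
    simp [edgeQubits, h]
  · by_cases h2 : q = v
    · subst h2
      simp [edgeQubits, h1]
    · simp [edgeQubits, h1, h2]

/-- Vectors of even weight are combinations of edges. -/
theorem mem_span_edgeVec {m : ℕ} {x : HexQubit m → ZMod 2} (hx : x ⬝ᵥ 1 = 0) :
    x ∈ Submodule.span (ZMod 2) (edgeVec '' (hexGraph m).edgeSet) := by
  obtain ⟨o, -⟩ := exists_qubit (m := m) (x := 0) (y := 0) (by simp)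
  have hpair : ∀ u : HexQubit m, (Pi.single u 1 + Pi.single o 1 : HexQubit m → ZMod 2) ∈
      Submodule.span (ZMod 2) (edgeVec '' (hexGraph m).edgeSet) := by
    intro u
    induction triAdj_connected o u with
    | refl =>
      rw [show (Pi.single o 1 + Pi.single o 1 : HexQubit m → ZMod 2) = 0 from
        funext fun q => CharTwo.add_self_eq_zero _]
      exact zero_mem _
    | @tail b c _ h ih =>
      have hbc := hexGraph_adj_iff.2 h
      have := Submodule.add_mem _ (Submodule.subset_span (s := edgeVec '' (hexGraph m).edgeSet)
        (R := ZMod 2) ⟨s(c, b), hbc.symm, rfl⟩) ih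
      rw [edgeVec_mk hbc.symm.ne] at this
      convert this using 1
      rw [add_assoc, ← add_assoc (Pi.single b 1),
        show (Pi.single b 1 + Pi.single b 1 : HexQubit m → ZMod 2) = 0 from
        funext fun q => CharTwo.add_self_eq_zero _, zero_add]
  -- The added terms at `o` occur as many times as the weight of `x`, which is even.
  have : x = ∑ u, x u • (Pi.single u 1 + Pi.single o 1 : HexQubit m → ZMod 2) := by
    simp only [smul_add, Finset.sum_add_distrib]
    rw [← Finset.sum_smul]
    have h0 : ∑ u, x u = 0 := by simpa [dotProduct] using hx
    rw [h0, zero_smul, add_zero]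
    ext q
    simp [Finset.sum_apply, Pi.single_apply]
  rw [this]
  exact Submodule.sum_mem _ fun u _ => Submodule.smul_mem _ _ (hpair u)

/-- A vector that is orthogonal to all edges is constant. -/
theorem eq_smul_one_of_dot_edgeVec {m : ℕ} {x : HexQubit m → ZMod 2}
    (hx : ∀ e ∈ (hexGraph m).edgeSet, x ⬝ᵥ edgeVec e = 0) : ∃ c : ZMod 2, x = c • 1 := by
  obtain ⟨o, -⟩ := exists_qubit (m := m) (x := 0) (y := 0) (by simp)
  refine ⟨x o, funext fun q => ?_⟩
  rw [Pi.smul_apply, Pi.one_apply, smul_eq_mul, mul_one]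
  induction triAdj_connected o q with
  | refl => rfl
  | @tail b c _ h ih =>
    have hbc := hexGraph_adj_iff.2 h
    have := hx s(b, c) hbc
    rw [edgeVec_mk hbc.ne, dotProduct_add, dotProduct_single, dotProduct_single, mul_one,
      mul_one] at this
    rw [← ih]
    exact (CharTwo.add_eq_zero.1 this).symm

/-! ### The stacked code as a CSS code -/

/-- The supports of the `X` generators of the stack. -/
def stackXGens (m : ℕ) : Set (StackQubit m → ZMod 2) := {u | ∃ k : Fin m,
  (∃ P, u = liftLayer (lowerLayer k) (plaqMatrix m P) + liftLayer (upperLayer k) (plaqMatrix m P)) ∨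
  u = liftLayer (upperLayer k) 1 + wholeVec m (2 * k + 3)}

/-- The supports of the `Z` generators of the stack. -/
def stackZGens (m : ℕ) : Set (StackQubit m → ZMod 2) := {w | ∃ k : Fin m,
  (∃ e ∈ (hexGraph m).edgeSet,
    w = liftLayer (lowerLayer k) (edgeVec e) + liftLayer (upperLayer k) (edgeVec e)) ∨
  (∃ P, w = liftLayer (lowerLayer k) (plaqMatrix m P)) ∨
  (∃ P, w = liftLayer (upperLayer k) (plaqMatrix m P)) ∨
  w = liftLayer (upperLayer k) 1 + wholeVec m (2 * k + 3)}

/-- Removes the choice of `E` and splits off the plaquettes of the upper layers. Pairs are counted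
from zero here: the pair `k` consists of the layers `2 * k + 1` and `2 * k + 2`, and `2 * k + 3` is
the next layer, which is the ancilla for the last pair. -/
theorem stackedCode_eq {m : ℕ} {E : Set (Sym2 (HexQubit m))} (hE : IsGaugeEdgeSet m E) :
    stackedCode m E = (Submodule.span (ZMod 2) (stackXGens m)).prod
      (Submodule.span (ZMod 2) (stackZGens m)) := by
  have lo : ∀ (k : Fin m) (s : Set (HexQubit m)),
      (onLayer (2 * (k + 1) - 1) s).indicator (1 : StackQubit m → ZMod 2)
        = liftLayer (lowerLayer k) (s.indicator 1) := fun k s =>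
    indicator_onLayer (lowerLayer k) s
  have hi : ∀ (k : Fin m) (s : Set (HexQubit m)),
      (onLayer (2 * (k + 1)) s).indicator (1 : StackQubit m → ZMod 2)
        = liftLayer (upperLayer k) (s.indicator 1) := fun k s =>
    indicator_onLayer (upperLayer k) s
  have whi : ∀ k : Fin m, (wholeLayer (2 * (k + 1))).indicator (1 : StackQubit m → ZMod 2)
      = liftLayer (upperLayer k) 1 := fun k => wholeVec_layer (upperLayer k)
  have wnext : ∀ k : Fin m, (wholeLayer (2 * (k + 1) + 1)).indicator (1 : StackQubit m → ZMod 2)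
      = wholeVec m (2 * k + 3) := fun k => rfl
  apply le_antisymm
  · rw [stackedCode, Submodule.span_le]
    rintro g ⟨k', hk1, hkm, h⟩
    obtain ⟨k, rfl⟩ : ∃ k : Fin m, k' = k + 1 := ⟨⟨k' - 1, by omega⟩, by simp only; omega⟩
    rcases h with ⟨e, he, rfl⟩ | ⟨P, rfl⟩ | ⟨P, rfl⟩ | ⟨P, rfl⟩ | rfl | rfl
    · refine ⟨by simp [zOp], ?_⟩
      simp only [zOp, Prod.snd_add, lo, hi]
      exact Submodule.subset_span ⟨k, Or.inl ⟨e, hE.1 he, rfl⟩⟩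
    · refine ⟨by simp [zOp], ?_⟩
      simp only [zOp, lo]
      exact Submodule.subset_span ⟨k, Or.inr (Or.inl ⟨P, rfl⟩)⟩
    · refine ⟨?_, by simp [xOp]⟩
      simp only [xOp, Prod.fst_add, lo, hi]
      exact Submodule.subset_span ⟨k, Or.inl ⟨P, rfl⟩⟩
    · refine ⟨by simp [zOp], ?_⟩
      simp only [zOp, Prod.snd_add, lo, hi]
      exact Submodule.add_mem _ (Submodule.subset_span ⟨k, Or.inr (Or.inl ⟨P, rfl⟩)⟩)
        (Submodule.subset_span ⟨k, Or.inr (Or.inr (Or.inl ⟨P, rfl⟩))⟩)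
    · refine ⟨?_, by simp [xOp]⟩
      simp only [xOp, Prod.fst_add, whi, wnext]
      exact Submodule.subset_span ⟨k, Or.inr rfl⟩
    · refine ⟨by simp [zOp], ?_⟩
      simp only [zOp, Prod.snd_add, whi, wnext]
      exact Submodule.subset_span ⟨k, Or.inr (Or.inr (Or.inr rfl))⟩
  · have hgen : ∀ (k : Fin m) (g : Pauli (StackQubit m)),
        ((∃ e ∈ E, g = zOp (onLayer (2 * (k + 1) - 1) (edgeQubits e))
          + zOp (onLayer (2 * (k + 1)) (edgeQubits e)))
        ∨ (∃ P, g = zOp (onLayer (2 * (k + 1) - 1) (plaquette m P)))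
        ∨ (∃ P, g = xOp (onLayer (2 * (k + 1) - 1) (plaquette m P))
          + xOp (onLayer (2 * (k + 1)) (plaquette m P)))
        ∨ (∃ P, g = zOp (onLayer (2 * (k + 1) - 1) (plaquette m P))
          + zOp (onLayer (2 * (k + 1)) (plaquette m P)))
        ∨ g = xOp (wholeLayer (2 * (k + 1))) + xOp (wholeLayer (2 * (k + 1) + 1))
        ∨ g = zOp (wholeLayer (2 * (k + 1))) + zOp (wholeLayer (2 * (k + 1) + 1))) →
        g ∈ stackedCode m E := fun k g hg =>
      Submodule.subset_span ⟨k + 1, by omega, by omega, hg⟩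
    have hlo : ∀ (k : Fin m) P, ((0, liftLayer (lowerLayer k) (plaqMatrix m P)) :
        Pauli (StackQubit m)) ∈ stackedCode m E := fun k P => by
      have := hgen k _ (Or.inr (Or.inl ⟨P, rfl⟩))
      rwa [zOp, lo] at this
    have hboth : ∀ (k : Fin m) P, ((0, liftLayer (lowerLayer k) (plaqMatrix m P) +
        liftLayer (upperLayer k) (plaqMatrix m P)) :
        Pauli (StackQubit m)) ∈ stackedCode m E := fun k P => by
      have := hgen k _ (Or.inr (Or.inr (Or.inr (Or.inl ⟨P, rfl⟩))))
      rwa [zOp, zOp, lo, hi, Prod.mk_add_mk, add_zero] at this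
    rw [← LinearMap.span_inl_union_inr, Submodule.span_le]
    rintro _ (⟨u, ⟨k, ⟨P, rfl⟩ | rfl⟩, rfl⟩ | ⟨w, ⟨k, h⟩, rfl⟩)
    · have := hgen k _ (Or.inr (Or.inr (Or.inl ⟨P, rfl⟩)))
      rwa [xOp, xOp, lo, hi, Prod.mk_add_mk, add_zero] at this
    · have := hgen k _ (Or.inr (Or.inr (Or.inr (Or.inr (Or.inl rfl)))))
      rwa [xOp, xOp, whi, wnext, Prod.mk_add_mk, add_zero] at this
    · rcases h with ⟨e, he, rfl⟩ | ⟨P, rfl⟩ | ⟨P, rfl⟩ | rfl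
      -- `φ` copies the Z part of a 2D operator to both layers. It sends the edges in `E` and the
      -- plaquettes to stabilizers, hence, by the gauge condition, all edges.
      · let φ : Pauli (HexQubit m) →ₗ[ZMod 2] Pauli (StackQubit m) :=
          LinearMap.inr (ZMod 2) _ _ ∘ₗ
            (liftLayer (lowerLayer k) + liftLayer (upperLayer k)) ∘ₗ LinearMap.snd (ZMod 2) _ _
        suffices Submodule.span (ZMod 2) ((fun e => zOp (edgeQubits e)) '' E ∪
            Set.range (fun P => zOp (plaquette m P))) ≤ (stackedCode m E).comap φ from
          this (hE.2 e he)
        rw [Submodule.span_le]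
        rintro _ (⟨e, he, rfl⟩ | ⟨P, rfl⟩)
        · have := hgen k _ (Or.inl ⟨e, he, rfl⟩)
          rwa [zOp, zOp, lo, hi, Prod.mk_add_mk, add_zero] at this
        · exact hboth k P
      · exact hlo k P
      · have := Submodule.add_mem _ (hlo k P) (hboth k P)
        rw [Prod.mk_add_mk, add_zero, ← add_assoc, show liftLayer (lowerLayer k) (plaqMatrix m P) +
          liftLayer (lowerLayer k) (plaqMatrix m P) = 0 from
          funext fun q => CharTwo.add_self_eq_zero _, zero_add] at this
        exact this
      · have := hgen k _ (Or.inr (Or.inr (Or.inr (Or.inr (Or.inr rfl)))))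
        rwa [zOp, zOp, whi, wnext, Prod.mk_add_mk, add_zero] at this

theorem lowerLayer_injective {m : ℕ} : Function.Injective (lowerLayer (m := m)) := by
  intro k l h
  simp only [lowerLayer, Fin.mk.injEq] at h
  exact Fin.ext (by omega)

theorem upperLayer_injective {m : ℕ} : Function.Injective (upperLayer (m := m)) := by
  intro k l h
  simp only [upperLayer, Fin.mk.injEq] at h
  exact Fin.ext (by omega)

/-- A vector on the 2D code, placed on both layers of a pair. -/
def doubleLayer {m : ℕ} (k : Fin m) :
    (HexQubit m → ZMod 2) →ₗ[ZMod 2] (StackQubit m → ZMod 2) :=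
  liftLayer (lowerLayer k) + liftLayer (upperLayer k)

theorem doubleLayer_apply {m : ℕ} (k : Fin m) (x : HexQubit m → ZMod 2) :
    doubleLayer k x = liftLayer (lowerLayer k) x + liftLayer (upperLayer k) x := rfl

theorem layerVec_add {m : ℕ} (A B : StackQubit m → ZMod 2) (t : Fin (2 * m)) :
    layerVec (A + B) t = layerVec A t + layerVec B t := rfl

theorem layerVec_doubleLayer_lower {m : ℕ} (k j : Fin m) (x : HexQubit m → ZMod 2) :
    layerVec (doubleLayer k x) (lowerLayer j) = if j = k then x else 0 := by
  rw [doubleLayer_apply, layerVec_add,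
    layerVec_liftLayer_of_ne (lowerLayer_ne_upperLayer j k), add_zero]
  split_ifs with h
  · rw [h, layerVec_liftLayer_self]
  · exact layerVec_liftLayer_of_ne (lowerLayer_injective.ne h) x

theorem layerVec_doubleLayer_upper {m : ℕ} (k j : Fin m) (x : HexQubit m → ZMod 2) :
    layerVec (doubleLayer k x) (upperLayer j) = if j = k then x else 0 := by
  rw [doubleLayer_apply, layerVec_add,
    layerVec_liftLayer_of_ne (upperLayer_ne_lowerLayer j k), zero_add]
  split_ifs with h
  · rw [h, layerVec_liftLayer_self]
  · exact layerVec_liftLayer_of_ne (upperLayer_injective.ne h) x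

theorem eq_sum_layers {m : ℕ} (A : StackQubit m → ZMod 2) :
    A = ∑ k, (liftLayer (lowerLayer k) (layerVec A (lowerLayer k)) +
      liftLayer (upperLayer k) (layerVec A (upperLayer k))) +
      A (Sum.inr ()) • wholeVec m (2 * m + 1) := by
  ext (⟨t, q⟩ | u)
  · rw [wholeVec_ancilla, Pi.add_apply, Finset.sum_apply]
    simp only [Pi.add_apply, liftLayer_inl, Pi.smul_apply, Sum.elim_inl, smul_zero, add_zero]
    obtain ⟨j, rfl | rfl⟩ := layer_cases t
    · rw [Finset.sum_eq_single j]
      · simp [lowerLayer_ne_upperLayer, layerVec]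
      · intro k _ hk
        simp [lowerLayer_ne_upperLayer, lowerLayer_injective.ne hk.symm]
      · simp
    · rw [Finset.sum_eq_single j]
      · simp [upperLayer_ne_lowerLayer, layerVec]
      · intro k _ hk
        simp [upperLayer_ne_lowerLayer, upperLayer_injective.ne hk.symm]
      · simp
  · rw [wholeVec_ancilla, Pi.add_apply, Finset.sum_apply]
    simp [liftLayer_inr]

theorem wholeVec_eq_layer_or_ancilla {m l : ℕ} (h1 : 1 ≤ l) (h2 : l ≤ 2 * m + 1) :
    (∃ t : Fin (2 * m), l = t + 1) ∨ l = 2 * m + 1 := by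
  by_cases h : l = 2 * m + 1
  · exact Or.inr h
  · exact Or.inl ⟨⟨l - 1, by omega⟩, by simp only; omega⟩

theorem wholeVec_dot_wholeVec {m l l' : ℕ} (h1 : 1 ≤ l) (h2 : l ≤ 2 * m + 1) (h1' : 1 ≤ l')
    (h2' : l' ≤ 2 * m + 1) : wholeVec m l ⬝ᵥ wholeVec m l' = if l = l' then 1 else 0 := by
  obtain ⟨t, rfl⟩ | rfl := wholeVec_eq_layer_or_ancilla h1' h2'
  · rw [dot_wholeVec_layer]
    obtain ⟨s, rfl⟩ | rfl := wholeVec_eq_layer_or_ancilla h1 h2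
    · rw [wholeVec_layer]
      by_cases h : t = s
      · rw [h, layerVec_liftLayer_self, one_dot_one, if_pos rfl]
      · rw [layerVec_liftLayer_of_ne h, zero_dotProduct, if_neg]
        rw [Fin.ext_iff] at h
        omega
    · rw [wholeVec_ancilla, if_neg (by omega)]
      exact zero_dotProduct _
  · rw [dot_wholeVec_ancilla]
    obtain ⟨s, rfl⟩ | rfl := wholeVec_eq_layer_or_ancilla h1 h2
    · rw [wholeVec_layer, liftLayer_inr, if_neg (by omega)]
    · rw [wholeVec_ancilla, if_pos rfl]
      rfl

theorem exists_layerVec_wholeVec {m l : ℕ} (h1 : 1 ≤ l) (h2 : l ≤ 2 * m + 1) (t : Fin (2 * m)) :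
    ∃ c : ZMod 2, layerVec (wholeVec m l) t = c • 1 := by
  obtain ⟨s, rfl⟩ | rfl := wholeVec_eq_layer_or_ancilla h1 h2
  · rw [wholeVec_layer]
    by_cases h : t = s
    · exact ⟨1, by rw [h, layerVec_liftLayer_self, one_smul]⟩
    · exact ⟨0, by rw [layerVec_liftLayer_of_ne h, zero_smul]⟩
  · exact ⟨0, by rw [wholeVec_ancilla, zero_smul]; rfl⟩

theorem one_dot_edgeVec {m : ℕ} {e : Sym2 (HexQubit m)} (he : e ∈ (hexGraph m).edgeSet) :
    (1 : HexQubit m → ZMod 2) ⬝ᵥ edgeVec e = 0 := by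
  induction e with
  | _ u v =>
    rw [edgeVec_mk (SimpleGraph.Adj.ne ((SimpleGraph.mem_edgeSet _).1 he)), dotProduct_add,
      dotProduct_single, dotProduct_single]
    exact CharTwo.add_self_eq_zero _

theorem layerVec_one {m : ℕ} (t : Fin (2 * m)) :
    layerVec (1 : StackQubit m → ZMod 2) t = 1 := rfl

theorem liftLayer_upper_one {m : ℕ} (k : Fin m) :
    liftLayer (upperLayer k) 1 = wholeVec m (2 * k + 2) :=
  (wholeVec_layer (upperLayer k)).symm

theorem one_dot_wholeVec {m l : ℕ} (h1 : 1 ≤ l) (h2 : l ≤ 2 * m + 1) :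
    (1 : StackQubit m → ZMod 2) ⬝ᵥ wholeVec m l = 1 := by
  obtain ⟨s, rfl⟩ | rfl := wholeVec_eq_layer_or_ancilla h1 h2
  · rw [dot_wholeVec_layer, layerVec_one, one_dot_one]
  · rw [dot_wholeVec_ancilla]
    rfl

/-- A double plaquette meets a double edge equally on both layers, and plaquettes and whole layers
evenly. A Bell operator is constant on each layer and so meets even vectors evenly; two Bell
operators are disjoint or share two layers of odd size. -/
theorem stackGens_orthogonal {m : ℕ} : ∀ u ∈ stackXGens m, ∀ w ∈ stackZGens m, u ⬝ᵥ w = 0 := by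
  rintro u ⟨k, hu⟩ w ⟨j, hw⟩
  have hj := j.2
  have hk := k.2
  rcases hu with ⟨P, rfl⟩ | rfl
  · rw [← doubleLayer_apply]
    rcases hw with ⟨e, he, rfl⟩ | ⟨R, rfl⟩ | ⟨R, rfl⟩ | rfl
    · rw [dotProduct_add, dot_liftLayer, dot_liftLayer, layerVec_doubleLayer_lower,
        layerVec_doubleLayer_upper]
      exact CharTwo.add_self_eq_zero _
    · rw [dot_liftLayer, layerVec_doubleLayer_lower]
      split_ifs
      · exact plaqMatrix_mul_transpose P R
      · exact zero_dotProduct _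
    · rw [dot_liftLayer, layerVec_doubleLayer_upper]
      split_ifs
      · exact plaqMatrix_mul_transpose P R
      · exact zero_dotProduct _
    · have key : ∀ l, 1 ≤ l → l ≤ 2 * m + 1 →
          doubleLayer k (plaqMatrix m P) ⬝ᵥ wholeVec m l = 0 := by
        intro l h1 h2
        obtain ⟨t, rfl⟩ | rfl := wholeVec_eq_layer_or_ancilla h1 h2
        · rw [dot_wholeVec_layer]
          obtain ⟨i, rfl | rfl⟩ := layer_cases t
          · rw [layerVec_doubleLayer_lower]
            split_ifs
            · exact plaqMatrix_dot_one P
            · exact zero_dotProduct _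
          · rw [layerVec_doubleLayer_upper]
            split_ifs
            · exact plaqMatrix_dot_one P
            · exact zero_dotProduct _
        · rw [dot_wholeVec_ancilla, doubleLayer_apply, Pi.add_apply, liftLayer_inr, liftLayer_inr,
            add_zero]
      rw [liftLayer_upper_one, dotProduct_add, key _ (by omega) (by omega),
        key _ (by omega) (by omega), add_zero]
  · rw [liftLayer_upper_one]
    have hc : ∀ t, ∃ c : ZMod 2,
        layerVec (wholeVec m (2 * k + 2) + wholeVec m (2 * k + 3)) t = c • 1 := by
      intro t
      obtain ⟨c, hc⟩ := exists_layerVec_wholeVec (l := 2 * k + 2) (by omega) (by omega) t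
      obtain ⟨c', hc'⟩ := exists_layerVec_wholeVec (l := 2 * k + 3) (by omega) (by omega) t
      exact ⟨c + c', by rw [layerVec_add, hc, hc', add_smul]⟩
    have key : ∀ t x, (1 : HexQubit m → ZMod 2) ⬝ᵥ x = 0 →
        (wholeVec m (2 * k + 2) + wholeVec m (2 * k + 3)) ⬝ᵥ liftLayer t x = 0 := by
      intro t x hx
      obtain ⟨c, hc⟩ := hc t
      rw [dot_liftLayer, hc, smul_dotProduct, hx, smul_zero]
    rcases hw with ⟨e, he, rfl⟩ | ⟨R, rfl⟩ | ⟨R, rfl⟩ | rfl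
    · rw [dotProduct_add, key _ _ (one_dot_edgeVec he), key _ _ (one_dot_edgeVec he), add_zero]
    · exact key _ _ ((dotProduct_comm _ _).trans (plaqMatrix_dot_one R))
    · exact key _ _ ((dotProduct_comm _ _).trans (plaqMatrix_dot_one R))
    · rw [liftLayer_upper_one, add_dotProduct, dotProduct_add, dotProduct_add,
        wholeVec_dot_wholeVec, wholeVec_dot_wholeVec, wholeVec_dot_wholeVec,
        wholeVec_dot_wholeVec] <;> try omega
      by_cases h : (k : ℕ) = j
      · rw [if_pos (by omega), if_neg (by omega), if_neg (by omega), if_pos (by omega)]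
        decide
      · rw [if_neg (by omega), if_neg (by omega), if_neg (by omega), if_neg (by omega)]
        decide

theorem stackedCode_isStabilizerGroup {m : ℕ} {E : Set (Sym2 (HexQubit m))}
    (hE : IsGaugeEdgeSet m E) : IsStabilizerGroup (stackedCode m E) := by
  rw [stackedCode_eq hE]
  exact isStabilizerGroup_prod stackGens_orthogonal

/-! ### The distance of the stacked code -/

theorem doubleLayer_mem_span_stackXGens {m : ℕ} (k : Fin m) {x : HexQubit m → ZMod 2}
    (hx : x ∈ plaqSpan m) : doubleLayer k x ∈ Submodule.span (ZMod 2) (stackXGens m) := by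
  suffices plaqSpan m ≤ (Submodule.span (ZMod 2) (stackXGens m)).comap (doubleLayer k) from this hx
  rw [plaqSpan, Submodule.span_le]
  rintro _ ⟨P, rfl⟩
  exact Submodule.subset_span ⟨k, Or.inl ⟨P, rfl⟩⟩

theorem doubleLayer_mem_span_stackZGens {m : ℕ} (k : Fin m) {x : HexQubit m → ZMod 2}
    (hx : x ⬝ᵥ 1 = 0) : doubleLayer k x ∈ Submodule.span (ZMod 2) (stackZGens m) := by
  suffices Submodule.span (ZMod 2) (edgeVec '' (hexGraph m).edgeSet) ≤
    (Submodule.span (ZMod 2) (stackZGens m)).comap (doubleLayer k) from this (mem_span_edgeVec hx)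
  rw [Submodule.span_le]
  rintro _ ⟨e, he, rfl⟩
  exact Submodule.subset_span ⟨k, Or.inl ⟨e, he, rfl⟩⟩

theorem liftLayer_mem_span_stackZGens {m : ℕ} (t : Fin (2 * m)) {x : HexQubit m → ZMod 2}
    (hx : x ∈ plaqSpan m) : liftLayer t x ∈ Submodule.span (ZMod 2) (stackZGens m) := by
  suffices plaqSpan m ≤ (Submodule.span (ZMod 2) (stackZGens m)).comap (liftLayer t) from this hx
  rw [plaqSpan, Submodule.span_le]
  rintro _ ⟨P, rfl⟩
  obtain ⟨k, rfl | rfl⟩ := layer_cases t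
  · exact Submodule.subset_span ⟨k, Or.inr (Or.inl ⟨P, rfl⟩)⟩
  · exact Submodule.subset_span ⟨k, Or.inr (Or.inr (Or.inl ⟨P, rfl⟩))⟩

theorem supportCard_layerVec_add_le {m : ℕ} (A : StackQubit m → ZMod 2) {s t : Fin (2 * m)} :
    supportCard (layerVec A s + layerVec A t) ≤ supportCard A := by
  classical
  refine Finset.card_le_card_of_injOn
    (fun q => if layerVec A s q ≠ 0 then Sum.inl (s, q) else Sum.inl (t, q)) ?_ ?_
  · intro q hq
    simp only [Finset.coe_filter, Finset.mem_univ, true_and, Set.mem_ofPred_eq] at hq ⊢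
    split_ifs with h
    · exact h
    · rw [not_not] at h
      rw [Pi.add_apply, h, zero_add] at hq
      exact hq
  · intro q _ q' _ h
    dsimp only at h
    split_ifs at h <;> simp only [Sum.inl.injEq, Prod.mk.injEq] at h <;> exact h.2

theorem supportCard_layerVec_le {m : ℕ} (A : StackQubit m → ZMod 2) (t : Fin (2 * m)) :
    supportCard (layerVec A t) ≤ supportCard A := by
  refine Finset.card_le_card_of_injOn (fun q => Sum.inl (t, q)) ?_ ?_
  · intro q hq
    simp only [Finset.coe_filter, Finset.mem_univ, true_and, Set.mem_ofPred_eq] at hq ⊢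
    exact hq
  · intro q _ q' _ h
    simpa using h

/-- X type operators. All plaquettes of single layers are Z stabilizers, so every layer is a logical
operator of the 2D code and an odd layer already has the required weight. If all layers are even,
only stabilizers remain. -/
theorem supportCard_ge_of_dot_stackZGens {m : ℕ} (hm : 1 ≤ m) {A : StackQubit m → ZMod 2}
    (hA : ∀ w ∈ stackZGens m, A ⬝ᵥ w = 0) (hmem : A ∉ Submodule.span (ZMod 2) (stackXGens m)) :
    2 * m + 1 ≤ supportCard A := by
  have hplaq : ∀ t P, plaqMatrix m P ⬝ᵥ layerVec A t = 0 := by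
    intro t P
    rw [dotProduct_comm, ← dot_liftLayer]
    obtain ⟨k, rfl | rfl⟩ := layer_cases t
    · exact hA _ ⟨k, Or.inr (Or.inl ⟨P, rfl⟩)⟩
    · exact hA _ ⟨k, Or.inr (Or.inr (Or.inl ⟨P, rfl⟩))⟩
  by_cases hodd : ∃ t, layerVec A t ⬝ᵥ 1 ≠ 0
  · obtain ⟨t, ht⟩ := hodd
    exact (supportCard_ge_of_orthogonal (hplaq t) ht).trans (supportCard_layerVec_le A t)
  · simp only [ne_eq, not_exists, not_not] at hodd
    refine absurd ?_ hmem
    -- The last Bell operator compares the ancilla with the parity of the layer below it.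
    have hanc : A (Sum.inr ()) = 0 := by
      have := hA _ ⟨⟨m - 1, by omega⟩, Or.inr (Or.inr (Or.inr rfl))⟩
      rw [dotProduct_add, dot_liftLayer, hodd, zero_add,
        show 2 * (m - 1) + 3 = 2 * m + 1 by omega, dot_wholeVec_ancilla] at this
      exact this
    -- Orthogonality to the double edges makes the sum of the two layers constant; it is zero
    -- because it is even on an odd number of qubits.
    have heq : ∀ k, layerVec A (upperLayer k) = layerVec A (lowerLayer k) := by
      intro k
      obtain ⟨c, hc⟩ := eq_smul_one_of_dot_edgeVec
        (x := layerVec A (upperLayer k) + layerVec A (lowerLayer k)) (by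
          intro e he
          rw [add_dotProduct, ← dot_liftLayer, ← dot_liftLayer, add_comm, ← dotProduct_add]
          exact hA _ ⟨k, Or.inl ⟨e, he, rfl⟩⟩)
      have hc0 : c = 0 := by
        have := congrArg (· ⬝ᵥ (1 : HexQubit m → ZMod 2)) hc
        simp only [add_dotProduct, hodd, smul_dotProduct, one_dot_one, add_zero, smul_eq_mul,
          mul_one] at this
        exact this.symm
      rw [hc0, zero_smul] at hc
      exact funext fun q => CharTwo.add_eq_zero.1 (congrFun hc q)
    rw [eq_sum_layers A, hanc, zero_smul, add_zero]
    refine Submodule.sum_mem _ fun k _ => ?_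
    rw [heq]
    exact doubleLayer_mem_span_stackXGens k (mem_plaqSpan_of_orthogonal (hplaq _) (hodd _))

/-- Z type operators. The X plaquettes are doubled, so only the sum of the two layers of a pair is
constrained by the 2D code. When these sums are all even, the number of layers supplies the bound
instead. -/
theorem supportCard_ge_of_dot_stackXGens {m : ℕ} {B : StackQubit m → ZMod 2}
    (hB : ∀ u ∈ stackXGens m, B ⬝ᵥ u = 0) (hmem : B ∉ Submodule.span (ZMod 2) (stackZGens m)) :
    2 * m + 1 ≤ supportCard B := by
  have hplaq : ∀ k P,
      plaqMatrix m P ⬝ᵥ (layerVec B (lowerLayer k) + layerVec B (upperLayer k)) = 0 := by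
    intro k P
    rw [dotProduct_comm, add_dotProduct, ← dot_liftLayer, ← dot_liftLayer, ← dotProduct_add]
    exact hB _ ⟨k, Or.inl ⟨P, rfl⟩⟩
  by_cases hodd : ∃ k, (layerVec B (lowerLayer k) + layerVec B (upperLayer k)) ⬝ᵥ 1 ≠ 0
  · obtain ⟨k, hk⟩ := hodd
    exact (supportCard_ge_of_orthogonal (hplaq k) hk).trans (supportCard_layerVec_add_le B)
  simp only [ne_eq, not_exists, not_not] at hodd
  -- Inside a pair the parities agree by `hodd`; from one pair to the next, or to the ancilla, they
  -- agree by the X Bell operator.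
  have hpar : ∀ l, l ≤ 2 * m → B ⬝ᵥ wholeVec m (l + 1) = B ⬝ᵥ wholeVec m 1 := by
    intro l
    induction l with
    | zero => exact fun _ => rfl
    | succ l ih =>
      intro hl
      rw [← ih (by omega)]
      obtain ⟨k, rfl | rfl⟩ : ∃ k, l = 2 * k ∨ l = 2 * k + 1 := ⟨l / 2, by omega⟩
      · have := hodd ⟨k, by omega⟩
        rw [add_dotProduct, ← dot_wholeVec_layer, ← dot_wholeVec_layer] at this
        exact (CharTwo.add_eq_zero.1 this).symm
      · have := hB _ ⟨⟨k, by omega⟩, Or.inr rfl⟩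
        rw [liftLayer_upper_one, dotProduct_add] at this
        exact (CharTwo.add_eq_zero.1 this).symm
  have hanc : B (Sum.inr ()) = B ⬝ᵥ wholeVec m 1 := by
    rw [← dot_wholeVec_ancilla B, hpar _ le_rfl]
  have hlay : ∀ t, layerVec B t ⬝ᵥ 1 = B ⬝ᵥ wholeVec m 1 := fun t => by
    rw [← dot_wholeVec_layer, hpar _ t.2.le]
  rcases zmod_two_cases (B ⬝ᵥ wholeVec m 1) with h0 | h1
  · refine absurd ?_ hmem
    rw [h0] at hanc hlay
    rw [eq_sum_layers B, hanc, zero_smul, add_zero]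
    refine Submodule.sum_mem _ fun k _ => ?_
    -- Layers `x` and `y` of a pair are split as the doubled even vector `x`, generated by double
    -- edges, plus `x + y` on the upper layer, generated by plaquettes.
    have h1 := doubleLayer_mem_span_stackZGens k (hlay (lowerLayer k))
    have h2 := liftLayer_mem_span_stackZGens (upperLayer k)
      (mem_plaqSpan_of_orthogonal (hplaq k) (hodd k))
    have h3 := add_mem h1 h2
    rw [doubleLayer_apply, map_add, add_assoc, ← add_assoc (liftLayer (upperLayer k) _),
      show liftLayer (upperLayer k) (layerVec B (lowerLayer k)) +
        liftLayer (upperLayer k) (layerVec B (lowerLayer k)) = 0 from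
        funext fun q => CharTwo.add_self_eq_zero _, zero_add] at h3
    exact h3
  · rw [h1] at hanc hlay
    have hne : ∀ t, ∃ q, B (Sum.inl (t, q)) ≠ 0 := by
      intro t
      by_contra! h
      have := hlay t
      rw [show layerVec B t = 0 from funext h, zero_dotProduct] at this
      exact zero_ne_one this
    choose q hq using hne
    -- One nonzero entry on each of the `2 * m` layers of odd parity, and one on the ancilla.
    have := Finset.card_le_card_of_injOn (s := (Finset.univ : Finset (Option (Fin (2 * m)))))
      (t := Finset.univ.filter fun q => B q ≠ 0)
      (fun o => o.elim (Sum.inr ()) fun t => Sum.inl (t, q t)) (by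
        rintro (_ | t) _
        · simp [hanc]
        · simp [hq]) (by
        rintro (_ | t) _ (_ | s) _ h
        · rfl
        · simp at h
        · simp at h
        · simp only [Option.elim_some, Sum.inl.injEq, Prod.mk.injEq] at h
          rw [h.1])
    simpa [supportCard] using this

theorem one_dot_stackZGens {m : ℕ} : ∀ w ∈ stackZGens m, (1 : StackQubit m → ZMod 2) ⬝ᵥ w = 0 := by
  rintro w ⟨k, hw⟩
  have hk := k.2
  rcases hw with ⟨e, he, rfl⟩ | ⟨R, rfl⟩ | ⟨R, rfl⟩ | rfl
  · rw [dotProduct_add, dot_liftLayer, dot_liftLayer, layerVec_one, layerVec_one]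
    exact CharTwo.add_self_eq_zero _
  · rw [dot_liftLayer, layerVec_one, dotProduct_comm]
    exact plaqMatrix_dot_one R
  · rw [dot_liftLayer, layerVec_one, dotProduct_comm]
    exact plaqMatrix_dot_one R
  · rw [liftLayer_upper_one, dotProduct_add, one_dot_wholeVec (by omega) (by omega),
      one_dot_wholeVec (by omega) (by omega)]
    exact CharTwo.add_self_eq_zero _

theorem supportCard_liftLayer {m : ℕ} (t : Fin (2 * m)) (x : HexQubit m → ZMod 2) :
    supportCard (liftLayer t x) = supportCard x := by
  refine le_antisymm ?_ ?_
  · refine Finset.card_le_card_of_surjOn (fun q => Sum.inl (t, q)) ?_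
    rintro (⟨s, q⟩ | u) hq
    · simp only [Finset.coe_filter, Finset.mem_univ, true_and, Set.mem_ofPred_eq, liftLayer_inl,
        ne_eq, ite_eq_right_iff, Classical.not_imp] at hq
      exact ⟨q, by simpa using hq.2, by rw [hq.1]⟩
    · simp [liftLayer_inr] at hq
  · have := supportCard_layerVec_le (liftLayer t x) t
    rwa [layerVec_liftLayer_self] at this

/-- The minimum is attained by a Z operator along a side on the first layer. No X Bell operator
touches this layer, and all Z stabilizers have even weight. -/
theorem stackedCode_hasCodeDistance {m : ℕ} (hm : 1 ≤ m) {E : Set (Sym2 (HexQubit m))}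
    (hE : IsGaugeEdgeSet m E) : HasCodeDistance (stackedCode m E) (2 * m + 1) := by
  rw [stackedCode_eq hE]
  refine hasCodeDistance_prod (fun A hA => supportCard_ge_of_dot_stackZGens hm hA)
    (fun B hB => supportCard_ge_of_dot_stackXGens hB)
    ⟨liftLayer (lowerLayer ⟨0, hm⟩) (sideVec m 0), ?_, ?_, ?_⟩
  · rintro u ⟨k, ⟨P, rfl⟩ | rfl⟩
    · rw [dotProduct_comm, ← doubleLayer_apply, dot_liftLayer, layerVec_doubleLayer_lower]
      split_ifs
      · exact plaqMatrix_dot_sideVec P 0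
      · exact zero_dotProduct _
    · have key : ∀ l, 2 ≤ l → l ≤ 2 * m + 1 →
          liftLayer (lowerLayer ⟨0, hm⟩) (sideVec m 0) ⬝ᵥ wholeVec m l = 0 := by
        intro l h1 h2
        obtain ⟨t, rfl⟩ | rfl := wholeVec_eq_layer_or_ancilla (by omega) h2
        · rw [dot_wholeVec_layer, layerVec_liftLayer_of_ne, zero_dotProduct]
          rw [lowerLayer, ne_eq, Fin.ext_iff]
          simp only
          omega
        · rw [dot_wholeVec_ancilla, liftLayer_inr]
      have hk := k.2
      rw [liftLayer_upper_one, dotProduct_add, key _ (by omega) (by omega),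
        key _ (by omega) (by omega), add_zero]
  · intro h
    have := dotProduct_eq_zero_of_mem_span one_dot_stackZGens h
    rw [dot_liftLayer, layerVec_one, dotProduct_comm, sideVec_dot_one] at this
    exact one_ne_zero this
  · rw [supportCard_liftLayer, supportCard_sideVec]

/-! ### The triangulation behind the stacked code -/

/-- The tetrahedra of the 3D triangulation are the qubits of the stack and the removed tetrahedron.
They are stacked up, with the removed tetrahedron at the bottom. -/
def facetHeight {m : ℕ} : Option (StackQubit m) → ℕ
  | none => 0
  | some (Sum.inl (t, _)) => t + 1
  | some (Sum.inr _) => 2 * m + 1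

/-- The vertices of a tetrahedron that come from the 2D code: plaquettes of a pair of layers, or
`none` for a boundary. -/
noncomputable def facetPlaq {m : ℕ} : Option (StackQubit m) → Fin 3 → Option (ℕ × HexPlaquette m)
  | none, _ => none
  | some (Sum.inl (t, q)), i => (tri q i).map (Prod.mk ((t : ℕ) / 2))
  | some (Sum.inr _), _ => none

/-- The four vertices of a tetrahedron. -/
noncomputable def facetLabel {m : ℕ} (f : Option (StackQubit m)) :
    Option (Fin 3) → Option (ℕ × HexPlaquette m) ⊕ ℕ
  -- Heights `2c` and `2c + 1` share the cell `c`, whereas plaquettes are shared by heights `2k + 1`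
  -- and `2k + 2`. Cells and plaquettes thus pair consecutive layers in the two alternate ways.
  | none => Sum.inr (facetHeight f / 2)
  | some i => Sum.inl (facetPlaq f i)

theorem facetLabel_some_eq_iff {m : ℕ} {f g : Option (StackQubit m)} {i : Fin 3} :
    facetLabel f (some i) = facetLabel g (some i) ↔ facetPlaq f i = facetPlaq g i :=
  Sum.inl_injective.eq_iff

theorem facetLabel_none_eq_iff {m : ℕ} {f g : Option (StackQubit m)} :
    facetLabel f none = facetLabel g none ↔ facetHeight f / 2 = facetHeight g / 2 :=
  Sum.inr_injective.eq_iff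

theorem facetPlaq_inl {m : ℕ} (t : Fin (2 * m)) (q : HexQubit m) (i : Fin 3) :
    facetPlaq (some (Sum.inl (t, q))) i = (tri q i).map (Prod.mk ((t : ℕ) / 2)) := rfl

theorem facetPlaq_inl_eq_some {m : ℕ} {t : Fin (2 * m)} {q : HexQubit m} {i : Fin 3} {k : ℕ}
    {P : HexPlaquette m} :
    facetPlaq (some (Sum.inl (t, q))) i = some (k, P) ↔ (t : ℕ) / 2 = k ∧ tri q i = some P := by
  rw [facetPlaq_inl]
  cases tri q i with
  | none => simp
  | some R => simp [Prod.ext_iff]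

theorem facetPlaq_inl_eq_none {m : ℕ} {t : Fin (2 * m)} {q : HexQubit m} {i : Fin 3} :
    facetPlaq (some (Sum.inl (t, q))) i = none ↔ tri q i = none := by
  rw [facetPlaq_inl, Option.map_eq_none_iff]

theorem facetPlaq_eq_some {m : ℕ} {f : Option (StackQubit m)} {i : Fin 3} {k : ℕ}
    {P : HexPlaquette m} (h : facetPlaq f i = some (k, P)) :
    ∃ t q, f = some (Sum.inl (t, q)) ∧ (t : ℕ) / 2 = k ∧ tri q i = some P := by
  rcases f with _ | ⟨⟨t, q⟩ | u⟩
  · cases h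
  · exact ⟨t, q, rfl, facetPlaq_inl_eq_some.1 h⟩
  · cases h

theorem facetPlaq_inl_eq_inl_iff {m : ℕ} {s t : Fin (2 * m)} (hst : (s : ℕ) / 2 = (t : ℕ) / 2)
    {q r : HexQubit m} {i : Fin 3} :
    facetPlaq (some (Sum.inl (s, q))) i = facetPlaq (some (Sum.inl (t, r))) i ↔
      tri q i = tri r i := by
  rw [facetPlaq_inl, facetPlaq_inl, hst]
  exact (Option.map_injective (Prod.mk_right_injective _)).eq_iff

theorem facetHeight_inl {m : ℕ} (t : Fin (2 * m)) (q : HexQubit m) :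
    facetHeight (some (Sum.inl (t, q))) = t + 1 := rfl

theorem facetHeight_le {m : ℕ} (f : Option (StackQubit m)) : facetHeight f ≤ 2 * m + 1 := by
  rcases f with _ | ⟨⟨t, q⟩ | u⟩
  · exact Nat.zero_le _
  · rw [facetHeight_inl]; omega
  · exact le_rfl

theorem exists_tri_ne_none {m : ℕ} (hm : 1 ≤ m) (q : HexQubit m) : ∃ i, tri q i ≠ none := by
  by_contra! h
  simp only [tri_eq_none_iff] at h
  have h0 := h 0
  have h1 := h 1
  have h2 := h 2
  simp only [sideCoord, if_true, Fin.reduceEq, if_false] at h0 h1 h2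
  omega

/-- A plaquette label fixes the pair of layers, the cell then fixes the layer, and `tri` the qubit.
Without plaquette labels only the removed tetrahedron and the ancilla are left, in the distinct
cells `0` and `m`. -/
theorem facet_ext {m : ℕ} (hm : 1 ≤ m) {f g : Option (StackQubit m)}
    (h : ∀ i, facetPlaq f i = facetPlaq g i) (hc : facetHeight f / 2 = facetHeight g / 2) :
    f = g := by
  by_cases hf : ∃ i, facetPlaq f i ≠ none
  · obtain ⟨i, hi⟩ := hf
    obtain ⟨⟨k, P⟩, hP⟩ := Option.ne_none_iff_exists'.1 hi
    obtain ⟨t, q, rfl, ht, hq⟩ := facetPlaq_eq_some hP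
    obtain ⟨s, r, rfl, hs, hr⟩ := facetPlaq_eq_some ((h i).symm.trans hP)
    rw [facetHeight_inl, facetHeight_inl] at hc
    obtain rfl : t = s := Fin.ext (by omega)
    obtain rfl : q = r := tri_injective (funext fun i => (facetPlaq_inl_eq_inl_iff rfl).1 (h i))
    rfl
  · have key : ∀ f : Option (StackQubit m), (∀ i, facetPlaq f i = none) →
        f = none ∨ f = some (Sum.inr ()) := by
      rintro (_ | ⟨⟨t, q⟩ | u⟩) hf
      · exact Or.inl rfl
      · obtain ⟨i, hi⟩ := exists_tri_ne_none hm q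
        exact absurd (facetPlaq_inl_eq_none.1 (hf i)) hi
      · exact Or.inr rfl
    have hf' : ∀ i, facetPlaq f i = none := by simpa using hf
    rcases key f hf' with rfl | rfl <;> rcases key g (fun i => (h i).symm.trans (hf' i)) with rfl | rfl
    · rfl
    · simp only [facetHeight] at hc
      omega
    · simp only [facetHeight] at hc
      omega
    · rfl

theorem facetLabel_injective {m : ℕ} (hm : 1 ≤ m) :
    Function.Injective (facetLabel (m := m)) := fun _ _ h =>
  facet_ext hm (fun i => facetLabel_some_eq_iff.1 (congrFun h (some i)))
    (facetLabel_none_eq_iff.1 (congrFun h none))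

/-- The qubit at the corner of the triangle with a plaquette of color `i` only. -/
noncomputable def cornerQubit (m : ℕ) (i : Fin 3) : HexQubit m := (exists_corner m i).choose

theorem tri_cornerQubit {m : ℕ} {i j : Fin 3} (h : j ≠ i) : tri (cornerQubit m i) j = none :=
  (exists_corner m i).choose_spec j h

/-- The tetrahedra around the edge of two boundaries, by height. -/
noncomputable def cornerFacet (m : ℕ) (i : Fin 3) (h : ℕ) : Option (StackQubit m) :=
  if h = 0 then none
  else if ht : h - 1 < 2 * m then some (Sum.inl (⟨h - 1, ht⟩, cornerQubit m i))
  else some (Sum.inr ())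

theorem cornerFacet_succ {m : ℕ} (i : Fin 3) (t : Fin (2 * m)) :
    cornerFacet m i (t + 1) = some (Sum.inl (t, cornerQubit m i)) := by
  rw [cornerFacet, if_neg (Nat.succ_ne_zero _), dif_pos (show (t : ℕ) + 1 - 1 < 2 * m from t.2)]
  rfl

theorem cornerFacet_top {m : ℕ} (i : Fin 3) :
    cornerFacet m i (2 * m + 1) = some (Sum.inr ()) := by
  rw [cornerFacet, if_neg (Nat.succ_ne_zero _), dif_neg]
  simp

theorem eq_cornerFacet {m : ℕ} {i : Fin 3} {f : Option (StackQubit m)}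
    (h : ∀ j, j ≠ i → facetPlaq f j = none) : f = cornerFacet m i (facetHeight f) := by
  rcases f with _ | ⟨⟨t, q⟩ | u⟩
  · rfl
  · rw [facetHeight_inl, cornerFacet_succ]
    have : q = cornerQubit m i := eq_of_tri_eq_none
      (fun j hj => facetPlaq_inl_eq_none.1 (h j hj)) fun j hj => tri_cornerQubit hj
    rw [this]
  · exact (cornerFacet_top i).symm

theorem height_cases {m h : ℕ} (hh : h ≤ 2 * m + 1) :
    h = 0 ∨ h = 2 * m + 1 ∨ ∃ t : Fin (2 * m), h = t + 1 := by
  by_cases h0 : h = 0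
  · exact Or.inl h0
  · by_cases h1 : h = 2 * m + 1
    · exact Or.inr (Or.inl h1)
    · exact Or.inr (Or.inr ⟨⟨h - 1, by omega⟩, by simp only; omega⟩)

theorem facetHeight_cornerFacet {m : ℕ} (i : Fin 3) {h : ℕ} (hh : h ≤ 2 * m + 1) :
    facetHeight (cornerFacet m i h) = h := by
  obtain rfl | rfl | ⟨t, rfl⟩ := height_cases hh
  · rfl
  · rw [cornerFacet_top]; rfl
  · rw [cornerFacet_succ]; rfl

theorem facetPlaq_cornerFacet {m : ℕ} {i j : Fin 3} (hj : j ≠ i) (h : ℕ) :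
    facetPlaq (cornerFacet m i h) j = none := by
  rw [cornerFacet]
  split_ifs
  · rfl
  · rw [facetPlaq_inl_eq_none, tri_cornerQubit hj]
  · rfl

theorem facetPlaq_cornerFacet_pair {m : ℕ} (i j : Fin 3) {k : ℕ} (hk : k < m) :
    facetPlaq (cornerFacet m i (2 * k + 1)) j = facetPlaq (cornerFacet m i (2 * k + 2)) j := by
  have h1 := cornerFacet_succ i (lowerLayer ⟨k, hk⟩)
  have h2 := cornerFacet_succ i (upperLayer ⟨k, hk⟩)
  simp only [lowerLayer, upperLayer] at h1 h2
  rw [h1, h2, facetPlaq_inl_eq_inl_iff]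
  simp only
  omega

theorem exists_pair_layer {m : ℕ} (t : Fin (2 * m)) :
    ∃ s : Fin (2 * m), s ≠ t ∧ (s : ℕ) / 2 = (t : ℕ) / 2 := by
  refine ⟨⟨if (t : ℕ) % 2 = 0 then t + 1 else t - 1, ?_⟩, ?_, ?_⟩
  · split_ifs <;> omega
  · rw [ne_eq, Fin.ext_iff]
    simp only
    split_ifs <;> omega
  · simp only
    split_ifs <;> omega

/-- Every tetrahedron has exactly one neighbor opposite to each of its vertices. -/
theorem existsUnique_facetLabel {m : ℕ} (hm : 1 ≤ m) (f : Option (StackQubit m))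
    (i : Option (Fin 3)) :
    ∃! g, g ≠ f ∧ ∀ j, j ≠ i → facetLabel g j = facetLabel f j := by
  rcases i with _ | i
  -- Opposite to the cell: the same qubit on the other layer of the pair. The removed tetrahedron
  -- and the ancilla, sharing the three boundaries, are neighbors of each other.
  · suffices h : ∃ g, g ≠ f ∧ ∀ j, facetPlaq g j = facetPlaq f j by
      obtain ⟨g, hg, h⟩ := h
      refine ⟨g, ⟨hg, ?_⟩, ?_⟩
      · rintro (_ | j) hj
        · exact absurd rfl hj
        · exact facetLabel_some_eq_iff.2 (h j)
      · rintro g' ⟨hg', h'⟩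
        have h' : ∀ j, facetPlaq g' j = facetPlaq f j := fun j =>
          facetLabel_some_eq_iff.1 (h' (some j) (Option.some_ne_none j))
        have hne : ∀ g'', g'' ≠ f → (∀ j, facetPlaq g'' j = facetPlaq f j) →
            facetHeight g'' / 2 ≠ facetHeight f / 2 := fun g'' hg'' h'' hc =>
          hg'' (facet_ext hm h'' hc)
        have n1 := hne g hg h
        have n2 := hne g' hg' h'
        refine facet_ext hm (fun j => (h' j).trans (h j).symm) ?_
        by_cases hf : ∃ j, facetPlaq f j ≠ none
        · obtain ⟨j, hj⟩ := hf
          obtain ⟨⟨k, P⟩, hP⟩ := Option.ne_none_iff_exists'.1 hj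
          obtain ⟨t, q, rfl, ht, -⟩ := facetPlaq_eq_some hP
          obtain ⟨s, q, rfl, hs, -⟩ := facetPlaq_eq_some ((h j).trans hP)
          obtain ⟨s', q, rfl, hs', -⟩ := facetPlaq_eq_some ((h' j).trans hP)
          simp only [facetHeight_inl] at n1 n2 ⊢
          omega
        · have hf' : ∀ j, facetPlaq f j = none := by simpa using hf
          have key : ∀ f : Option (StackQubit m), (∀ j, facetPlaq f j = none) →
              facetHeight f = 0 ∨ facetHeight f = 2 * m + 1 := by
            rintro (_ | ⟨⟨t, q⟩ | u⟩) hf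
            · exact Or.inl rfl
            · obtain ⟨i, hi⟩ := exists_tri_ne_none hm q
              exact absurd (facetPlaq_inl_eq_none.1 (hf i)) hi
            · exact Or.inr rfl
          have := key f hf'
          have := key g fun j => (h j).trans (hf' j)
          have := key g' fun j => (h' j).trans (hf' j)
          omega
    rcases f with _ | ⟨⟨t, q⟩ | u⟩
    · exact ⟨some (Sum.inr ()), Option.some_ne_none _, fun _ => rfl⟩
    · obtain ⟨s, hs, hst⟩ := exists_pair_layer t
      refine ⟨some (Sum.inl (s, q)), fun h => hs ?_, fun j => (facetPlaq_inl_eq_inl_iff hst).2 rfl⟩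
      simpa using h
    · exact ⟨none, (Option.some_ne_none _).symm, fun _ => rfl⟩
  · have hiff : ∀ g, (∀ j, j ≠ some i → facetLabel g j = facetLabel f j) ↔
        (∀ j, j ≠ i → facetPlaq g j = facetPlaq f j) ∧ facetHeight g / 2 = facetHeight f / 2 := by
      intro g
      rw [Option.forall]
      simp only [ne_eq, reduceCtorEq, not_false_eq_true, forall_const, Option.some.injEq,
        facetLabel_some_eq_iff, facetLabel_none_eq_iff]
      exact and_comm
    simp only [hiff]
    -- The triangle has two boundaries and a cell: the tetrahedra around these boundaries have one
    -- representative per height, and a cell contains two heights.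
    by_cases hf : ∀ j, j ≠ i → facetPlaq f j = none
    · have hfh := facetHeight_le f
      obtain ⟨h', hh', hne, hdiv⟩ : ∃ h' ≤ 2 * m + 1, h' ≠ facetHeight f ∧
          h' / 2 = facetHeight f / 2 := by
        refine ⟨if facetHeight f % 2 = 0 then facetHeight f + 1 else facetHeight f - 1, ?_, ?_, ?_⟩
          <;> split_ifs <;> omega
      refine ⟨cornerFacet m i h', ⟨?_, ?_, ?_⟩, ?_⟩
      · intro h
        have := congrArg facetHeight h
        rw [facetHeight_cornerFacet i hh'] at this
        exact hne this
      · intro j hj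
        rw [facetPlaq_cornerFacet hj, hf j hj]
      · rw [facetHeight_cornerFacet i hh', hdiv]
      · rintro g ⟨hgf, hg, hc⟩
        have hg' := eq_cornerFacet fun j hj => (hg j hj).trans (hf j hj)
        have hne' : facetHeight g ≠ facetHeight f := by
          intro h
          rw [h, ← eq_cornerFacet hf] at hg'
          exact hgf hg'
        rw [hg', show facetHeight g = h' by omega]
    -- A plaquette and a cell fix the layer, so the neighbor is the adjacent qubit on this layer.
    · push Not at hf
      obtain ⟨j, hj, hfj⟩ := hf
      obtain ⟨⟨k, P⟩, hP⟩ := Option.ne_none_iff_exists'.1 hfj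
      obtain ⟨t, q, rfl, ht, hq⟩ := facetPlaq_eq_some hP
      obtain ⟨r, hr⟩ := exists_triAdj_of_ne_none hj (q := q) (by rw [hq]; exact Option.some_ne_none P)
      refine ⟨some (Sum.inl (t, r)), ⟨?_, ?_, rfl⟩, ?_⟩
      · intro h
        simp only [Option.some.injEq, Sum.inl.injEq, Prod.mk.injEq, true_and] at h
        exact hr.1 h.symm
      · exact fun l hl => (facetPlaq_inl_eq_inl_iff rfl).2 (hr.2 l hl).symm
      · rintro g ⟨hgf, hg, hc⟩
        obtain ⟨s, w, rfl, hs, -⟩ := facetPlaq_eq_some ((hg j hj).trans hP)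
        rw [facetHeight_inl, facetHeight_inl] at hc
        obtain rfl : s = t := Fin.ext (by omega)
        have hw : TriAdj i q w :=
          ⟨fun h => hgf (by rw [h]), fun l hl => ((facetPlaq_inl_eq_inl_iff rfl).1 (hg l hl)).symm⟩
        rw [hr.unique hw]

/-- Tetrahedra are joined by chains that keep all the common vertices. -/
theorem facetLabel_chain {m : ℕ} (hm : 1 ≤ m) (f g : Option (StackQubit m)) :
    Relation.ReflTransGen (fun a b =>
      (∀ j, facetLabel f j = facetLabel g j →
        facetLabel a j = facetLabel f j ∧ facetLabel b j = facetLabel f j) ∧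
      ∃ i, facetLabel f i ≠ facetLabel g i ∧
        ∀ j, j ≠ i → facetLabel a j = facetLabel b j) f g := by
  set R : Option (StackQubit m) → Option (StackQubit m) → Prop := fun a b =>
      (∀ j, facetLabel f j = facetLabel g j →
        facetLabel a j = facetLabel f j ∧ facetLabel b j = facetLabel f j) ∧
      ∃ i, facetLabel f i ≠ facetLabel g i ∧
        ∀ j, j ≠ i → facetLabel a j = facetLabel b j with hR
  have hsymm : ∀ {a b}, R a b → R b a := by
    rintro a b ⟨h1, i, hi, h2⟩
    exact ⟨fun j hj => (h1 j hj).symm, i, hi, fun j hj => (h2 j hj).symm⟩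
  have hplaq : ∀ {a b}, (∀ j, facetPlaq f j = facetPlaq g j →
      facetPlaq a j = facetPlaq f j ∧ facetPlaq b j = facetPlaq f j) →
      (facetHeight f / 2 = facetHeight g / 2 → facetHeight a / 2 = facetHeight f / 2) →
      facetHeight a / 2 = facetHeight b / 2 →
      (∃ i, facetPlaq f i ≠ facetPlaq g i ∧ ∀ j, j ≠ i → facetPlaq a j = facetPlaq b j) →
      R a b := by
    rintro a b h1 h2 h3 ⟨i, hi, h4⟩
    refine ⟨?_, some i, facetLabel_some_eq_iff.not.2 hi, ?_⟩
    · rintro (_ | j) hj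
      · have := h2 (facetLabel_none_eq_iff.1 hj)
        exact ⟨facetLabel_none_eq_iff.2 this, facetLabel_none_eq_iff.2 (h3.symm.trans this)⟩
      · have := h1 j (facetLabel_some_eq_iff.1 hj)
        exact ⟨facetLabel_some_eq_iff.2 this.1, facetLabel_some_eq_iff.2 this.2⟩
    · rintro (_ | j) hj
      · exact facetLabel_none_eq_iff.2 h3
      · exact facetLabel_some_eq_iff.2 (h4 j fun h => hj (congrArg some h))
  have hcell : ∀ {a b}, facetHeight f / 2 ≠ facetHeight g / 2 →
      (∀ j, facetPlaq a j = facetPlaq b j) →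
      (∀ j, facetPlaq f j = facetPlaq g j → facetPlaq a j = facetPlaq f j) → R a b := by
    rintro a b hne h1 h2
    refine ⟨?_, none, facetLabel_none_eq_iff.not.2 hne, ?_⟩
    · rintro (_ | j) hj
      · exact absurd (facetLabel_none_eq_iff.1 hj) hne
      · have := h2 j (facetLabel_some_eq_iff.1 hj)
        exact ⟨facetLabel_some_eq_iff.2 this, facetLabel_some_eq_iff.2 ((h1 j).symm.trans this)⟩
    · rintro (_ | j) hj
      · exact absurd rfl hj
      · exact facetLabel_some_eq_iff.2 (h1 j)
  -- A common plaquette confines both tetrahedra to one pair of layers: change the layer first if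
  -- needed, then walk inside the layer.
  by_cases hcommon : ∃ j, facetPlaq f j = facetPlaq g j ∧ facetPlaq f j ≠ none
  · obtain ⟨j, hj, hfj⟩ := hcommon
    obtain ⟨⟨k, P⟩, hP⟩ := Option.ne_none_iff_exists'.1 hfj
    obtain ⟨t, q, rfl, ht, -⟩ := facetPlaq_eq_some hP
    obtain ⟨s, r, rfl, hs, -⟩ := facetPlaq_eq_some (hj.symm.trans hP)
    have hts : (t : ℕ) / 2 = (s : ℕ) / 2 := by omega
    have h1 : Relation.ReflTransGen R (some (Sum.inl (t, q))) (some (Sum.inl (s, q))) := by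
      by_cases h : t = s
      · rw [h]
      · refine .single (hcell ?_ (fun j => (facetPlaq_inl_eq_inl_iff hts).2 rfl) fun j _ => rfl)
        rw [facetHeight_inl, facetHeight_inl]
        rw [Fin.ext_iff] at h
        omega
    refine h1.trans ((tri_chain q r).lift (fun a => some (Sum.inl (s, a))) ?_)
    rintro a b ⟨h2, i, hi, h3⟩
    refine hplaq ?_ (fun h => h.symm) rfl
      ⟨i, (facetPlaq_inl_eq_inl_iff hts).not.2 hi, fun l hl =>
        (facetPlaq_inl_eq_inl_iff rfl).2 (h3 l hl)⟩
    intro l hl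
    have := h2 l ((facetPlaq_inl_eq_inl_iff hts).1 hl)
    exact ⟨(facetPlaq_inl_eq_inl_iff hts.symm).2 this.1,
      (facetPlaq_inl_eq_inl_iff hts.symm).2 this.2⟩
  · push Not at hcommon
    by_cases hall : ∃ i, facetPlaq f i ≠ facetPlaq g i
    · obtain ⟨i, hi⟩ := hall
      -- The common vertices are now boundaries of colors other than `i`, and possibly a cell. Both
      -- tetrahedra are moved within their layers to the corner `i`, where all these boundaries are
      -- present, and are joined there along the vertical column.
      have hS : ∀ j, facetPlaq f j = facetPlaq g j → j ≠ i ∧ facetPlaq f j = none :=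
        fun j hj => ⟨fun h => hi (h ▸ hj), hcommon j hj⟩
      have toCorner : ∀ a : Option (StackQubit m),
          (∀ j, facetPlaq f j = facetPlaq g j → facetPlaq a j = none) →
          (facetHeight f / 2 = facetHeight g / 2 → facetHeight a / 2 = facetHeight f / 2) →
          Relation.ReflTransGen R a (cornerFacet m i (facetHeight a)) := by
        rintro (_ | ⟨⟨t, q⟩ | u⟩) ha hc
        · exact .refl
        · rw [facetHeight_inl, cornerFacet_succ]
          refine (tri_chain q (cornerQubit m i)).lift (fun a => some (Sum.inl (t, a))) ?_
          rintro a b ⟨h2, l, hl, h3⟩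
          have hagree : ∀ j, facetPlaq f j = facetPlaq g j →
              tri q j = none ∧ tri q j = tri (cornerQubit m i) j := fun j hj => by
            have := facetPlaq_inl_eq_none.1 (ha j hj)
            exact ⟨this, by rw [this, tri_cornerQubit (hS j hj).1]⟩
          refine hplaq (fun j hj => ?_) hc rfl
            ⟨l, fun h => hl (hagree l h).2, fun j hj => (facetPlaq_inl_eq_inl_iff rfl).2 (h3 j hj)⟩
          obtain ⟨e1, e2⟩ := hagree j hj
          rw [(hS j hj).2, facetPlaq_inl_eq_none, facetPlaq_inl_eq_none, (h2 j e2).1, (h2 j e2).2]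
          exact ⟨e1, e1⟩
        · rw [show facetHeight (some (Sum.inr u)) = 2 * m + 1 from rfl, cornerFacet_top]
      have hstep : ∀ c ≤ m, (facetHeight f / 2 = facetHeight g / 2 → c = facetHeight f / 2) →
          R (cornerFacet m i (2 * c)) (cornerFacet m i (2 * c + 1)) := by
        intro c hcm hc
        refine hplaq (fun j hj => ?_) (fun h => ?_) ?_ ⟨i, hi, fun j hj => ?_⟩
        · rw [facetPlaq_cornerFacet (hS j hj).1, facetPlaq_cornerFacet (hS j hj).1, (hS j hj).2]
          exact ⟨rfl, rfl⟩
        · rw [facetHeight_cornerFacet i (by omega), ← hc h]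
          omega
        · rw [facetHeight_cornerFacet i (by omega), facetHeight_cornerFacet i (by omega)]
          omega
        · rw [facetPlaq_cornerFacet hj, facetPlaq_cornerFacet hj]
      have hf1 := toCorner f (fun j hj => (hS j hj).2) fun _ => rfl
      have hg1 := toCorner g (fun j hj => hj.symm.trans (hS j hj).2) fun h => h.symm
      refine (hf1.trans ?_).trans (reflTransGen_symm hsymm hg1)
      have hf2 := facetHeight_le f
      have hg2 := facetHeight_le g
      by_cases hc : facetHeight f / 2 = facetHeight g / 2
      · have h := hstep (facetHeight f / 2) (by omega) fun _ => rfl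
        rcases lt_trichotomy (facetHeight f) (facetHeight g) with hlt | heq | hgt
        · rw [show 2 * (facetHeight f / 2) + 1 = facetHeight g by omega,
            show 2 * (facetHeight f / 2) = facetHeight f by omega] at h
          exact .single h
        · rw [heq]
        · rw [show 2 * (facetHeight f / 2) + 1 = facetHeight f by omega,
            show 2 * (facetHeight f / 2) = facetHeight g by omega] at h
          exact .single (hsymm h)
      -- Without a common cell the column may be climbed freely, alternately inside a cell and
      -- inside a pair of layers.
      · have hzero : ∀ h ≤ 2 * m + 1,
            Relation.ReflTransGen R (cornerFacet m i 0) (cornerFacet m i h) := by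
          intro h
          induction h with
          | zero => exact fun _ => .refl
          | succ h ih =>
            intro hh
            refine (ih (by omega)).tail ?_
            obtain ⟨c, rfl | rfl⟩ : ∃ c, h = 2 * c ∨ h = 2 * c + 1 := ⟨h / 2, by omega⟩
            · exact hstep c (by omega) fun h => absurd h hc
            · refine hcell hc (fun j => facetPlaq_cornerFacet_pair i j (by omega)) fun j hj => ?_
              rw [facetPlaq_cornerFacet (hS j hj).1, (hS j hj).2]
        exact (reflTransGen_symm hsymm (hzero _ hf2)).trans (hzero _ hg2)
    · push Not at hall
      by_cases hc : facetHeight f / 2 = facetHeight g / 2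
      · rw [facet_ext hm hall hc]
      · exact .single (hcell hc hall fun _ _ => rfl)

/-! ### The links of the vertices are spheres -/

theorem card_image_facetLabel_some {m : ℕ} {S : Finset (Option (StackQubit m))} {j : Fin 3}
    {K : Finset ℕ} {B : Finset (HexPlaquette m)} (hnone : ∃ f ∈ S, facetPlaq f j = none)
    (hsome : ∀ k P, (∃ f ∈ S, facetPlaq f j = some (k, P)) ↔ k ∈ K ∧ P ∈ B) :
    (S.image fun f => facetLabel f (some j)).card = K.card * B.card + 1 := by
  have : (S.image fun f => facetLabel f (some j))
      = (Finset.insertNone (K ×ˢ B)).image (Sum.inl : _ → Option (ℕ × HexPlaquette m) ⊕ ℕ) := by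
    ext (o | c)
    · simp only [Finset.mem_image, facetLabel, Sum.inl.injEq, exists_eq_right]
      rcases o with _ | ⟨k, P⟩
      · simpa using hnone
      · rw [hsome, Finset.some_mem_insertNone, Finset.mem_product]
    · simp [facetLabel]
  rw [this, Finset.card_image_of_injective _ Sum.inl_injective, Finset.card_insertNone,
    Finset.card_product]

theorem facetPlaq_none {m : ℕ} (i : Fin 3) : facetPlaq (m := m) none i = none := rfl

theorem facetPlaq_ancilla {m : ℕ} (i : Fin 3) :
    facetPlaq (m := m) (some (Sum.inr ())) i = none := rfl

theorem card_filter_facet {m : ℕ} (p : Option (StackQubit m) → Prop) [DecidablePred p] :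
    (Finset.univ.filter p).card = (if p none then 1 else 0) +
      (∑ t : Fin (2 * m), (Finset.univ.filter fun q => p (some (Sum.inl (t, q)))).card) +
      (if p (some (Sum.inr ())) then 1 else 0) := by
  simp only [Finset.card_filter]
  rw [Fintype.sum_option, Fintype.sum_sum_type, Fintype.sum_prod_type, ← add_assoc]
  exact congrArg _ (Fintype.sum_unique _)

theorem sum_erase_some {i j k : Fin 3} (hjk : j ≠ k) (hj : j ≠ i) (hk : k ≠ i)
    (h : ∀ l, l ≠ i → l = j ∨ l = k) (F : Option (Fin 3) → ℕ) :
    ∑ l ∈ Finset.univ.erase (some i), F l = F none + (F (some j) + F (some k)) := by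
  have : (Finset.univ : Finset (Option (Fin 3))).erase (some i) = {none, some j, some k} := by
    ext (_ | l)
    · simp
    · simp only [Finset.mem_erase, ne_eq, Option.some.injEq, Finset.mem_univ, and_true,
        Finset.mem_insert, reduceCtorEq, Finset.mem_singleton, false_or]
      exact ⟨h l, fun h' => by rcases h' with rfl | rfl <;> assumption⟩
  rw [this, Finset.sum_insert (by simp), Finset.sum_pair (by simpa using hjk)]

theorem sum_erase_none (F : Option (Fin 3) → ℕ) :
    ∑ l ∈ Finset.univ.erase none, F l = ∑ i, F (some i) := by
  have := Finset.add_sum_erase Finset.univ F (Finset.mem_univ none)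
  rw [Fintype.sum_option] at this
  omega

theorem card_layers_of_pair {m k : ℕ} (hk : k < m) :
    (Finset.univ.filter fun t : Fin (2 * m) => (t : ℕ) / 2 = k).card = 2 := by
  rw [Finset.card_eq_two]
  refine ⟨lowerLayer ⟨k, hk⟩, upperLayer ⟨k, hk⟩, lowerLayer_ne_upperLayer _ _, ?_⟩
  ext t
  simp only [Finset.mem_filter, Finset.mem_univ, true_and, Finset.mem_insert,
    Finset.mem_singleton, lowerLayer, upperLayer, Fin.ext_iff]
  omega

/-- Every cell has two levels; in the first cell one of them is the removed tetrahedron, in the last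
one the ancilla. -/
theorem card_layers_of_cell {m c : ℕ} (hm : 1 ≤ m) (hc : c ≤ m) :
    (Finset.univ.filter fun t : Fin (2 * m) => ((t : ℕ) + 1) / 2 = c).card +
      (if c = 0 then 1 else 0) + (if c = m then 1 else 0) = 2 := by
  by_cases h0 : c = 0
  · rw [if_pos h0, if_neg (by omega), Finset.card_eq_one.2 ⟨⟨0, by omega⟩, ?_⟩]
    ext t
    simp only [Finset.mem_filter, Finset.mem_univ, true_and, Finset.mem_singleton, Fin.ext_iff]
    omega
  · by_cases h1 : c = m
    · rw [if_neg h0, if_pos h1, Finset.card_eq_one.2 ⟨⟨2 * m - 1, by omega⟩, ?_⟩]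
      ext t
      simp only [Finset.mem_filter, Finset.mem_univ, true_and, Finset.mem_singleton, Fin.ext_iff]
      omega
    · rw [if_neg h0, if_neg h1, Finset.card_eq_two.2
        ⟨⟨2 * c - 1, by omega⟩, ⟨2 * c, by omega⟩, ?_, ?_⟩]
      · simp only [ne_eq, Fin.mk.injEq]
        omega
      · ext t
        simp only [Finset.mem_filter, Finset.mem_univ, true_and, Finset.mem_insert,
          Finset.mem_singleton, Fin.ext_iff]
        omega

theorem exists_facet_of_cell {m c : ℕ} (hc : c ≤ m) (i : Fin 3) :
    ∃ f : Option (StackQubit m), facetHeight f / 2 = c ∧ facetPlaq f i = none := by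
  obtain ⟨j, -, -, hj, -⟩ := exists_other_colors i
  refine ⟨cornerFacet m j (2 * c), ?_, facetPlaq_cornerFacet hj.symm _⟩
  rw [facetHeight_cornerFacet j (by omega)]
  omega

/-- The link is a bipyramid. For a plaquette of `a` qubits it has two apexes, the cells below and
above, and `a / 2` vertices of each of the other two colors, with `2a` triangles. -/
theorem euler_plaquette {m k : ℕ} (hk : k < m) {i : Fin 3} {P : HexPlaquette m}
    (hP : plaqColor P = i) :
    2 * ∑ j ∈ Finset.univ.erase (some i), ((Finset.univ.filter fun f : Option (StackQubit m) =>
      facetPlaq f i = some (k, P)).image fun f => facetLabel f j).card =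
    (Finset.univ.filter fun f : Option (StackQubit m) => facetPlaq f i = some (k, P)).card + 4 := by
  obtain ⟨j, l, hjl, hj, hl, hother⟩ := exists_other_colors i
  rw [sum_erase_some hjl hj hl hother]
  set A := Finset.univ.filter fun q : HexQubit m => tri q i = some P with hA
  have hcard : (Finset.univ.filter fun f : Option (StackQubit m) =>
      facetPlaq f i = some (k, P)).card = 2 * A.card := by
    rw [card_filter_facet, if_neg (by simp [facetPlaq_none]), if_neg (by simp [facetPlaq_ancilla]), zero_add,
      add_zero]
    simp only [facetPlaq_inl_eq_some]
    have h : ∀ t : Fin (2 * m), (Finset.univ.filter fun q : HexQubit m =>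
        (t : ℕ) / 2 = k ∧ tri q i = some P).card = (if (t : ℕ) / 2 = k then 1 else 0) * A.card := by
      intro t
      by_cases ht : (t : ℕ) / 2 = k
      · simp only [ht, true_and, if_true, one_mul, hA]
      · simp [ht]
    simp only [h]
    rw [← Finset.sum_mul, ← Finset.card_filter, card_layers_of_pair hk]
  have himage : ∀ j, ((Finset.univ.filter fun f : Option (StackQubit m) =>
      facetPlaq f i = some (k, P)).image fun f => facetLabel f (some j)).card
      = (A.image fun q => tri q j).card := by
    intro j
    have hinj : Function.Injective fun o : Option (HexPlaquette m) =>
        (Sum.inl (o.map (Prod.mk k)) : Option (ℕ × HexPlaquette m) ⊕ ℕ) := fun _ _ h =>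
      Option.map_injective (Prod.mk_right_injective _) (Sum.inl_injective h)
    rw [← Finset.card_image_of_injective _ hinj, Finset.image_image]
    congr 1
    ext x
    simp only [Finset.mem_image, Finset.mem_filter, Finset.mem_univ, true_and, hA,
      Function.comp_apply]
    constructor
    · rintro ⟨f, hf, rfl⟩
      obtain ⟨t, q, rfl, ht, hq⟩ := facetPlaq_eq_some hf
      exact ⟨q, hq, by rw [facetLabel, facetPlaq_inl, ht]⟩
    · rintro ⟨q, hq, rfl⟩
      have ht : ((lowerLayer ⟨k, hk⟩ : Fin (2 * m)) : ℕ) / 2 = k := by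
        simp only [lowerLayer]; omega
      exact ⟨some (Sum.inl (lowerLayer ⟨k, hk⟩, q)), facetPlaq_inl_eq_some.2 ⟨ht, hq⟩,
        by rw [facetLabel, facetPlaq_inl, ht]⟩
  have hcells : ((Finset.univ.filter fun f : Option (StackQubit m) =>
      facetPlaq f i = some (k, P)).image fun f => facetLabel f none).card = 2 := by
    rw [Finset.card_eq_two]
    refine ⟨Sum.inr k, Sum.inr (k + 1), by simp, ?_⟩
    ext x
    simp only [Finset.mem_image, Finset.mem_filter, Finset.mem_univ, true_and,
      Finset.mem_insert, Finset.mem_singleton]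
    constructor
    · rintro ⟨f, hf, rfl⟩
      obtain ⟨t, q, rfl, ht, hq⟩ := facetPlaq_eq_some hf
      simp only [facetLabel, facetHeight_inl, Sum.inr.injEq]
      omega
    · obtain ⟨q, hq⟩ := exists_qubit_of_plaquette P
      rw [hP] at hq
      rintro (rfl | rfl)
      · refine ⟨some (Sum.inl (lowerLayer ⟨k, hk⟩, q)), facetPlaq_inl_eq_some.2 ⟨?_, hq⟩, ?_⟩
        · simp only [lowerLayer]; omega
        · simp only [facetLabel, facetHeight_inl, Sum.inr.injEq, lowerLayer]; omega
      · refine ⟨some (Sum.inl (upperLayer ⟨k, hk⟩, q)), facetPlaq_inl_eq_some.2 ⟨?_, hq⟩, ?_⟩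
        · simp only [upperLayer]; omega
        · simp only [facetLabel, facetHeight_inl, Sum.inr.injEq, upperLayer]; omega
  rw [hcells, himage, himage, hcard]
  have h1 := card_image_tri_plaquette hj.symm P
  have h2 := card_image_tri_plaquette hl.symm P
  rw [← hA] at h1 h2
  omega

/-- The side contributes `2 * m + 1` tetrahedra on each of `2 * m` layers, and two more come from
the ancilla and the removed tetrahedron. The neighbors are `m + 1` cells and, for each other color,
`m` plaquettes in each of `m` pairs and a boundary. -/
theorem euler_boundary {m : ℕ} (i : Fin 3) :
    2 * ∑ j ∈ Finset.univ.erase (some i), ((Finset.univ.filter fun f : Option (StackQubit m) =>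
      facetPlaq f i = none).image fun f => facetLabel f j).card =
    (Finset.univ.filter fun f : Option (StackQubit m) => facetPlaq f i = none).card + 4 := by
  obtain ⟨j, l, hjl, hj, hl, hother⟩ := exists_other_colors i
  rw [sum_erase_some hjl hj hl hother]
  have hcard : (Finset.univ.filter fun f : Option (StackQubit m) =>
      facetPlaq f i = none).card = 2 * m * (2 * m + 1) + 2 := by
    rw [card_filter_facet, if_pos (facetPlaq_none i), if_pos (facetPlaq_ancilla i)]
    simp only [facetPlaq_inl_eq_none, card_side, Finset.sum_const, Finset.card_univ,
      Fintype.card_fin, smul_eq_mul]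
    ring
  have himage : ∀ j l, j ≠ i → l ≠ i → j ≠ l →
      ((Finset.univ.filter fun f : Option (StackQubit m) =>
      facetPlaq f i = none).image fun f => facetLabel f (some j)).card = m * m + 1 := by
    intro j l hj hl hjl
    set B := (Finset.univ.filter fun q : HexQubit m => tri q i = none).image fun q => tri q j
      with hB
    have hnone : none ∈ B := by
      rw [hB, Finset.mem_image]
      exact ⟨cornerQubit m l, by simpa using tri_cornerQubit hl.symm, tri_cornerQubit hjl⟩
    have hBcard : (Finset.eraseNone B).card = m := by
      have h1 := card_image_tri_side (m := m) hj.symm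
      rw [← hB, ← Finset.insert_eq_of_mem hnone, ← Finset.insertNone_eraseNone,
        Finset.card_insertNone] at h1
      omega
    rw [card_image_facetLabel_some (K := Finset.range m) (B := Finset.eraseNone B),
      Finset.card_range, hBcard]
    · exact ⟨none, by simp [facetPlaq_none], rfl⟩
    · intro k P
      simp only [Finset.mem_filter, Finset.mem_univ, true_and, Finset.mem_range,
        Finset.mem_eraseNone, hB, Finset.mem_image]
      constructor
      · rintro ⟨f, hf1, hf2⟩
        obtain ⟨t, q, rfl, ht, hq⟩ := facetPlaq_eq_some hf2
        exact ⟨by omega, q, facetPlaq_inl_eq_none.1 hf1, hq⟩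
      · rintro ⟨hk, q, hq1, hq2⟩
        refine ⟨some (Sum.inl (lowerLayer ⟨k, hk⟩, q)), facetPlaq_inl_eq_none.2 hq1,
          facetPlaq_inl_eq_some.2 ⟨?_, hq2⟩⟩
        simp only [lowerLayer]
        omega
  have hcells : ((Finset.univ.filter fun f : Option (StackQubit m) =>
      facetPlaq f i = none).image fun f => facetLabel f none).card = m + 1 := by
    have : ((Finset.univ.filter fun f : Option (StackQubit m) =>
        facetPlaq f i = none).image fun f => facetLabel f none)
        = (Finset.range (m + 1)).image Sum.inr := by
      ext x
      simp only [Finset.mem_image, Finset.mem_filter, Finset.mem_univ, true_and,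
        Finset.mem_range, facetLabel]
      constructor
      · rintro ⟨f, -, rfl⟩
        have := facetHeight_le f
        exact ⟨_, by omega, rfl⟩
      · rintro ⟨c, hc, rfl⟩
        obtain ⟨f, hf1, hf2⟩ := exists_facet_of_cell (m := m) (c := c) (by omega) i
        exact ⟨f, hf2, by rw [hf1]⟩
    rw [this, Finset.card_image_of_injective _ Sum.inr_injective, Finset.card_range]
  rw [hcells, himage j l hj hl hjl, himage l j hl hj hjl.symm, hcard]
  ring

/-- Let `p` be the number of plaquettes. A full layer contributes `2p + 1` tetrahedra and `p`
vertices, the removed tetrahedron or the ancilla one tetrahedron and no vertex of its own. The three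
boundaries are common to both levels. -/
theorem euler_cell {m c : ℕ} (hm : 1 ≤ m) (hc : c ≤ m) :
    2 * ∑ j ∈ Finset.univ.erase none, ((Finset.univ.filter fun f : Option (StackQubit m) =>
      facetHeight f / 2 = c).image fun f => facetLabel f j).card =
    (Finset.univ.filter fun f : Option (StackQubit m) => facetHeight f / 2 = c).card + 4 := by
  set T := Finset.univ.filter fun t : Fin (2 * m) => ((t : ℕ) + 1) / 2 = c with hT
  have hTcard := card_layers_of_cell hm hc
  rw [← hT] at hTcard
  have hcard : (Finset.univ.filter fun f : Option (StackQubit m) =>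
      facetHeight f / 2 = c).card = T.card * (2 * Fintype.card (HexPlaquette m) + 1) +
        (2 - T.card) := by
    rw [card_filter_facet]
    have : (∑ t : Fin (2 * m), (Finset.univ.filter fun q : HexQubit m =>
        facetHeight (some (Sum.inl (t, q))) / 2 = c).card) = T.card * (2 * Fintype.card (HexPlaquette m) + 1) := by
      rw [← card_hexQubit, hT, Finset.card_filter, Finset.sum_mul]
      refine Finset.sum_congr rfl fun t _ => ?_
      by_cases ht : ((t : ℕ) + 1) / 2 = c
      · simp [facetHeight_inl, ht]
      · simp [facetHeight_inl, ht]
    rw [this]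
    have e1 : facetHeight (m := m) none / 2 = c ↔ c = 0 := by
      rw [show facetHeight (m := m) none = 0 from rfl]; omega
    have e2 : facetHeight (m := m) (some (Sum.inr ())) / 2 = c ↔ c = m := by
      rw [show facetHeight (m := m) (some (Sum.inr ())) = 2 * m + 1 from rfl]; omega
    simp only [e1, e2]
    omega
  have himage : ∀ j, ((Finset.univ.filter fun f : Option (StackQubit m) =>
      facetHeight f / 2 = c).image fun f => facetLabel f (some j)).card =
      T.card * (Finset.univ.filter fun P : HexPlaquette m => plaqColor P = j).card + 1 := by
    intro j
    rw [card_image_facetLabel_some (K := T.image fun t : Fin (2 * m) => (t : ℕ) / 2)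
      (B := Finset.univ.filter fun P : HexPlaquette m => plaqColor P = j),
      Finset.card_image_of_injOn]
    · intro s hs t ht h
      simp only [hT, Finset.coe_filter, Finset.mem_univ, true_and, Set.mem_ofPred_eq] at hs ht h
      exact Fin.ext (by omega)
    · obtain ⟨f, hf1, hf2⟩ := exists_facet_of_cell hc j
      exact ⟨f, by simpa using hf1, hf2⟩
    · intro k P
      simp only [Finset.mem_filter, Finset.mem_univ, true_and, Finset.mem_image, hT]
      constructor
      · rintro ⟨f, hf1, hf2⟩
        obtain ⟨t, q, rfl, ht, hq⟩ := facetPlaq_eq_some hf2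
        exact ⟨⟨t, hf1, ht⟩, (tri_eq_some_iff.1 hq).1⟩
      · rintro ⟨⟨t, ht1, ht2⟩, hP⟩
        obtain ⟨q, hq⟩ := exists_qubit_of_plaquette P
        rw [hP] at hq
        exact ⟨some (Sum.inl (t, q)), ht1, facetPlaq_inl_eq_some.2 ⟨ht2, hq⟩⟩
  have hsum : ∑ j, (Finset.univ.filter fun P : HexPlaquette m => plaqColor P = j).card
      = Fintype.card (HexPlaquette m) := by
    rw [← Finset.card_univ]
    exact (Finset.card_eq_sum_card_fiberwise fun _ _ => Finset.mem_univ _).symm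
  rw [sum_erase_none, hcard]
  simp only [himage]
  rw [Finset.sum_add_distrib, ← Finset.mul_sum, hsum]
  simp only [Finset.sum_const, Finset.card_univ, Fintype.card_fin, smul_eq_mul, mul_one]
  have : T.card * (2 * Fintype.card (HexPlaquette m) + 1)
      = 2 * (T.card * Fintype.card (HexPlaquette m)) + T.card := by ring
  omega

theorem euler_facetLabel {m : ℕ} (hm : 1 ≤ m) (i : Option (Fin 3))
    (x : Option (ℕ × HexPlaquette m) ⊕ ℕ) (hx : ∃ f : Option (StackQubit m), facetLabel f i = x) :
    2 * ∑ j ∈ Finset.univ.erase i, ((Finset.univ.filter fun f : Option (StackQubit m) =>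
      facetLabel f i = x).image fun f => facetLabel f j).card =
    (Finset.univ.filter fun f : Option (StackQubit m) => facetLabel f i = x).card + 4 := by
  obtain ⟨f, rfl⟩ := hx
  rcases i with _ | i
  · simp only [facetLabel_none_eq_iff]
    exact euler_cell hm (by have := facetHeight_le f; omega)
  · simp only [facetLabel_some_eq_iff]
    cases h : facetPlaq f i with
    | none => exact euler_boundary i
    | some p =>
      obtain ⟨k, P⟩ := p
      obtain ⟨t, q, rfl, ht, hq⟩ := facetPlaq_eq_some h
      exact euler_plaquette (by omega) (tri_eq_some_iff.1 hq).1

theorem isFourColorableManifold_stack {m : ℕ} (hm : 1 ≤ m) :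
    IsFourColorableManifold (labelComplex (facetLabel (m := m))) :=
  isFourColorableManifold_labelComplex facetLabel (by simp) (facetLabel_injective hm)
    (existsUnique_facetLabel hm) (facetLabel_chain hm) (euler_facetLabel hm)

/-! ### Generators of the stack as cells and faces of the triangulation -/

theorem layerOf_eq_facetHeight {m : ℕ} (q : StackQubit m) : layerOf q = facetHeight (some q) := by
  rcases q with ⟨t, q⟩ | u <;> rfl

theorem indicator_setOf {Q : Type} (p : Q → Prop) [DecidablePred p] (q : Q) :
    {q | p q}.indicator (1 : Q → ZMod 2) q = if p q then 1 else 0 := by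
  classical
  rw [Set.indicator_apply]
  exact if_congr Iff.rfl rfl rfl

theorem wholeVec_apply {m l : ℕ} (q : StackQubit m) :
    wholeVec m l q = if facetHeight (some q) = l then 1 else 0 := by
  rw [wholeVec, wholeLayer, indicator_setOf]
  simp only [layerOf_eq_facetHeight]

/-- The `X` and `Z` Bell operators of layer `2 * k + 2` and the layer above it act on a cell. -/
theorem indicator_cell {m : ℕ} (k : Fin m) :
    {q : StackQubit m | facetHeight (some q) / 2 = k + 1}.indicator (1 : StackQubit m → ZMod 2)
      = liftLayer (upperLayer k) 1 + wholeVec m (2 * k + 3) := by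
  classical
  funext q
  rw [liftLayer_upper_one, indicator_setOf, Pi.add_apply, wholeVec_apply, wholeVec_apply]
  by_cases h : facetHeight (some q) / 2 = k + 1
  · rw [if_pos h]
    by_cases h2 : facetHeight (some q) = 2 * k + 2
    · rw [if_pos h2, if_neg (by omega), add_zero]
    · rw [if_neg h2, if_pos (by omega), zero_add]
  · rw [if_neg h, if_neg (by omega), if_neg (by omega), add_zero]

theorem indicator_plaquette {m k : ℕ} (hk : k < m) {i : Fin 3} {P : HexPlaquette m}
    (hP : plaqColor P = i) :
    {q : StackQubit m | facetPlaq (some q) i = some (k, P)}.indicator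
      (1 : StackQubit m → ZMod 2) = doubleLayer ⟨k, hk⟩ (plaqMatrix m P) := by
  classical
  funext q
  rw [doubleLayer_apply, indicator_setOf, Pi.add_apply]
  rcases q with ⟨t, q⟩ | u
  · rw [liftLayer_inl, liftLayer_inl, plaqMatrix_apply, hP]
    simp only [facetPlaq_inl_eq_some, lowerLayer, upperLayer, Fin.ext_iff]
    by_cases h : tri q i = some P
    · simp only [h, and_true, if_true]
      split_ifs <;> first | omega | simp
    · simp [h]
  · rw [if_neg (by rw [facetPlaq_ancilla]; exact (Option.some_ne_none _).symm), liftLayer_inr,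
      liftLayer_inr, add_zero]

/-- A cell and a plaquette on it have a single layer in common, which isolates the plaquettes of
individual layers among the Z operators. -/
theorem indicator_cell_plaquette {m : ℕ} (t : Fin (2 * m)) {i : Fin 3} {P : HexPlaquette m}
    (hP : plaqColor P = i) :
    {q : StackQubit m | facetHeight (some q) / 2 = ((t : ℕ) + 1) / 2 ∧
      facetPlaq (some q) i = some ((t : ℕ) / 2, P)}.indicator
      (1 : StackQubit m → ZMod 2) = liftLayer t (plaqMatrix m P) := by
  classical
  funext q
  rw [indicator_setOf]
  rcases q with ⟨s, q⟩ | u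
  · rw [liftLayer_inl, plaqMatrix_apply, hP, ← ite_and]
    refine if_congr ?_ rfl rfl
    rw [facetPlaq_inl_eq_some, facetHeight_inl, Fin.ext_iff, ← and_assoc]
    refine and_congr ?_ Iff.rfl
    omega
  · rw [if_neg, liftLayer_inr]
    rw [facetPlaq_ancilla]
    exact fun h => Option.some_ne_none _ h.2.symm

/-- The face consists of a side on each layer of the cell, and of the ancilla in the last cell.
Replacing sides by whole layers costs `1 + sideVec m i`, a sum of plaquettes. -/
theorem indicator_cell_boundary {m : ℕ} (k : Fin m) (i : Fin 3) :
    {q : StackQubit m | facetHeight (some q) / 2 = k + 1 ∧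
      facetPlaq (some q) i = none}.indicator (1 : StackQubit m → ZMod 2)
      = liftLayer (upperLayer k) 1 + wholeVec m (2 * k + 3) +
        ∑ t ∈ Finset.univ.filter fun t : Fin (2 * m) => ((t : ℕ) + 1) / 2 = k + 1,
          liftLayer t (1 + sideVec m i) := by
  classical
  funext q
  rw [← indicator_cell, indicator_setOf, Pi.add_apply, indicator_setOf, Finset.sum_apply]
  rcases q with ⟨t, q⟩ | u
  · simp only [liftLayer_inl, facetHeight_inl, facetPlaq_inl_eq_none, Finset.sum_ite_eq,
      Finset.mem_filter, Finset.mem_univ, true_and, Pi.add_apply, Pi.one_apply, sideVec]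
    by_cases h : ((t : ℕ) + 1) / 2 = k + 1
    · by_cases h' : tri q i = none
      · simp only [h, h', and_self, if_true]
        decide
      · simp only [h, h', and_false, if_true, if_false]
        decide
    · simp only [h, false_and, if_false, add_zero]
  · simp only [liftLayer_inr, Finset.sum_const_zero, add_zero]
    refine if_congr ?_ rfl rfl
    exact and_iff_left (facetPlaq_ancilla i)

theorem edgeVec_mk_apply {m : ℕ} (u v q : HexQubit m) :
    edgeVec s(u, v) q = if q = u ∨ q = v then 1 else 0 := by
  classical
  rw [edgeVec, Set.indicator_apply]
  simp [edgeQubits]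

theorem indicator_edge {m : ℕ} (k : Fin m) {l i j : Fin 3} (hl : ∀ c, c ≠ l → c = i ∨ c = j)
    (hil : i ≠ l) (hjl : j ≠ l) {u v : HexQubit m} (h : TriAdj l u v) :
    {q : StackQubit m | facetPlaq (some q) i = facetPlaq (some (Sum.inl (lowerLayer k, u))) i ∧
      facetPlaq (some q) j = facetPlaq (some (Sum.inl (lowerLayer k, u))) j}.indicator
      (1 : StackQubit m → ZMod 2) = doubleLayer k (edgeVec s(u, v)) := by
  classical
  -- An edge with a partner has a plaquette among its two labels, and this label restricts the face
  -- to the pair `k`.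
  obtain ⟨c, hc, hcu⟩ : ∃ c, (c = i ∨ c = j) ∧ tri u c ≠ none := by
    by_contra! hcon
    exact not_triAdj_of_corner (fun c hc => hcon c (hl c hc)) h
  obtain ⟨P, hP⟩ := Option.ne_none_iff_exists'.1 hcu
  have hk : ((lowerLayer k : Fin (2 * m)) : ℕ) / 2 = k := by
    simp only [lowerLayer]; omega
  have hcP : facetPlaq (some (Sum.inl (lowerLayer k, u))) c = some ((k : ℕ), P) :=
    facetPlaq_inl_eq_some.2 ⟨hk, hP⟩
  have hlevel : ∀ q : StackQubit m,
      (facetPlaq (some q) i = facetPlaq (some (Sum.inl (lowerLayer k, u))) i ∧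
      facetPlaq (some q) j = facetPlaq (some (Sum.inl (lowerLayer k, u))) j) →
      ∃ t r, q = Sum.inl (t, r) ∧ (t : ℕ) / 2 = k := by
    intro q hq
    have : facetPlaq (some q) c = some ((k : ℕ), P) := by
      rw [← hcP]
      rcases hc with rfl | rfl
      · exact hq.1
      · exact hq.2
    obtain ⟨t, r, hq, ht, -⟩ := facetPlaq_eq_some this
    exact ⟨t, r, Option.some.inj hq, ht⟩
  funext q
  rw [doubleLayer_apply, indicator_setOf, Pi.add_apply]
  rcases q with ⟨t, q⟩ | u'
  · rw [liftLayer_inl, liftLayer_inl, edgeVec_mk_apply]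
    have hmem := edge_eq_pair hl hil hjl h q
    by_cases ht : (t : ℕ) / 2 = k
    · have hiff : ∀ c, facetPlaq (some (Sum.inl (t, q))) c =
          facetPlaq (some (Sum.inl (lowerLayer k, u))) c ↔ tri q c = tri u c := fun c =>
        facetPlaq_inl_eq_inl_iff (ht.trans hk.symm)
      simp only [hiff, hmem]
      by_cases hlow : t = lowerLayer k
      · rw [if_pos hlow, if_neg (c := t = upperLayer k)
          (by rw [hlow]; exact lowerLayer_ne_upperLayer k k), add_zero]
      · have : t = upperLayer k := by
          simp only [lowerLayer, upperLayer, Fin.ext_iff] at hlow ⊢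
          omega
        rw [if_neg hlow, if_pos this, zero_add]
    · rw [if_neg, if_neg, if_neg, add_zero]
      · rintro rfl
        simp only [upperLayer] at ht
        omega
      · rintro rfl
        exact ht hk
      · intro hq
        obtain ⟨s, r, hs, hsk⟩ := hlevel _ hq
        simp only [Sum.inl.injEq, Prod.mk.injEq] at hs
        exact ht (hs.1 ▸ hsk)
  · rw [liftLayer_inr, liftLayer_inr, if_neg, add_zero]
    intro hq
    obtain ⟨s, r, hs, -⟩ := hlevel _ hq
    simp at hs

/-- The supports of the `X` generators of the 3D color code. -/
def cellSets (m : ℕ) : Set (Set (StackQubit m)) :=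
  {s | ∃ i x, (∃ f : Option (StackQubit m), facetLabel f i = x) ∧ facetLabel (m := m) none i ≠ x ∧
    s = {q | facetLabel (some q) i = x}}

/-- The supports of the `Z` generators of the 3D color code. -/
def faceSets (m : ℕ) : Set (Set (StackQubit m)) :=
  {s | ∃ i j x y, i ≠ j ∧ (∃ f : Option (StackQubit m), facetLabel f i = x ∧ facetLabel f j = y) ∧
    ¬ (facetLabel (m := m) none i = x ∧ facetLabel (m := m) none j = y) ∧
    s = {q | facetLabel (some q) i = x ∧ facetLabel (some q) j = y}}

theorem span_cellSets (m : ℕ) :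
    Submodule.span (ZMod 2) ((fun s : Set (StackQubit m) =>
      s.indicator (1 : StackQubit m → ZMod 2)) '' cellSets m)
      = Submodule.span (ZMod 2) (stackXGens m) := by
  apply le_antisymm <;> rw [Submodule.span_le]
  · rintro _ ⟨_, ⟨i, _, ⟨f, rfl⟩, hne, rfl⟩, rfl⟩
    dsimp only
    rcases i with _ | i
    · rw [ne_eq, facetLabel_none_eq_iff, show facetHeight (m := m) none = 0 from rfl] at hne
      simp only [facetLabel_none_eq_iff]
      obtain ⟨k, hk⟩ : ∃ k : Fin m, facetHeight f / 2 = k + 1 := by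
        have := facetHeight_le f
        exact ⟨⟨facetHeight f / 2 - 1, by omega⟩, by simp only; omega⟩
      rw [hk, indicator_cell]
      exact Submodule.subset_span ⟨k, Or.inr rfl⟩
    · rw [ne_eq, facetLabel_some_eq_iff, facetPlaq_none] at hne
      simp only [facetLabel_some_eq_iff]
      obtain ⟨⟨k, P⟩, hP⟩ := Option.ne_none_iff_exists'.1 (Ne.symm hne)
      obtain ⟨t, q, rfl, ht, hq⟩ := facetPlaq_eq_some hP
      rw [hP, indicator_plaquette (by omega) (tri_eq_some_iff.1 hq).1]
      exact Submodule.subset_span ⟨_, Or.inl ⟨P, rfl⟩⟩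
  · rintro _ ⟨k, ⟨P, rfl⟩ | rfl⟩ <;> apply Submodule.subset_span
    · obtain ⟨q, hq⟩ := exists_qubit_of_plaquette P
      have hf : facetPlaq (some (Sum.inl (lowerLayer k, q))) (plaqColor P) = some ((k : ℕ), P) :=
        facetPlaq_inl_eq_some.2 ⟨by simp only [lowerLayer]; omega, hq⟩
      refine ⟨_, ⟨some (plaqColor P), _, ⟨some (Sum.inl (lowerLayer k, q)), rfl⟩, ?_, rfl⟩, ?_⟩
      · rw [ne_eq, facetLabel_some_eq_iff, facetPlaq_none, hf]
        exact (Option.some_ne_none _).symm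
      · simp only [facetLabel_some_eq_iff, hf]
        exact indicator_plaquette k.2 rfl
    · obtain ⟨f, hf, -⟩ := exists_facet_of_cell (m := m) (c := k + 1) k.2 0
      refine ⟨_, ⟨none, _, ⟨f, rfl⟩, ?_, rfl⟩, ?_⟩
      · rw [ne_eq, facetLabel_none_eq_iff, hf, show facetHeight (m := m) none = 0 from rfl]
        omega
      · simp only [facetLabel_none_eq_iff, hf]
        exact indicator_cell k

theorem indicator_cell_face_mem {m : ℕ} {f : Option (StackQubit m)} {i : Fin 3}
    (hne : ¬ (facetHeight f / 2 = 0 ∧ facetPlaq f i = none)) :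
    {q : StackQubit m | facetHeight (some q) / 2 = facetHeight f / 2 ∧
      facetPlaq (some q) i = facetPlaq f i}.indicator (1 : StackQubit m → ZMod 2) ∈
      Submodule.span (ZMod 2) (stackZGens m) := by
  cases h : facetPlaq f i with
  | none =>
    obtain ⟨k, hk⟩ : ∃ k : Fin m, facetHeight f / 2 = k + 1 := by
      have := facetHeight_le f
      have : facetHeight f / 2 ≠ 0 := fun h0 => hne ⟨h0, h⟩
      exact ⟨⟨facetHeight f / 2 - 1, by omega⟩, by simp only; omega⟩
    rw [hk, indicator_cell_boundary]
    refine add_mem (Submodule.subset_span ⟨k, Or.inr (Or.inr (Or.inr rfl))⟩)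
      (Submodule.sum_mem _ fun t _ => ?_)
    exact liftLayer_mem_span_stackZGens t (one_add_sideVec_mem m i)
  | some p =>
    obtain ⟨k, P⟩ := p
    obtain ⟨t, q, rfl, rfl, hq⟩ := facetPlaq_eq_some h
    rw [facetHeight_inl, indicator_cell_plaquette t (tri_eq_some_iff.1 hq).1]
    exact liftLayer_mem_span_stackZGens t (Submodule.subset_span ⟨P, rfl⟩)

theorem indicator_plaquette_face_mem {m : ℕ} {f : Option (StackQubit m)} {i j : Fin 3}
    (hij : i ≠ j) (hne : ¬ (facetPlaq f i = none ∧ facetPlaq f j = none)) :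
    {q : StackQubit m | facetPlaq (some q) i = facetPlaq f i ∧
      facetPlaq (some q) j = facetPlaq f j}.indicator (1 : StackQubit m → ZMod 2) ∈
      Submodule.span (ZMod 2) (stackZGens m) := by
  obtain ⟨l, hil, hjl, hl⟩ := exists_third_color hij
  obtain ⟨c, hcl, hc⟩ : ∃ c, c ≠ l ∧ facetPlaq f c ≠ none := by
    rcases not_and_or.1 hne with h | h
    · exact ⟨i, hil, h⟩
    · exact ⟨j, hjl, h⟩
  obtain ⟨⟨k', P⟩, hP⟩ := Option.ne_none_iff_exists'.1 hc
  obtain ⟨t, u, rfl, ht, hu⟩ := facetPlaq_eq_some hP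
  obtain ⟨v, hv⟩ := exists_triAdj_of_ne_none hcl (q := u) (by rw [hu]; exact Option.some_ne_none P)
  obtain ⟨k, hk⟩ : ∃ k : Fin m, ((lowerLayer k : Fin (2 * m)) : ℕ) / 2 = (t : ℕ) / 2 :=
    ⟨⟨t / 2, by omega⟩, by simp only [lowerLayer]; omega⟩
  rw [← (facetPlaq_inl_eq_inl_iff hk).2 (rfl : tri u i = tri u i),
    ← (facetPlaq_inl_eq_inl_iff hk).2 (rfl : tri u j = tri u j), indicator_edge k hl hil hjl hv]
  exact Submodule.subset_span ⟨k, Or.inl ⟨s(u, v), hexGraph_adj_iff.2 ⟨l, hv⟩, rfl⟩⟩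

/-- Faces between two plaquettes, or a plaquette and a boundary, are double lattice edges; those
between a cell and a plaquette are single plaquettes; those between a cell and a boundary are Bell
operators up to plaquettes. Boundaries with each other or with the cell `0` span edges of the
removed tetrahedron. -/
theorem span_faceSets (m : ℕ) :
    Submodule.span (ZMod 2) ((fun s : Set (StackQubit m) =>
      s.indicator (1 : StackQubit m → ZMod 2)) '' faceSets m)
      = Submodule.span (ZMod 2) (stackZGens m) := by
  apply le_antisymm <;> rw [Submodule.span_le]
  · rintro _ ⟨_, ⟨i, j, _, _, hij, ⟨f, rfl, rfl⟩, hne, rfl⟩, rfl⟩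
    dsimp only
    have hzero : 0 / 2 = facetHeight f / 2 ↔ facetHeight f / 2 = 0 := by omega
    rcases i with _ | i <;> rcases j with _ | j
    · exact absurd rfl hij
    · rw [facetLabel_none_eq_iff, facetLabel_some_eq_iff, facetPlaq_none,
        show facetHeight (m := m) none = 0 from rfl, hzero, eq_comm (a := none)] at hne
      simp only [facetLabel_none_eq_iff, facetLabel_some_eq_iff]
      exact indicator_cell_face_mem hne
    · rw [facetLabel_none_eq_iff, facetLabel_some_eq_iff, facetPlaq_none,
        show facetHeight (m := m) none = 0 from rfl, hzero, eq_comm (a := none), and_comm] at hne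
      simp only [facetLabel_none_eq_iff, facetLabel_some_eq_iff, and_comm (a := facetPlaq _ _ = _)]
      exact indicator_cell_face_mem hne
    · rw [facetLabel_some_eq_iff, facetLabel_some_eq_iff, facetPlaq_none, facetPlaq_none,
        eq_comm (a := none), eq_comm (a := none)] at hne
      simp only [facetLabel_some_eq_iff]
      exact indicator_plaquette_face_mem (fun h => hij (congrArg some h)) hne
  · have hplaq : ∀ t P, liftLayer t (plaqMatrix m P) ∈ Submodule.span (ZMod 2)
        ((fun s : Set (StackQubit m) => s.indicator (1 : StackQubit m → ZMod 2)) '' faceSets m) := by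
      intro t P
      obtain ⟨q, hq⟩ := exists_qubit_of_plaquette P
      have hf : facetPlaq (some (Sum.inl (t, q))) (plaqColor P) = some ((t : ℕ) / 2, P) :=
        facetPlaq_inl_eq_some.2 ⟨rfl, hq⟩
      refine Submodule.subset_span ⟨_, ⟨none, some (plaqColor P), _, _,
        (Option.some_ne_none _).symm, ⟨some (Sum.inl (t, q)), rfl, rfl⟩, ?_, rfl⟩, ?_⟩
      · rw [facetLabel_some_eq_iff, facetPlaq_none, hf]
        exact fun h => Option.some_ne_none _ h.2.symm
      · simp only [facetLabel_none_eq_iff, facetLabel_some_eq_iff, hf, facetHeight_inl]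
        exact indicator_cell_plaquette t rfl
    rintro _ ⟨k, ⟨e, he, rfl⟩ | ⟨P, rfl⟩ | ⟨P, rfl⟩ | rfl⟩
    · induction e with
      | _ u v =>
        obtain ⟨l, hv⟩ := hexGraph_adj_iff.1 ((SimpleGraph.mem_edgeSet _).1 he)
        obtain ⟨i, j, hij, hil, hjl, hl⟩ := exists_other_colors l
        refine Submodule.subset_span ⟨_, ⟨some i, some j, _, _, ?_,
          ⟨some (Sum.inl (lowerLayer k, u)), rfl, rfl⟩, ?_, rfl⟩, ?_⟩
        · exact fun h => hij (Option.some.inj h)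
        · rw [facetLabel_some_eq_iff, facetLabel_some_eq_iff, facetPlaq_none, facetPlaq_none,
            eq_comm (a := none), eq_comm (a := none), facetPlaq_inl_eq_none,
            facetPlaq_inl_eq_none]
          rintro ⟨h1, h2⟩
          refine not_triAdj_of_corner (fun c hc => ?_) hv
          rcases hl c hc with rfl | rfl
          · exact h1
          · exact h2
        · simp only [facetLabel_some_eq_iff]
          exact indicator_edge k hl hil hjl hv
    · exact hplaq _ P
    · exact hplaq _ P
    -- The Bell operator is recovered from the face of the cell `k + 1` with the boundary of color
    -- `0`, any color being possible, by removing plaquettes already obtained.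
    · obtain ⟨f, hf1, hf2⟩ := exists_facet_of_cell (m := m) (c := k + 1) k.2 0
      have hface : {q : StackQubit m | facetHeight (some q) / 2 = k + 1 ∧
          facetPlaq (some q) 0 = none}.indicator (1 : StackQubit m → ZMod 2) ∈
          Submodule.span (ZMod 2) ((fun s : Set (StackQubit m) =>
            s.indicator (1 : StackQubit m → ZMod 2)) '' faceSets m) := by
        refine Submodule.subset_span ⟨_, ⟨none, some 0, _, _, (Option.some_ne_none _).symm,
          ⟨f, rfl, rfl⟩, ?_, rfl⟩, ?_⟩
        · rw [facetLabel_none_eq_iff, hf1, show facetHeight (m := m) none = 0 from rfl]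
          omega
        · simp only [facetLabel_none_eq_iff, facetLabel_some_eq_iff, hf1, hf2]
      rw [indicator_cell_boundary] at hface
      refine (Submodule.add_mem_iff_left _ (Submodule.sum_mem _ fun t _ => ?_)).1 hface
      suffices plaqSpan m ≤ (Submodule.span (ZMod 2) ((fun s : Set (StackQubit m) =>
          s.indicator (1 : StackQubit m → ZMod 2)) '' faceSets m)).comap (liftLayer t) from
        this (one_add_sideVec_mem m 0)
      rw [plaqSpan, Submodule.span_le]
      rintro _ ⟨P, rfl⟩
      exact hplaq t P

theorem stackedCode_is3DColorCode {m : ℕ} (hm : 1 ≤ m) {E : Set (Sym2 (HexQubit m))}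
    (hE : IsGaugeEdgeSet m E) : Is3DColorCode (stackedCode m E) := by
  have h := is3DColorCode_of_labelling (facetLabel (m := m)) (by simp) (facetLabel_injective hm)
    (isFourColorableManifold_stack hm)
  rw [stackedCode_eq hE, ← span_cellSets, ← span_faceSets, ← span_xOp_union_zOp]
  convert h using 3
  · ext g
    constructor
    · rintro ⟨_, ⟨i, x, hx, hne, rfl⟩, rfl⟩
      exact ⟨i, x, hx, hne, rfl⟩
    · rintro ⟨i, x, hx, hne, rfl⟩
      exact ⟨_, ⟨i, x, hx, hne, rfl⟩, rfl⟩
  · ext g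
    constructor
    · rintro ⟨_, ⟨i, j, x, y, hij, hx, hne, rfl⟩, rfl⟩
      exact ⟨i, j, x, y, hij, hx, hne, rfl⟩
    · rintro ⟨i, j, x, y, hij, hx, hne, rfl⟩
      exact ⟨_, ⟨i, j, x, y, hij, hx, hne, rfl⟩, rfl⟩

theorem lemma1 (d m : ℕ) (hm : 1 ≤ m) (hd : d = 2 * m + 1)
    (E : Set (Sym2 (HexQubit m))) (hE : IsGaugeEdgeSet m E) :
    (IsStabilizerGroup (hexCode m) ∧ HasCodeDistance (hexCode m) d) ∧
    IsStabilizerGroup (stackedCode m E) ∧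
    Is3DColorCode (stackedCode m E) ∧
    HasCodeDistance (stackedCode m E) d := by
  subst hd
  exact ⟨⟨hexCode_isStabilizerGroup m, hexCode_hasCodeDistance m⟩,
    stackedCode_isStabilizerGroup hE, stackedCode_is3DColorCode hm hE,
    stackedCode_hasCodeDistance hm hE⟩
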